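/- Let $f:[0,1]\to\mathbb{R}^2$ be a simple closed curve ($f$ is continuous, $f(0)=f(1)$, and $f$ is injective on $[0,1)$) that is differentiable with constant non-zero speed, and put $\Gamma_f=f([0,1])$. Let the thickness $\Delta(f)$ be the infimum of the radii of the circles through three distinct points of $\Gamma_f$ (the radius is $\infty$ for collinear points), and let $0<\sigma<\Delta(f)$. Let $H$ be a distribution on $[0,1]$ with a density $h$ satisfying $0<c_1\le h\le c_2<\infty$. Let $F$ be a distribution on $\mathbb{R}^2$ with a bounded density $\phi$ that vanishes for $\|x\|>\sigma$, is continuous and positive for $\|x\|<\sigma$, depends only on $\|x\|$ and is nonincreasing in $\|x\|$, and satisfies $\phi(x)\sim c(\sigma-\|x\|)^\beta$ as $\|x\|\uparrow\sigma$, for some $c>0$ and some $\beta\in[0,\infty)$. Observe $Y_i=f(U_i)+\epsilon_i$, $i=1,\dots,n$, where $U_i\sim H$ and $\epsilon_i\sim F$ are all independent. Put $$\alpha=\beta+\tfrac12,\qquad r_n=\Bigl(\frac{\log n}{n}\Bigr)^{1/(2+\alpha)},\qquad \hat S=\bigcup_{i=1}^n B(Y_i,\varepsilon_n),\qquad \varepsilon_n=C\,r_n,$$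 where $B(x,\rho)$ is the closed disc. Suppose that $\partial\hat S$ is the disjoint union of two simple closed curves $\hat{\partial S}_0$ and $\hat{\partial S}_1$ (labelled in either order), and let $g:[0,1]\to\mathbb{R}^2$ be a parametrization of $\hat{\partial S}_0$ as a simple closed curve. For $y\in\hat{\partial S}_0$ let $\hat\mu(y)$ be the midpoint of the segment from $y$ to a closest point of $\hat{\partial S}_1$ (with any choice among ties), and let $\hat f(u)=\hat\mu(g(u))$ be the fitted curve of the medial estimator. When $\hat f$ is piecewise continuous, i.e. there are $0=a_0<\dots<a_N=1$ such that $\hat f$ is continuous on each $(a_j,a_{j+1})$ with one-sided limits at both ends of that interval, let $f^*$ be the curve that runs through the pieces of $\hat f$ in order and joins $\hat f(a_j^-)$ to $\hat f(a_j^+)$ by a line segment at every jump; the parameters $0$ and $1$ are identified, so that $\hat f(1^-)$ is joined to $\hat f(0^+)$. Let $\Gamma_{f^*}=f^*([0,1])$. **Theorem.** There is a constant $C_0>0$ such that the following holds for every $C\ge C_0$. With probability one, for all sufficiently large $n$, $\partial\hat S$ is the disjoint union of two simple closed curves, and, whatever the labelling, the parametrization and the choice among ties, $\hat f$ is piecewise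 continuous and $f^*$ is a simple closed curve. Furthermore, uniformly over these choices, $$d_H(\Gamma_{f^*},\Gamma_f)=O_P(r_n),$$ where $d_H$ is the Hausdorff distance. -/

import Mathlib

open Set Filter Topology MeasureTheory ProbabilityTheory
open scoped ENNReal

namespace Filament

/-- The Euclidean plane. -/
abbrev Plane : Type := EuclideanSpace ℝ (Fin 2)

/-! ### Curves and thickness -/

/-- The trace of a curve `γ : [0,1] → ℝ²`. -/
def trace (γ : ℝ → Plane) : Set Plane := γ '' Icc 0 1

/-- A simple closed curve parametrized by `[0,1]`. -/
structure IsSimpleClosedCurve (γ : ℝ → Plane) : Prop where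
  continuousOn : ContinuousOn γ (Icc 0 1)
  closed : γ 0 = γ 1
  injOn : InjOn γ (Ico 0 1)

/-- The curve is differentiable on `[0,1]` (one-sidedly at the end points) with constant non-zero
speed, that is, it is parametrized by arclength, normalized to `[0,1]`. -/
def IsArclengthParametrized (γ : ℝ → Plane) : Prop :=
  ∃ ℓ : ℝ, 0 < ℓ ∧ ∀ u ∈ Icc (0 : ℝ) 1, ∃ γ' : Plane,
    HasDerivWithinAt γ γ' (Icc 0 1) u ∧ ‖γ'‖ = ℓ

/-- The radius of the circle through three distinct points of the plane; it is `∞` when the points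
are collinear (no centre `c` qualifies). -/
noncomputable def circleRadius (x y z : Plane) : ℝ≥0∞ :=
  ⨅ (c : Plane) (_ : dist x c = dist y c ∧ dist y c = dist z c), edist x c

/-- The thickness (minimum global radius of curvature) of a set of points. -/
noncomputable def thickness (Γ : Set Plane) : ℝ≥0∞ :=
  ⨅ (x ∈ Γ) (y ∈ Γ) (z ∈ Γ) (_ : x ≠ y ∧ y ≠ z ∧ x ≠ z), circleRadius x y z

/-! ### The model -/

/-- `h` is a density on `[0,1]` that is bounded and bounded away from zero. -/
structure IsDesignDensity (h : ℝ → ℝ) : Prop where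
  measurable : Measurable h
  bounds : ∃ c₁ c₂ : ℝ, 0 < c₁ ∧ ∀ u ∈ Icc (0 : ℝ) 1, c₁ ≤ h u ∧ h u ≤ c₂

/-- The distribution on `[0,1]` with density `h`. -/
noncomputable def designLaw (h : ℝ → ℝ) : Measure ℝ :=
  (volume.restrict (Icc (0 : ℝ) 1)).withDensity fun u => ENNReal.ofReal (h u)

/-- The conditions on the noise density `φ`: it vanishes off the closed disc of radius `σ`, is
bounded, continuous and positive on the open disc (so that the uniform density is
included), is a nonincreasing function of the norm, and decays like `(σ - ‖x‖) ^ β` at the edge. -/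
structure IsNoiseDensity (σ β : ℝ) (φ : Plane → ℝ) : Prop where
  measurable : Measurable φ
  nonneg : ∀ x, 0 ≤ φ x
  bounded : ∃ M : ℝ, ∀ x, φ x ≤ M
  eq_zero : ∀ x, σ < ‖x‖ → φ x = 0
  pos : ∀ x, ‖x‖ < σ → 0 < φ x
  continuousOn : ContinuousOn φ (Metric.ball 0 σ)
  nonincreasing : ∀ x y, ‖x‖ ≤ ‖y‖ → φ y ≤ φ x
  symmetric : ∀ x y, ‖x‖ = ‖y‖ → φ x = φ y
  edge : ∃ C : ℝ, 0 < C ∧ Asymptotics.IsEquivalent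
    (comap (fun x : Plane => ‖x‖) (𝓝[<] σ)) φ (fun x => C * (σ - ‖x‖) ^ β)

/-- The distribution on the plane with density `φ`. -/
noncomputable def noiseLaw (φ : Plane → ℝ) : Measure Plane :=
  volume.withDensity fun x => ENNReal.ofReal (φ x)

/-- The observations `Yᵢ = f(Uᵢ) + εᵢ`. -/
def observation {Ω : Type*} (f : ℝ → Plane) (U : ℕ → Ω → ℝ) (ε : ℕ → Ω → Plane)
    (i : ℕ) (ω : Ω) : Plane :=
  f (U i ω) + ε i ω

/-- The rate `(log n / n) ^ (1 / (2 + α))` with `α = β + 1/2`. -/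
noncomputable def rate (β : ℝ) (n : ℕ) : ℝ :=
  (Real.log n / n) ^ (1 / (2 + (β + 1 / 2)))

/-- The union-of-balls estimator with radius `ρ` from the first `n` points. -/
def unionOfBalls (y : ℕ → Plane) (n : ℕ) (ρ : ℝ) : Set Plane :=
  ⋃ i ∈ Finset.range n, Metric.closedBall (y i) ρ

/-! ### The medial estimator and its completion -/

/-- The boundary of `S` consists of two disjoint simple closed curves, parametrized by `g₀` and
`g₁` (in either order). -/
structure IsBoundaryPair (S : Set Plane) (g₀ g₁ : ℝ → Plane) : Prop where
  simple₀ : IsSimpleClosedCurve g₀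
  simple₁ : IsSimpleClosedCurve g₁
  disjoint : Disjoint (trace g₀) (trace g₁)
  union : trace g₀ ∪ trace g₁ = frontier S

/-- `p` assigns to each point of `A` a closest point of `B`. -/
def IsClosestPointMap (A B : Set Plane) (p : Plane → Plane) : Prop :=
  ∀ y ∈ A, p y ∈ B ∧ ∀ z ∈ B, dist y (p y) ≤ dist y z

/-- `F` is a fitted curve of the medial estimator for the support estimate `S`: `F u` is the
midpoint of the segment from `g₀ u` to a closest point on the other boundary curve. -/
def IsMedialFit (S : Set Plane) (F : ℝ → Plane) : Prop :=
  ∃ (g₀ g₁ : ℝ → Plane) (p : Plane → Plane), IsBoundaryPair S g₀ g₁ ∧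
    IsClosestPointMap (trace g₀) (trace g₁) p ∧
    F = fun u => midpoint ℝ (g₀ u) (p (g₀ u))

/-- `F` is continuous on each open piece `(aⱼ, aⱼ₊₁)` of a partition `0 = a₀ < ⋯ < a_N = 1`, with
right limit `r j` at `aⱼ` and left limit `l (j + 1)` at `aⱼ₊₁`. The end points `0` and `1` of the
parameter interval are identified, so `r N = r 0`. -/
structure IsPiecewiseContinuousWith (F : ℝ → Plane) (N : ℕ) (a : ℕ → ℝ) (l r : ℕ → Plane) :
    Prop where
  pos : 0 < N
  first : a 0 = 0
  last : a N = 1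
  lt : ∀ j < N, a j < a (j + 1)
  continuousOn : ∀ j < N, ContinuousOn F (Ioo (a j) (a (j + 1)))
  right : ∀ j < N, Tendsto F (𝓝[>] a j) (𝓝 (r j))
  left : ∀ j < N, Tendsto F (𝓝[<] a (j + 1)) (𝓝 (l (j + 1)))
  wrap : r N = r 0

/-- `F` is piecewise continuous on `[0,1]` (finitely many pieces, with one-sided limits). -/
def IsPiecewiseContinuous (F : ℝ → Plane) : Prop :=
  ∃ (N : ℕ) (a : ℕ → ℝ) (l r : ℕ → Plane), IsPiecewiseContinuousWith F N a l r

/-- `G` is the curve obtained from the piecewise continuous `F` by joining the one-sided limits at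
every jump by a line segment. The `j`-th piece of `F` is run (affinely) during the time interval
`[s j, t j]` and the segment from `l (j + 1)` to `r (j + 1)` during `[t j, s (j + 1)]`; the latter
interval is a single instant exactly when there is no jump. The last segment joins the left limit
at `1` to the right limit at `0`. -/
def IsCompletion (F G : ℝ → Plane) : Prop :=
  ∃ (N : ℕ) (a : ℕ → ℝ) (l r : ℕ → Plane) (s t : ℕ → ℝ),
    IsPiecewiseContinuousWith F N a l r ∧
    s 0 = 0 ∧ s N = 1 ∧
    (∀ j < N, s j < t j ∧ t j ≤ s (j + 1) ∧ (t j = s (j + 1) ↔ l (j + 1) = r (j + 1))) ∧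
    G 0 = r 0 ∧
    (∀ j < N, ∀ x ∈ Ioo (0 : ℝ) 1, G (AffineMap.lineMap (s j) (t j) x) =
      F (AffineMap.lineMap (a j) (a (j + 1)) x)) ∧
    (∀ j < N, ∀ x ∈ Icc (0 : ℝ) 1, G (AffineMap.lineMap (t j) (s (j + 1)) x) =
      AffineMap.lineMap (l (j + 1)) (r (j + 1)) x)

/-- The completed medial estimators (one for each labelling and parametrization of the two boundary
curves, each choice among tied closest points, and each time scale). -/
def completedMedialEstimators (S : Set Plane) : Set (ℝ → Plane) :=
  {G | ∃ F, IsMedialFit S F ∧ IsCompletion F G}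

/-- `X n = O_P(r n)`. (`P` of a set that is not measurable is its outer measure.) -/
def IsBigOP {Ω : Type*} [MeasurableSpace Ω] (P : Measure Ω) (X : ℕ → Ω → ℝ≥0∞) (r : ℕ → ℝ) :
    Prop :=
  ∀ η : ℝ, 0 < η → ∃ K : ℝ, 0 < K ∧
    ∀ᶠ n in atTop, P {ω | ENNReal.ofReal (K * r n) < X n ω} ≤ ENNReal.ofReal η

end Filament

/-!
Positive thickness means that the open discs of some radius `τ > σ` tangent to the curve do not meet
it. They give a continuous unit tangent and normal coordinates in the tube of radius `τ`. When the
first `n` observations are an `ε / 2`-net of the closed `σ`-tube, the union of the `ε`-balls meets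
every normal segment of length `τ` in an initial segment, of length between `σ + ε / 2` and `σ + ε`;
hence its boundary consists of two graphs over the curve, one on each side.

The segment from a boundary point to a closest point on the opposite side is at most `2 σ + 2 ε`
long and has to cross the curve, so it does so within `ε` of its midpoint. If the closest point
lay on one circle only, the segment would extend the radius and be too short to reach the curve.
So closest points are vertices of the boundary, and there are finitely many of them and finitely
many ties. Since closest points are monotone, a point of the completed curve determines the boundary
point it comes from, which makes the completed curve simple. The jumps have length `O(√ε)`, so by
curvature the completed curve stays within `O(ε)` of the original one; conversely it crosses every
normal line, by the intermediate value theorem.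

A disc of radius `ε` around a point of the closed tube has probability at least of order
`ε ^ (β + 5 / 2)`: the factor `ε ^ β` comes from the edge of the noise density, `ε ^ 2` from the
area and `ε ^ (1 / 2)` from the stretch of curve whose noise discs reach it. With
`ε = C * rate β n` and `C` large, a union bound over a net of the tube and the Borel–Cantelli
lemma finish the proof.
-/

namespace Filament

/-! ### Plane geometry -/

instance : Fact (Module.finrank ℝ Plane = 2) := ⟨finrank_euclideanSpace_fin⟩

/-- Rotation of the plane by a right angle; `inner ℝ (perp v) w` is the determinant of `v` and `w`
up to a sign that depends on the choice of orientation and never matters. -/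
noncomputable def perp : Plane ≃ₗᵢ[ℝ] Plane :=
  (EuclideanSpace.basisFun (Fin 2) ℝ).toBasis.orientation.rightAngleRotation

lemma inner_perp_self (v : Plane) : inner ℝ (perp v) v = 0 :=
  Orientation.inner_rightAngleRotation_self _ v

lemma inner_perp_swap (v w : Plane) : inner ℝ (perp w) v = -inner ℝ (perp v) w := by
  rw [real_inner_comm]
  exact Orientation.inner_rightAngleRotation_swap _ v w

lemma inner_sq_add_inner_perp_sq (v w : Plane) :
    inner ℝ v w ^ 2 + inner ℝ (perp v) w ^ 2 = ‖v‖ ^ 2 * ‖w‖ ^ 2 := by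
  rw [perp, Orientation.inner_rightAngleRotation_left, Orientation.inner_sq_add_areaForm_sq]

lemma inner_sq_add_inner_perp_sq_of_norm_eq_one {T : Plane} (hT : ‖T‖ = 1) (v : Plane) :
    inner ℝ T v ^ 2 + inner ℝ (perp T) v ^ 2 = ‖v‖ ^ 2 := by
  rw [inner_sq_add_inner_perp_sq, hT, one_pow, one_mul]

lemma norm_norm_sq_smul_sub {E : Type*} [NormedAddCommGroup E] [InnerProductSpace ℝ E] (a b : E) :
    ‖‖b‖ ^ 2 • a - ‖a‖ ^ 2 • b‖ = ‖a‖ * ‖b‖ * ‖a - b‖ := by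
  rw [← sq_eq_sq₀ (norm_nonneg _) (by positivity), mul_pow, norm_sub_sq_real a b,
    norm_sub_sq_real, norm_smul, norm_smul, real_inner_smul_left, real_inner_smul_right]
  simp only [norm_pow, norm_norm]
  ring

lemma norm_sub_eq_norm_of_inner_eq {E : Type*} [NormedAddCommGroup E] [InnerProductSpace ℝ E]
    {a w : E} (h : 2 * inner ℝ w a = ‖a‖ ^ 2) : ‖a - w‖ = ‖w‖ := by
  rw [← sq_eq_sq₀ (norm_nonneg _) (norm_nonneg _), norm_sub_sq_real, real_inner_comm, h]
  ring

lemma exists_circumcenter {a b : Plane} (hab : inner ℝ (perp a) b ≠ 0) :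
    ∃ w : Plane, ‖a - w‖ = ‖w‖ ∧ ‖b - w‖ = ‖w‖ ∧
      2 * |inner ℝ (perp a) b| * ‖w‖ = ‖a‖ * ‖b‖ * ‖a - b‖ := by
  set D := inner ℝ (perp a) b
  refine ⟨(2 * D)⁻¹ • perp (‖b‖ ^ 2 • a - ‖a‖ ^ 2 • b), norm_sub_eq_norm_of_inner_eq ?_,
    norm_sub_eq_norm_of_inner_eq ?_, ?_⟩
  · rw [map_sub, map_smul, map_smul, real_inner_smul_left, inner_sub_left, real_inner_smul_left,
      real_inner_smul_left, inner_perp_self, inner_perp_swap]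
    field_simp
    ring
  · rw [map_sub, map_smul, map_smul, real_inner_smul_left, inner_sub_left, real_inner_smul_left,
      real_inner_smul_left, inner_perp_self]
    field_simp
    ring
  · rw [norm_smul, LinearIsometryEquiv.norm_map, norm_norm_sq_smul_sub, norm_inv, norm_mul,
      Real.norm_two, Real.norm_eq_abs]
    field_simp [abs_ne_zero.2 hab]

lemma thickness_le_edist {Γ : Set Plane} {x y z c : Plane} (hx : x ∈ Γ) (hy : y ∈ Γ) (hz : z ∈ Γ)
    (hxy : x ≠ y) (hyz : y ≠ z) (hxz : x ≠ z) (hxc : dist x c = dist y c)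
    (hyc : dist y c = dist z c) : thickness Γ ≤ edist x c :=
  (iInf₂_le x hx).trans <| (iInf₂_le y hy).trans <| (iInf₂_le z hz).trans <|
    (iInf_le _ ⟨hxy, hyz, hxz⟩).trans (iInf₂_le c ⟨hxc, hyc⟩)

/-- The circumradius of a triangle is the product of its sides divided by four times its area. -/
lemma thickness_le_circumradius {Γ : Set Plane} {τ : ℝ} (hΓ : ENNReal.ofReal τ ≤ thickness Γ)
    {x y z : Plane} (hx : x ∈ Γ) (hy : y ∈ Γ) (hz : z ∈ Γ) :
    2 * τ * |inner ℝ (perp (y - x)) (z - x)| ≤ ‖y - x‖ * ‖z - x‖ * ‖y - z‖ := by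
  rcases eq_or_ne (inner ℝ (perp (y - x)) (z - x)) 0 with hD | hD
  · rw [hD, abs_zero, mul_zero]
    positivity
  obtain ⟨w, hyw, hzw, hw⟩ := exists_circumcenter hD
  have hxy : x ≠ y := by rintro rfl; simp at hD
  have hxz : x ≠ z := by rintro rfl; simp at hD
  have hyz : y ≠ z := by rintro rfl; exact hD (inner_perp_self _)
  have hxc : dist x (x + w) = ‖w‖ := by simp
  have hyc : dist y (x + w) = ‖w‖ := by rw [dist_eq_norm, ← sub_sub, hyw]
  have hzc : dist z (x + w) = ‖w‖ := by rw [dist_eq_norm, ← sub_sub, hzw]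
  have hτw : τ ≤ ‖w‖ := by
    have := hΓ.trans (thickness_le_edist hx hy hz hxy hyz hxz (hxc.trans hyc.symm)
      (hyc.trans hzc.symm))
    rwa [edist_dist, ENNReal.ofReal_le_ofReal_iff dist_nonneg, hxc] at this
  calc 2 * τ * |inner ℝ (perp (y - x)) (z - x)|
      = 2 * |inner ℝ (perp (y - x)) (z - x)| * τ := by ring
    _ ≤ 2 * |inner ℝ (perp (y - x)) (z - x)| * ‖w‖ := by gcongr
    _ = ‖y - x‖ * ‖z - x‖ * ‖y - z‖ := by rw [hw, sub_sub_sub_cancel_right]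

/-! ### Simple closed curves -/

namespace IsSimpleClosedCurve
variable {g : ℝ → Plane}

lemma isCompact_trace (hg : IsSimpleClosedCurve g) : IsCompact (trace g) :=
  isCompact_Icc.image_of_continuousOn hg.continuousOn

lemma isPreconnected_trace (hg : IsSimpleClosedCurve g) : IsPreconnected (trace g) :=
  isPreconnected_Icc.image _ hg.continuousOn

lemma ne_of_lt (hg : IsSimpleClosedCurve g) {u v : ℝ} (hu : 0 ≤ u) (huv : u < v) (hv : v ≤ 1)
    (h1 : v - u < 1) : g v ≠ g u := by
  intro he
  rcases hv.eq_or_lt with rfl | hv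
  · rw [← hg.closed] at he
    linarith [hg.injOn (by simp) ⟨hu, huv⟩ he]
  · linarith [hg.injOn ⟨hu.trans huv.le, hv⟩ ⟨hu, huv.trans hv⟩ he]

lemma injOn_Ioc (hg : IsSimpleClosedCurve g) : InjOn g (Ioc 0 1) := by
  intro u hu v hv huv
  rcases lt_trichotomy u v with h | h | h
  · exact (hg.ne_of_lt hu.1.le h hv.2 (by linarith [hu.1, hv.2]) huv.symm).elim
  · exact h
  · exact (hg.ne_of_lt hv.1.le h hu.2 (by linarith [hv.1, hu.2]) huv).elim

lemma reverse (hg : IsSimpleClosedCurve g) : IsSimpleClosedCurve fun u => g (1 - u) where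
  continuousOn := hg.continuousOn.comp (by fun_prop)
    fun _ hu => ⟨sub_nonneg.2 hu.2, sub_le_self 1 hu.1⟩
  closed := by simp [hg.closed]
  injOn u hu v hv huv := sub_right_injective <| hg.injOn_Ioc
    ⟨sub_pos.2 hu.2, sub_le_self 1 hu.1⟩ ⟨sub_pos.2 hv.2, sub_le_self 1 hv.1⟩ huv

end IsSimpleClosedCurve

lemma trace_nonempty (g : ℝ → Plane) : (trace g).Nonempty := (nonempty_Icc.2 zero_le_one).image g

/-! ### Unit tangents of a curve with positive thickness -/

lemma abs_inner_perp_deriv_le {f : ℝ → Plane} {s : Set ℝ} {τ : ℝ}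
    (hthick : ENNReal.ofReal τ ≤ thickness (f '' s)) {u v : ℝ} (hu : u ∈ s) (hv : v ∈ s)
    (hs : UniqueDiffWithinAt ℝ s u) {D : Plane} (hD : HasDerivWithinAt f D s u) :
    2 * τ * |inner ℝ (perp D) (f v - f u)| ≤ ‖D‖ * ‖f v - f u‖ ^ 2 := by
  have : (𝓝[s \ {u}] u).NeBot := accPt_principal_iff_nhdsWithin.1 hs.accPt
  have hslope := hasDerivWithinAt_iff_tendsto_slope.1 hD
  have hcont : Tendsto f (𝓝[s \ {u}] u) (𝓝 (f u)) :=
    hD.continuousWithinAt.mono_left (nhdsWithin_mono _ sdiff_subset)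
  have hleft : Tendsto (fun w => 2 * τ * |inner ℝ (perp (slope f u w)) (f v - f u)|)
      (𝓝[s \ {u}] u) (𝓝 (2 * τ * |inner ℝ (perp D) (f v - f u)|)) :=
    ((((perp.continuous.tendsto _).comp hslope).inner tendsto_const_nhds).abs).const_mul _
  have hright : Tendsto (fun w => ‖slope f u w‖ * ‖f v - f u‖ * ‖f w - f v‖)
      (𝓝[s \ {u}] u) (𝓝 (‖D‖ * ‖f v - f u‖ * ‖f u - f v‖)) :=
    (hslope.norm.mul_const _).mul (hcont.sub_const _).norm
  rw [sq, ← mul_assoc, norm_sub_rev (f v) (f u)] at *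
  refine le_of_tendsto_of_tendsto hleft hright ?_
  filter_upwards [self_mem_nhdsWithin] with w hw
  have := thickness_le_circumradius hthick (mem_image_of_mem f hu) (mem_image_of_mem f hw.1)
    (mem_image_of_mem f hv)
  rw [slope_def_module, map_smul, real_inner_smul_left, abs_mul, norm_smul, Real.norm_eq_abs]
  calc 2 * τ * (|(w - u)⁻¹| * |inner ℝ (perp (f w - f u)) (f v - f u)|)
      = |(w - u)⁻¹| * (2 * τ * |inner ℝ (perp (f w - f u)) (f v - f u)|) := by ring
    _ ≤ |(w - u)⁻¹| * (‖f w - f u‖ * ‖f v - f u‖ * ‖f w - f v‖) := by gcongr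
    _ = |(w - u)⁻¹| * ‖f w - f u‖ * ‖f u - f v‖ * ‖f w - f v‖ := by
      rw [norm_sub_rev (f v) (f u)]; ring

/-- `T` is the unit tangent of the simple closed curve `f` of speed `ℓ`, and no point of the curve
lies in the two open discs of radius `τ` that are tangent to it at `f u`. -/
structure HasUnitTangent (f T : ℝ → Plane) (ℓ τ : ℝ) : Prop where
  simple : IsSimpleClosedCurve f
  speed_pos : 0 < ℓ
  radius_pos : 0 < τ
  deriv : ∀ u ∈ Icc (0 : ℝ) 1, HasDerivWithinAt f (ℓ • T u) (Icc 0 1) u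
  norm_eq : ∀ u ∈ Icc (0 : ℝ) 1, ‖T u‖ = 1
  disc : ∀ u ∈ Icc (0 : ℝ) 1, ∀ v ∈ Icc (0 : ℝ) 1,
    2 * τ * |inner ℝ (perp (T u)) (f v - f u)| ≤ ‖f v - f u‖ ^ 2

lemma exists_hasUnitTangent {f : ℝ → Plane} (hf : IsSimpleClosedCurve f)
    (hf_arc : IsArclengthParametrized f) {τ : ℝ} (hτ : 0 < τ)
    (hthick : ENNReal.ofReal τ ≤ thickness (trace f)) : ∃ T ℓ, HasUnitTangent f T ℓ τ := by
  obtain ⟨ℓ, hℓ, h⟩ := hf_arc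
  choose! D hD hDℓ using h
  refine ⟨fun u => ℓ⁻¹ • D u, ℓ, hf, hℓ, hτ, fun u hu => ?_, fun u hu => ?_, fun u hu v hv => ?_⟩
  · rw [smul_inv_smul₀ hℓ.ne']
    exact hD u hu
  · rw [norm_smul, hDℓ u hu, norm_inv, Real.norm_of_nonneg hℓ.le, inv_mul_cancel₀ hℓ.ne']
  · have hdisc := abs_inner_perp_deriv_le hthick hu hv (uniqueDiffOn_Icc_zero_one u hu) (hD u hu)
    rw [hDℓ u hu] at hdisc
    rw [map_smul, real_inner_smul_left, abs_mul, abs_of_pos (inv_pos.2 hℓ), mul_left_comm,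
      inv_mul_le_iff₀ hℓ]
    exact hdisc

lemma inner_ne_zero_of_disc {T T' e : Plane} {τ : ℝ} (hT : ‖T‖ = 1) (he : e ≠ 0)
    (hdisc : 2 * τ * |inner ℝ (perp T') e| ≤ ‖e‖ ^ 2) (hτ : 0 < τ)
    (hshort : ‖e‖ < 2 * τ * (1 - ‖T - T'‖)) : inner ℝ T e ≠ 0 := by
  intro h0
  have hnormal : |inner ℝ (perp T) e| = ‖e‖ := by
    rw [← sq_eq_sq₀ (abs_nonneg _) (norm_nonneg _), sq_abs,
      ← inner_sq_add_inner_perp_sq_of_norm_eq_one hT, h0]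
    ring
  have hdiff : |inner ℝ (perp T) e - inner ℝ (perp T') e| ≤ ‖T - T'‖ * ‖e‖ := by
    rw [← inner_sub_left, ← map_sub, ← perp.norm_map (T - T')]
    exact abs_real_inner_le_norm _ _
  have hnormal' : (1 - ‖T - T'‖) * ‖e‖ ≤ |inner ℝ (perp T') e| := by
    linarith [abs_sub_abs_le_abs_sub (inner ℝ (perp T) e) (inner ℝ (perp T') e)]
  have hpos := norm_pos_iff.2 he
  have : 2 * τ * (1 - ‖T - T'‖) * ‖e‖ ≤ ‖e‖ * ‖e‖ := by
    rw [mul_assoc, ← sq]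
    exact (by gcongr : _ ≤ 2 * τ * |inner ℝ (perp T') e|).trans hdisc
  exact hshort.not_ge (le_of_mul_le_mul_right this hpos)

lemma norm_sub_normalize_le {T e : Plane} {τ : ℝ} (hT : ‖T‖ = 1) (hτ : 0 < τ) (he : e ≠ 0)
    (hpos : 0 < inner ℝ T e) (hdisc : 2 * τ * |inner ℝ (perp T) e| ≤ ‖e‖ ^ 2) :
    ‖T - ‖e‖⁻¹ • e‖ ≤ ‖e‖ / τ := by
  have hd : 0 < ‖e‖ := norm_pos_iff.2 he
  have hpyth := inner_sq_add_inner_perp_sq_of_norm_eq_one hT e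
  have hle : inner ℝ T e ≤ ‖e‖ := by simpa [hT] using real_inner_le_norm T e
  have hnormal : inner ℝ (perp T) e ^ 2 ≤ (‖e‖ ^ 2 / (2 * τ)) ^ 2 :=
    sq_le_sq' (neg_le_of_abs_le <| (le_div_iff₀' (by positivity)).2 hdisc)
      (le_of_abs_le <| (le_div_iff₀' (by positivity)).2 hdisc)
  refine (sq_le_sq₀ (norm_nonneg _) (by positivity)).1 ?_
  calc ‖T - ‖e‖⁻¹ • e‖ ^ 2 = 2 * (1 - inner ℝ T e / ‖e‖) := by
        rw [norm_sub_sq_real, hT, norm_smul, real_inner_smul_right, norm_inv, norm_norm,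
          inv_mul_cancel₀ hd.ne']
        ring
    _ ≤ 2 * (1 - (inner ℝ T e / ‖e‖) ^ 2) := by
        have : inner ℝ T e / ‖e‖ ≤ 1 := (div_le_one hd).2 hle
        have : 0 ≤ inner ℝ T e / ‖e‖ := by positivity
        nlinarith
    _ = 2 * (inner ℝ (perp T) e ^ 2 / ‖e‖ ^ 2) := by
        rw [div_pow, eq_sub_of_add_eq hpyth]
        field_simp
        rw [sub_sub_cancel]
    _ ≤ 2 * ((‖e‖ ^ 2 / (2 * τ)) ^ 2 / ‖e‖ ^ 2) := by gcongr
    _ = (‖e‖ / τ) ^ 2 / 2 := by field_simp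
    _ ≤ (‖e‖ / τ) ^ 2 := half_le_self (by positivity)

lemma exists_mem_Ioc_exists_mem_Ico_eq {φ : ℝ → ℝ} {x y c d : ℝ} (hφ : ContinuousOn φ (Icc x y))
    (hxc : x ≤ c) (hcd : c < d) (hx : φ x = 0) (hy : φ y = 0) (hc : 0 < φ c) (hd : 0 < φ d)
    (hdy : d ≤ y) : ∃ a ∈ Ioc x c, ∃ b ∈ Ico d y, φ a = φ b := by
  have hm : 0 < min (φ c) (φ d) := lt_min hc hd
  obtain ⟨a, ha, hma⟩ := intermediate_value_Icc hxc
    (hφ.mono (Icc_subset_Icc le_rfl (hcd.le.trans hdy))) ⟨hx.trans_le hm.le, min_le_left _ _⟩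
  obtain ⟨b, hb, hmb⟩ := intermediate_value_Icc' hdy
    (hφ.mono (Icc_subset_Icc (hxc.trans hcd.le) le_rfl)) ⟨hy.trans_le hm.le, min_le_right _ _⟩
  refine ⟨a, ⟨ha.1.lt_of_ne ?_, ha.2⟩, b, ⟨hb.1, hb.2.lt_of_ne ?_⟩, hma.trans hmb.symm⟩
  · rintro rfl
    exact hm.ne (hx.symm.trans hma)
  · rintro rfl
    exact hm.ne (hy.symm.trans hmb)

namespace HasUnitTangent
variable {f T : ℝ → Plane} {ℓ τ : ℝ}

lemma reverse (h : HasUnitTangent f T ℓ τ) :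
    HasUnitTangent (fun u => f (1 - u)) (fun u => -T (1 - u)) ℓ τ := by
  have hmem : MapsTo (fun u : ℝ => 1 - u) (Icc 0 1) (Icc 0 1) :=
    fun u hu => ⟨sub_nonneg.2 hu.2, sub_le_self 1 hu.1⟩
  refine ⟨h.simple.reverse, h.speed_pos, h.radius_pos, fun u hu => ?_, fun u hu => ?_,
    fun u hu v hv => ?_⟩
  · have hsub : HasDerivWithinAt (fun u : ℝ => 1 - u) (-1) (Icc 0 1) u :=
      ((hasDerivAt_id u).const_sub 1).hasDerivWithinAt
    simpa only [neg_smul, one_smul, smul_neg] using! (h.deriv _ (hmem hu)).scomp u hsub hmem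
  · rw [norm_neg, h.norm_eq _ (hmem hu)]
  · rw [map_neg, inner_neg_left, abs_neg]
    exact h.disc _ (hmem hu) _ (hmem hv)

lemma norm_sub_le (h : HasUnitTangent f T ℓ τ) {u v : ℝ} (hu : u ∈ Icc (0 : ℝ) 1)
    (hv : v ∈ Icc (0 : ℝ) 1) : ‖f v - f u‖ ≤ ℓ * |v - u| := by
  refine (convex_Icc (0 : ℝ) 1).norm_image_sub_le_of_norm_hasDerivWithin_le
    (fun x hx => h.deriv x hx) (fun x hx => ?_) hu hv
  rw [norm_smul, h.norm_eq x hx, Real.norm_of_nonneg h.speed_pos.le, mul_one]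

lemma inner_ne_zero (h : HasUnitTangent f T ℓ τ) {u v : ℝ} (hu : 0 ≤ u) (huv : u < v) (hv : v ≤ 1)
    (h1 : v - u < 1) (hτ : ℓ * (v - u) ≤ τ) : inner ℝ (T u) (f v - f u) ≠ 0 := by
  have hu' : u ∈ Icc (0 : ℝ) 1 := ⟨hu, huv.le.trans hv⟩
  have hv' : v ∈ Icc (0 : ℝ) 1 := ⟨hu.trans huv.le, hv⟩
  refine inner_ne_zero_of_disc (h.norm_eq u hu') (sub_ne_zero.2 (h.simple.ne_of_lt hu huv hv h1))
    (h.disc u hu' v hv') h.radius_pos ?_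
  have := h.norm_sub_le hu' hv'
  rw [abs_of_pos (sub_pos.2 huv)] at this
  rw [sub_self, norm_zero]
  linarith [h.radius_pos]

lemma exists_inner_pos (h : HasUnitTangent f T ℓ τ) {u v : ℝ} (hu : 0 ≤ u) (huv : u < v)
    (hv : v ≤ 1) : ∃ w ∈ Ioc u v, 0 < inner ℝ (T u) (f w - f u) := by
  have hu' : u ∈ Icc (0 : ℝ) 1 := ⟨hu, huv.le.trans hv⟩
  have hderiv : HasDerivWithinAt (fun w => inner ℝ (T u) (f w - f u)) ℓ (Icc u v) u := by
    have := (hasDerivWithinAt_const u (Icc u v) (T u)).inner ℝ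
      (((h.deriv u hu').mono (Icc_subset_Icc hu hv)).sub_const (f u))
    simpa [real_inner_smul_right, real_inner_self_eq_norm_sq, h.norm_eq u hu'] using this
  have : (𝓝[Icc u v \ {u}] u).NeBot := by
    rw [Icc_sdiff_left]
    exact left_nhdsWithin_Ioc_neBot huv
  obtain ⟨w, hslope, hw, hwu⟩ := (((hasDerivWithinAt_iff_tendsto_slope.1 hderiv).eventually
    (lt_mem_nhds h.speed_pos)).and self_mem_nhdsWithin).exists
  have huw : u < w := lt_of_le_of_ne hw.1 (Ne.symm hwu)
  refine ⟨w, ⟨huw, hw.2⟩, ?_⟩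
  rw [slope_def_field, sub_self, inner_zero_right, sub_zero] at hslope
  exact (div_pos_iff_of_pos_right (sub_pos.2 huw)).1 hslope

lemma inner_pos (h : HasUnitTangent f T ℓ τ) {u v : ℝ} (hu : 0 ≤ u) (huv : u < v) (hv : v ≤ 1)
    (h1 : v - u < 1) (hτ : ℓ * (v - u) ≤ τ) : 0 < inner ℝ (T u) (f v - f u) := by
  obtain ⟨w, hw, hwpos⟩ := h.exists_inner_pos hu huv hv
  by_contra! hneg
  have hcont : ContinuousOn (fun w => inner ℝ (T u) (f w - f u)) (Icc w v) :=
    continuousOn_const.inner ((h.simple.continuousOn.mono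
      (Icc_subset_Icc (hu.trans hw.1.le) hv)).sub continuousOn_const)
  obtain ⟨x, hx, hx0⟩ := intermediate_value_Icc' hw.2 hcont ⟨hneg, hwpos.le⟩
  have hxτ : ℓ * (x - u) ≤ ℓ * (v - u) :=
    mul_le_mul_of_nonneg_left (sub_le_sub_right hx.2 u) h.speed_pos.le
  exact h.inner_ne_zero hu (hw.1.trans_le hx.1) (hx.2.trans hv) (by linarith [hx.2])
    (hxτ.trans hτ) hx0

lemma inner_pos_of_lt (h : HasUnitTangent f T ℓ τ) {u v : ℝ} (hu : 0 ≤ u) (huv : u < v)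
    (hv : v ≤ 1) (h1 : v - u < 1) (hτ : ℓ * (v - u) ≤ τ) : 0 < inner ℝ (T v) (f v - f u) := by
  have := h.reverse.inner_pos (u := 1 - v) (v := 1 - u) (by linarith) (by linarith)
    (by linarith) (by linarith) (by linarith)
  rwa [sub_sub_cancel, sub_sub_cancel, inner_neg_left, ← inner_neg_right, neg_sub] at this

lemma norm_tangent_sub_le (h : HasUnitTangent f T ℓ τ) {u v : ℝ} (hu : 0 ≤ u) (huv : u < v)
    (hv : v ≤ 1) (h1 : v - u < 1) (hτ : ℓ * (v - u) ≤ τ) :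
    ‖T u - T v‖ ≤ 2 * ℓ / τ * (v - u) := by
  have hu' : u ∈ Icc (0 : ℝ) 1 := ⟨hu, huv.le.trans hv⟩
  have hv' : v ∈ Icc (0 : ℝ) 1 := ⟨hu.trans huv.le, hv⟩
  have hne : f v - f u ≠ 0 := sub_ne_zero.2 (h.simple.ne_of_lt hu huv hv h1)
  have hlen := h.norm_sub_le hu' hv'
  rw [abs_of_pos (sub_pos.2 huv)] at hlen
  have hdisc : 2 * τ * |inner ℝ (perp (T v)) (f v - f u)| ≤ ‖f v - f u‖ ^ 2 := by
    rw [← neg_sub (f u) (f v), inner_neg_right, abs_neg, norm_neg]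
    exact h.disc v hv' u hu'
  have hchord_u := norm_sub_normalize_le (h.norm_eq u hu') h.radius_pos hne
    (h.inner_pos hu huv hv h1 hτ) (h.disc u hu' v hv')
  have hchord_v := norm_sub_normalize_le (h.norm_eq v hv') h.radius_pos hne
    (h.inner_pos_of_lt hu huv hv h1 hτ) hdisc
  rw [norm_sub_rev] at hchord_v
  calc ‖T u - T v‖ ≤ ‖f v - f u‖ / τ + ‖f v - f u‖ / τ :=
        (norm_sub_le_norm_sub_add_norm_sub _ _ _).trans (add_le_add hchord_u hchord_v)
    _ ≤ ℓ * (v - u) / τ + ℓ * (v - u) / τ := by gcongr <;> exact h.radius_pos.le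
    _ = 2 * ℓ / τ * (v - u) := by ring

lemma continuousOn_tangent (h : HasUnitTangent f T ℓ τ) : ContinuousOn T (Icc 0 1) := by
  have hℓ := h.speed_pos
  have hτ := h.radius_pos
  rw [Metric.continuousOn_iff]
  intro v hv e he
  refine ⟨min (min (1 / 2) (τ / ℓ)) (e / (2 * ℓ / τ)), by positivity, fun u hu hd => ?_⟩
  rw [lt_min_iff, lt_min_iff, lt_div_iff₀ hℓ, lt_div_iff₀' (c := 2 * ℓ / τ) (by positivity),
    Real.dist_eq] at hd
  rw [dist_eq_norm]
  rcases lt_trichotomy u v with huv | rfl | huv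
  · rw [abs_of_neg (sub_neg.2 huv), neg_sub] at hd
    exact (h.norm_tangent_sub_le hu.1 huv hv.2 (by linarith) (by linarith)).trans_lt hd.2
  · rwa [sub_self, norm_zero]
  · rw [abs_of_pos (sub_pos.2 huv)] at hd
    rw [norm_sub_rev]
    exact (h.norm_tangent_sub_le hv.1 huv hu.2 (by linarith) (by linarith)).trans_lt hd.2

lemma inner_perp_tangent_eq_zero (h : HasUnitTangent f T ℓ τ) :
    inner ℝ (perp (T 0)) (T 1) = 0 := by
  have hτ := h.radius_pos
  have h0 : (0 : ℝ) ∈ Icc (0 : ℝ) 1 := by simp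
  have h1 : (1 : ℝ) ∈ Icc (0 : ℝ) 1 := by simp
  have hderiv : HasDerivWithinAt (fun v => inner ℝ (perp (T 0)) (f v - f 1))
      (ℓ * inner ℝ (perp (T 0)) (T 1)) (Icc 0 1) 1 := by
    have := (hasDerivWithinAt_const 1 (Icc 0 1) (perp (T 0))).inner ℝ
      ((h.deriv 1 h1).sub_const (f 1))
    simpa [real_inner_smul_right] using this
  have hquad : (fun v => inner ℝ (perp (T 0)) (f v - f 1)) =O[𝓝[Icc 0 1] 1]
      fun v => ‖v - 1‖ ^ 2 := by
    refine Asymptotics.IsBigO.of_bound (ℓ ^ 2 / (2 * τ)) ?_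
    filter_upwards [self_mem_nhdsWithin] with v hv
    have hdisc := h.disc 0 h0 v hv
    rw [h.simple.closed] at hdisc
    have hlen := pow_le_pow_left₀ (norm_nonneg _) (h.norm_sub_le h1 hv) 2
    rw [Real.norm_eq_abs, norm_pow, norm_norm, Real.norm_eq_abs, div_mul_eq_mul_div, ← mul_pow,
      le_div_iff₀' (by positivity)]
    exact hdisc.trans hlen
  have hzero : HasDerivWithinAt (fun v => inner ℝ (perp (T 0)) (f v - f 1)) 0 (Icc 0 1) 1 := by
    simpa using (hquad.hasFDerivWithinAt h1 one_lt_two).hasDerivWithinAt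
  exact (mul_eq_zero.1 ((uniqueDiffOn_Icc_zero_one 1 h1).eq_deriv _ hderiv hzero)).resolve_left
    h.speed_pos.ne'

lemma tangent_one_eq_or (h : HasUnitTangent f T ℓ τ) : T 1 = T 0 ∨ T 1 = -T 0 := by
  have h0 := h.norm_eq 0 (by simp)
  have h1 := h.norm_eq 1 (by simp)
  have hpyth := inner_sq_add_inner_perp_sq_of_norm_eq_one h0 (T 1)
  rw [h.inner_perp_tangent_eq_zero, h1, zero_pow two_ne_zero, add_zero, one_pow,
    sq_eq_one_iff] at hpyth
  rcases hpyth with hpyth | hpyth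
  · exact Or.inl ((inner_eq_one_iff_of_norm_eq_one h0 h1).1 hpyth).symm
  · exact Or.inr <|
      neg_eq_iff_eq_neg.1 ((inner_eq_neg_one_iff_of_norm_eq_one h0 h1).1 hpyth).symm

lemma norm_sub_le_of_wrap (h : HasUnitTangent f T ℓ τ) {a b : ℝ} (ha : a ∈ Icc (0 : ℝ) 1)
    (hb : b ∈ Icc (0 : ℝ) 1) : ‖f b - f a‖ ≤ ℓ * (a + (1 - b)) := by
  have hfa := h.norm_sub_le (u := 0) (by simp) ha
  have hfb := h.norm_sub_le (u := 1) (by simp) hb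
  rw [sub_zero, abs_of_nonneg ha.1] at hfa
  rw [abs_sub_comm, abs_of_nonneg (sub_nonneg.2 hb.2), ← h.simple.closed] at hfb
  rw [mul_add, add_comm, ← sub_sub_sub_cancel_right (f b) (f a) (f 0)]
  exact (_root_.norm_sub_le _ _).trans (add_le_add hfb hfa)

/-- If the tangent reversed at the base point, the two ends of the curve would leave `f 0` on the
same side, and points of them at the same height over `f 0` would be joined by a chord normal to
the curve. -/
lemma tangent_one (h : HasUnitTangent f T ℓ τ) : T 1 = T 0 := by
  refine h.tangent_one_eq_or.resolve_right fun hT => ?_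
  have hℓ := h.speed_pos
  have hτ := h.radius_pos
  obtain ⟨η, hη0, hη, hητ⟩ : ∃ η : ℝ, 0 < η ∧ η ≤ 1 / 4 ∧ ℓ * η ≤ τ / 4 :=
    ⟨min (1 / 4) (τ / 4 / ℓ), by positivity, min_le_left _ _,
      (le_div_iff₀' hℓ).1 (min_le_right _ _)⟩
  have hcont : ContinuousOn (fun v => inner ℝ (T 0) (f v - f 0)) (Icc 0 1) :=
    continuousOn_const.inner (h.simple.continuousOn.sub continuousOn_const)
  have hstart : 0 < inner ℝ (T 0) (f η - f 0) :=
    h.inner_pos le_rfl hη0 (by linarith) (by linarith) (by linarith)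
  have hend : 0 < inner ℝ (T 0) (f (1 - η) - f 0) := by
    have := h.inner_pos_of_lt (u := 1 - η) (v := 1) (by linarith) (by linarith) le_rfl
      (by linarith) (by linarith)
    rwa [hT, inner_neg_left, ← inner_neg_right, neg_sub, ← h.simple.closed] at this
  obtain ⟨a, ha, b, hb, hab⟩ := exists_mem_Ioc_exists_mem_Ico_eq hcont hη0.le (by linarith)
    (by simp) (by simp [h.simple.closed]) hstart hend (by linarith)
  have ha' : a ∈ Icc (0 : ℝ) 1 := ⟨ha.1.le, by linarith [ha.2]⟩
  have hb' : b ∈ Icc (0 : ℝ) 1 := ⟨by linarith [hb.1], hb.2.le⟩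
  have hη_mul {x : ℝ} (hx : x ≤ η) : ℓ * x ≤ τ / 4 := (by gcongr : _ ≤ ℓ * η).trans hητ
  have hTa : ‖T 0 - T a‖ ≤ 1 / 2 := by
    refine (h.norm_tangent_sub_le le_rfl ha.1 ha'.2 (by linarith [ha.2]) ?_).trans ?_ <;>
      rw [sub_zero]
    · linarith [hη_mul ha.2]
    · rw [div_mul_eq_mul_div, div_le_iff₀ hτ]
      linarith [hη_mul ha.2]
  have hlen : ‖f b - f a‖ ≤ τ / 2 := by
    have := hη_mul (x := 1 - b) (by linarith [hb.1])
    linarith [h.norm_sub_le_of_wrap ha' hb', hη_mul ha.2]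
  refine inner_ne_zero_of_disc (h.norm_eq 0 (by simp)) (sub_ne_zero.2 <|
    h.simple.ne_of_lt ha.1.le (by linarith [ha.2, hb.1]) hb.2.le (by linarith [ha.1, hb.2]))
    (h.disc a ha' b hb') hτ ?_ ?_
  · nlinarith
  · rw [← sub_sub_sub_cancel_right _ _ (f 0), inner_sub_right, hab, sub_self]

end HasUnitTangent

/-! ### Periodic frames -/

/-- `γ` is a closed curve of period `1` and speed `ℓ` with unit tangent `T`, with no point in the
open discs of radius `τ` that are tangent to it. -/
structure IsClosedFrame (γ T : ℝ → Plane) (ℓ τ : ℝ) : Prop where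
  speed_pos : 0 < ℓ
  radius_pos : 0 < τ
  periodic : Function.Periodic γ 1
  periodic_tangent : Function.Periodic T 1
  deriv : ∀ s, HasDerivAt γ (ℓ • T s) s
  norm_eq : ∀ s, ‖T s‖ = 1
  continuous_tangent : Continuous T
  injOn : InjOn γ (Ico 0 1)
  disc : ∀ s s', 2 * τ * |inner ℝ (perp (T s)) (γ s' - γ s)| ≤ ‖γ s' - γ s‖ ^ 2

lemma fract_mem_Icc (s : ℝ) : Int.fract s ∈ Icc (0 : ℝ) 1 :=
  ⟨Int.fract_nonneg s, (Int.fract_lt_one s).le⟩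

section Fract
variable {α : Type*} {g : ℝ → α}

lemma eqOn_comp_fract (hg : g 0 = g 1) (n : ℤ) :
    EqOn (fun s => g (Int.fract s)) (fun s => g (s - n)) (Icc (n : ℝ) (n + 1)) := by
  intro s hs
  rcases hs.2.eq_or_lt with rfl | hlt
  · simp [hg]
  · exact congrArg g (by rw [Int.fract, Int.floor_eq_iff.2 ⟨hs.1, hlt⟩])

lemma range_comp_fract (hg : g 0 = g 1) : range (fun s => g (Int.fract s)) = g '' Icc 0 1 := by
  refine Subset.antisymm (range_subset_iff.2 fun s => mem_image_of_mem g (fract_mem_Icc s)) ?_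
  rintro _ ⟨s, hs, rfl⟩
  exact ⟨s, by simpa using eqOn_comp_fract hg 0 (by simpa using hs)⟩

lemma comp_fract_of_periodic (hg : Function.Periodic g 1) (s : ℝ) : g (Int.fract s) = g s := by
  simpa using hg.sub_int_mul_eq ⌊s⌋ (x := s)

end Fract

namespace HasUnitTangent
variable {f T : ℝ → Plane} {ℓ τ : ℝ}

lemma hasDerivWithinAt_comp_fract (h : HasUnitTangent f T ℓ τ) (n : ℤ) {s : ℝ}
    (hs : s ∈ Icc (n : ℝ) (n + 1)) :
    HasDerivWithinAt (fun s => f (Int.fract s)) (ℓ • T (Int.fract s)) (Icc (n : ℝ) (n + 1)) s := by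
  have hmaps : MapsTo (fun s : ℝ => s - n) (Icc (n : ℝ) (n + 1)) (Icc 0 1) :=
    fun s hs => ⟨by linarith [hs.1], by linarith [hs.2]⟩
  have hshift : HasDerivWithinAt (fun s : ℝ => s - n) 1 (Icc (n : ℝ) (n + 1)) s :=
    ((hasDerivAt_id s).sub_const _).hasDerivWithinAt
  have hderiv := (h.deriv (s - n) (hmaps hs)).scomp s hshift hmaps
  have htangent : T (Int.fract s) = T (s - n) := eqOn_comp_fract h.tangent_one.symm n hs
  rw [one_smul, ← htangent] at hderiv
  exact hderiv.congr (eqOn_comp_fract h.simple.closed n) (eqOn_comp_fract h.simple.closed n hs)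

lemma hasDerivAt_comp_fract (h : HasUnitTangent f T ℓ τ) (s : ℝ) :
    HasDerivAt (fun s => f (Int.fract s)) (ℓ • T (Int.fract s)) s := by
  have hlt : s < ⌊s⌋ + 1 := Int.lt_floor_add_one s
  have hright := h.hasDerivWithinAt_comp_fract ⌊s⌋ ⟨Int.floor_le s, hlt.le⟩
  rcases (Int.floor_le s).eq_or_lt with heq | hgt
  · have hleft := h.hasDerivWithinAt_comp_fract (⌊s⌋ - 1) (s := s)
      ⟨by push_cast; linarith, by push_cast; linarith⟩
    have hboth := hleft.union hright
    push_cast at hboth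
    rw [sub_add_cancel, Icc_union_Icc_eq_Icc (by linarith) (by linarith)] at hboth
    exact hboth.hasDerivAt (Icc_mem_nhds (by linarith) hlt)
  · exact hright.hasDerivAt (Icc_mem_nhds hgt hlt)

lemma isClosedFrame (h : HasUnitTangent f T ℓ τ) :
    IsClosedFrame (fun s => f (Int.fract s)) (fun s => T (Int.fract s)) ℓ τ where
  speed_pos := h.speed_pos
  radius_pos := h.radius_pos
  periodic s := by simp
  periodic_tangent s := by simp
  deriv := h.hasDerivAt_comp_fract
  norm_eq s := h.norm_eq _ (fract_mem_Icc s)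
  continuous_tangent := h.continuousOn_tangent.comp_fract'' h.tangent_one.symm
  injOn s hs s' hs' hss := by
    simp only [Int.fract_eq_self.2 hs, Int.fract_eq_self.2 hs'] at hss
    exact h.simple.injOn hs hs' hss
  disc s s' := h.disc _ (fract_mem_Icc s) _ (fract_mem_Icc s')

end HasUnitTangent

lemma exists_isClosedFrame {f : ℝ → Plane} (hf : IsSimpleClosedCurve f)
    (hf_arc : IsArclengthParametrized f) {σ : ℝ} (hσ : 0 ≤ σ)
    (hthick : ENNReal.ofReal σ < thickness (trace f)) :
    ∃ γ T : ℝ → Plane, ∃ ℓ τ : ℝ,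
      IsClosedFrame γ T ℓ τ ∧ σ < τ ∧ EqOn f γ (Icc 0 1) ∧ range γ = trace f := by
  obtain ⟨τ, -, hστ, hτ⟩ := ENNReal.lt_iff_exists_real_btwn.1 hthick
  replace hστ : σ < τ := (ENNReal.ofReal_lt_ofReal_iff_of_nonneg hσ).1 hστ
  obtain ⟨T, ℓ, hT⟩ := exists_hasUnitTangent hf hf_arc (hσ.trans_lt hστ) hτ.le
  refine ⟨_, _, ℓ, τ, hT.isClosedFrame, hστ, fun s hs => ?_, range_comp_fract hf.closed⟩
  simpa using (eqOn_comp_fract hf.closed 0 (x := s) (by simpa using hs)).symm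

/-- A closed curve `γ` with unit normal field `N` whose normal coordinates cover the plane, with no
point in the open discs of radius `τ` that are tangent to it. -/
structure IsNormalFrame (γ N : ℝ → Plane) (τ : ℝ) : Prop where
  radius_pos : 0 < τ
  continuous : Continuous γ
  continuous_normal : Continuous N
  periodic : Function.Periodic γ 1
  periodic_normal : Function.Periodic N 1
  norm_eq : ∀ s, ‖N s‖ = 1
  injOn : InjOn γ (Ico 0 1)
  disc : ∀ s s', 2 * τ * |inner ℝ (N s) (γ s' - γ s)| ≤ ‖γ s' - γ s‖ ^ 2
  foot : ∀ x, ∃ s t, x = γ s + t • N s ∧ |t| = Metric.infDist x (range γ)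

lemma norm_smul_of_norm_eq_one {E : Type*} [NormedAddCommGroup E] [NormedSpace ℝ E] {v : E}
    (hv : ‖v‖ = 1) (t : ℝ) : ‖t • v‖ = |t| := by
  rw [norm_smul, hv, mul_one, Real.norm_eq_abs]

lemma inner_perp_smul_perp_of_inner_eq_zero {T v : Plane} (hT : ‖T‖ = 1) (hv : inner ℝ T v = 0) :
    inner ℝ (perp T) v • perp T = v := by
  have hperp : ‖perp T‖ = 1 := by rw [perp.norm_map, hT]
  have hpyth := inner_sq_add_inner_perp_sq_of_norm_eq_one hT v
  rw [← sub_eq_zero, ← norm_eq_zero, ← sq_eq_zero_iff, norm_sub_sq_real,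
    norm_smul_of_norm_eq_one hperp, sq_abs, real_inner_smul_left, ← hpyth, hv]
  ring

lemma inner_deriv_eq_zero_of_forall_dist_le {E : Type*} [NormedAddCommGroup E]
    [InnerProductSpace ℝ E] {γ : ℝ → E} {γ' x : E} {s : ℝ} (hγ : HasDerivAt γ γ' s)
    (hs : ∀ s', dist x (γ s) ≤ dist x (γ s')) : inner ℝ γ' (x - γ s) = 0 := by
  have hmin : IsLocalMin (fun s' => ‖x - γ s'‖ ^ 2) s := Eventually.of_forall fun s' =>
    pow_le_pow_left₀ (norm_nonneg _) (by simpa only [dist_eq_norm] using hs s') 2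
  have hzero := hmin.hasDerivAt_eq_zero (hγ.const_sub x).norm_sq
  rw [inner_neg_right, real_inner_comm] at hzero
  linarith

lemma IsClosedFrame.isNormalFrame {γ T : ℝ → Plane} {ℓ τ : ℝ} (h : IsClosedFrame γ T ℓ τ) :
    IsNormalFrame γ (fun s => perp (T s)) τ := by
  have hγ : Continuous γ := continuous_iff_continuousAt.2 fun s => (h.deriv s).continuousAt
  refine ⟨h.radius_pos, hγ, perp.continuous.comp h.continuous_tangent, h.periodic,
    h.periodic_tangent.comp perp, fun s => by rw [perp.norm_map, h.norm_eq], h.injOn, h.disc,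
    fun x => ?_⟩
  obtain ⟨_, ⟨s, rfl⟩, hs⟩ := (h.periodic.compact_of_continuous one_ne_zero
    hγ).exists_infDist_eq_dist (range_nonempty γ) x
  have horth : inner ℝ (T s) (x - γ s) = 0 := by
    have := inner_deriv_eq_zero_of_forall_dist_le (h.deriv s) fun s' =>
      hs ▸ Metric.infDist_le_dist_of_mem (mem_range_self s')
    rw [real_inner_smul_left] at this
    exact (mul_eq_zero.1 this).resolve_left h.speed_pos.ne'
  have hdecomp := inner_perp_smul_perp_of_inner_eq_zero (h.norm_eq s) horth
  refine ⟨s, inner ℝ (perp (T s)) (x - γ s), by rw [hdecomp, add_sub_cancel], ?_⟩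
  rw [hs, dist_eq_norm, ← hdecomp, norm_smul_of_norm_eq_one (by rw [perp.norm_map, h.norm_eq]),
    hdecomp]

namespace IsNormalFrame
variable {γ N : ℝ → Plane} {τ : ℝ}

lemma neg (h : IsNormalFrame γ N τ) : IsNormalFrame γ (-N) τ := by
  refine ⟨h.radius_pos, h.continuous, h.continuous_normal.neg, h.periodic,
    h.periodic_normal.comp Neg.neg, fun s => by simp [h.norm_eq s], h.injOn,
    fun s s' => by simpa using h.disc s s', fun x => ?_⟩
  obtain ⟨s, t, hx, ht⟩ := h.foot x
  exact ⟨s, -t, by simpa using hx, by simpa using ht⟩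

lemma isCompact_range (h : IsNormalFrame γ N τ) : IsCompact (range γ) :=
  h.periodic.compact_of_continuous one_ne_zero h.continuous

lemma norm_sq_add_smul_sub (h : IsNormalFrame γ N τ) (s t : ℝ) (c : Plane) :
    ‖γ s + t • N s - c‖ ^ 2 = t ^ 2 - 2 * t * inner ℝ (N s) (c - γ s) + ‖c - γ s‖ ^ 2 := by
  rw [add_comm, add_sub_assoc, ← sub_neg_eq_add, neg_sub, norm_sub_sq_real,
    norm_smul_of_norm_eq_one (h.norm_eq s), sq_abs, real_inner_smul_left, mul_assoc]

/-- Quantitative uniqueness of the foot point. -/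
lemma le_norm_sq (h : IsNormalFrame γ N τ) (s t s' : ℝ) :
    t ^ 2 + (1 - |t| / τ) * ‖γ s' - γ s‖ ^ 2 ≤ ‖γ s + t • N s - γ s'‖ ^ 2 := by
  have hτ := h.radius_pos
  have hdisc : |inner ℝ (N s) (γ s' - γ s)| ≤ ‖γ s' - γ s‖ ^ 2 / (2 * τ) :=
    (le_div_iff₀' (by positivity)).2 (h.disc s s')
  have : t * inner ℝ (N s) (γ s' - γ s) ≤ |t| / τ * ‖γ s' - γ s‖ ^ 2 / 2 := calc
    t * inner ℝ (N s) (γ s' - γ s) ≤ |t| * |inner ℝ (N s) (γ s' - γ s)| :=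
      abs_mul t _ ▸ le_abs_self _
    _ ≤ |t| * (‖γ s' - γ s‖ ^ 2 / (2 * τ)) := by gcongr
    _ = |t| / τ * ‖γ s' - γ s‖ ^ 2 / 2 := by ring
  rw [h.norm_sq_add_smul_sub]
  linarith

lemma infDist_add_smul (h : IsNormalFrame γ N τ) (s : ℝ) {t : ℝ} (ht : |t| ≤ τ) :
    Metric.infDist (γ s + t • N s) (range γ) = |t| := by
  apply le_antisymm
  · refine (Metric.infDist_le_dist_of_mem (mem_range_self s)).trans_eq ?_
    rw [dist_eq_norm, add_sub_cancel_left, norm_smul_of_norm_eq_one (h.norm_eq s)]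
  · refine (Metric.le_infDist (range_nonempty γ)).2 (forall_mem_range.2 fun s' => ?_)
    rw [dist_eq_norm, ← sq_le_sq₀ (abs_nonneg _) (norm_nonneg _), sq_abs]
    have : 0 ≤ 1 - |t| / τ := sub_nonneg.2 <| (div_le_one h.radius_pos).2 ht
    exact (le_add_of_nonneg_right (by positivity)).trans (h.le_norm_sq s t s')

lemma fract_eq_of_eq (h : IsNormalFrame γ N τ) {s s' : ℝ} (hs : γ s = γ s') :
    Int.fract s = Int.fract s' := by
  rw [← comp_fract_of_periodic h.periodic s, ← comp_fract_of_periodic h.periodic s'] at hs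
  exact h.injOn ⟨Int.fract_nonneg s, Int.fract_lt_one s⟩
    ⟨Int.fract_nonneg s', Int.fract_lt_one s'⟩ hs

lemma normal_eq_of_eq (h : IsNormalFrame γ N τ) {s s' : ℝ} (hs : γ s = γ s') : N s = N s' := by
  rw [← comp_fract_of_periodic h.periodic_normal s, ← comp_fract_of_periodic h.periodic_normal s',
    h.fract_eq_of_eq hs]

lemma eq_and_eq_of_add_smul_eq (h : IsNormalFrame γ N τ) {s t s' t' : ℝ} (ht : |t| < τ)
    (ht' : |t'| < τ) (he : γ s + t • N s = γ s' + t' • N s') : γ s = γ s' ∧ t = t' := by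
  have habs : |t| = |t'| := by
    rw [← h.infDist_add_smul s ht.le, he, h.infDist_add_smul s' ht'.le]
  have hquad := h.le_norm_sq s t s'
  rw [he, add_sub_cancel_left, norm_smul_of_norm_eq_one (h.norm_eq s'), ← habs, sq_abs,
    add_le_iff_nonpos_right] at hquad
  have hpos : 0 < 1 - |t| / τ := sub_pos.2 <| (div_lt_one h.radius_pos).2 ht
  have hnorm : ‖γ s' - γ s‖ ^ 2 = 0 :=
    le_antisymm (nonpos_of_mul_nonpos_right hquad hpos) (sq_nonneg _)
  have hs : γ s = γ s' := (sub_eq_zero.1 <| norm_eq_zero.1 <| sq_eq_zero_iff.1 hnorm).symm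
  have hN : N s' ≠ 0 := norm_ne_zero_iff.1 (by rw [h.norm_eq]; exact one_ne_zero)
  rw [hs, h.normal_eq_of_eq hs] at he
  exact ⟨hs, smul_left_injective ℝ hN (add_left_cancel he)⟩

lemma exists_eq_add_infDist_smul_or (h : IsNormalFrame γ N τ) (x : Plane) :
    ∃ s, x = γ s + Metric.infDist x (range γ) • N s ∨
      x = γ s + Metric.infDist x (range γ) • (-N) s := by
  obtain ⟨s, t, hx, ht⟩ := h.foot x
  refine ⟨s, ?_⟩
  rw [← ht, Pi.neg_apply, smul_neg, ← neg_smul]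
  rcases abs_choice t with habs | habs <;> rw [habs]
  · exact Or.inl hx
  · exact Or.inr (by rwa [neg_neg])

end IsNormalFrame

/-! ### The two sides of the curve -/

section CircleLift
variable {X : Type*} [TopologicalSpace X]

lemma exists_continuous_arg [SimplyConnectedSpace X] [LocallyPathConnectedSpace X] {θ : X → Circle}
    (hθ : Continuous θ) : ∃ Θ : X → ℝ, Continuous Θ ∧ ∀ x, Circle.exp (Θ x) = θ x := by
  obtain ⟨x₀⟩ : Nonempty X := inferInstance
  obtain ⟨F, ⟨-, hF⟩, -⟩ := Circle.isCoveringMap_exp.existsUnique_continuousMap_lifts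
    (⟨θ, hθ⟩ : C(X, Circle)) x₀ (Complex.arg (θ x₀)) (Circle.exp_arg _)
  exact ⟨F, F.continuous, congrFun hF⟩

lemma eq_of_circle_exp_eq_one {K : Set X} (hK : IsPreconnected K) {g : X → ℝ}
    (hg : ContinuousOn g K) (hexp : ∀ x ∈ K, Circle.exp (g x) = 1) {x y : X} (hx : x ∈ K)
    (hy : y ∈ K) : g x = g y := by
  have hdiscrete : IsDiscrete (AddSubgroup.zmultiples (2 * Real.pi) : Set ℝ) :=
    isDiscrete_iff_discreteTopology.2 (NormedSpace.discreteTopology_zmultiples _)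
  refine hK.constant_of_mapsTo hdiscrete hg (fun z hz => ?_) hx hy
  obtain ⟨n, hn⟩ := Circle.exp_eq_one.1 (hexp z hz)
  exact ⟨n, by simp [hn]⟩

lemma eq_zero_of_circle_exp_eq_one {a : ℝ} (ha : |a| < 2 * Real.pi) (hexp : Circle.exp a = 1) :
    a = 0 := by
  obtain ⟨n, rfl⟩ := Circle.exp_eq_one.1 hexp
  rw [abs_mul, abs_of_pos Real.two_pi_pos, mul_lt_iff_lt_one_left Real.two_pi_pos] at ha
  have hn : n = 0 := Int.abs_lt_one_iff.1 (by exact_mod_cast ha)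
  rw [hn, Int.cast_zero, zero_mul]

lemma circle_exp_pi_inv : (Circle.exp Real.pi)⁻¹ = Circle.exp Real.pi := by
  rw [← Circle.exp_neg, ← Circle.exp_add_two_pi]
  congr 1
  ring

end CircleLift

/-- The closed collar of width `r` of the curve `γ`, on the side of the normal field `N`. -/
def collar (γ N : ℝ → Plane) (r : ℝ) : Set Plane :=
  (fun q : ℝ × ℝ => γ q.1 + q.2 • N q.1) '' (Icc (0 : ℝ) 1 ×ˢ Icc 0 r)

open Classical in
/-- A circle-valued function on the plane that winds once around the circle when `γ` is crossed from
the side of `-N` to the side of `N`, and takes the value `1` on `γ` only. -/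
noncomputable def crossing (γ N : ℝ → Plane) (r : ℝ) (x : Plane) : Circle :=
  if x ∈ collar γ N r then Circle.exp (Real.pi * Metric.infDist x (range γ) / r)
  else if x ∈ collar γ (-N) r then (Circle.exp (Real.pi * Metric.infDist x (range γ) / r))⁻¹
  else Circle.exp Real.pi

namespace IsNormalFrame
variable {γ N : ℝ → Plane} {τ r : ℝ}

lemma mem_collar (h : IsNormalFrame γ N τ) (s : ℝ) {t : ℝ} (ht : 0 ≤ t) (htr : t ≤ r) :
    γ s + t • N s ∈ collar γ N r :=
  ⟨(Int.fract s, t), ⟨fract_mem_Icc s, ht, htr⟩, by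
    simp only [comp_fract_of_periodic h.periodic, comp_fract_of_periodic h.periodic_normal]⟩

lemma self_mem_collar (h : IsNormalFrame γ N τ) (s : ℝ) (hr : 0 ≤ r) : γ s ∈ collar γ N r := by
  simpa using h.mem_collar s le_rfl hr

lemma isCompact_collar (h : IsNormalFrame γ N τ) (r : ℝ) : IsCompact (collar γ N r) := by
  have := h.continuous
  have := h.continuous_normal
  exact (isCompact_Icc.prod isCompact_Icc).image (by fun_prop)

lemma isPreconnected_collar (h : IsNormalFrame γ N τ) (r : ℝ) : IsPreconnected (collar γ N r) := by
  have := h.continuous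
  have := h.continuous_normal
  exact (isPreconnected_Icc.prod isPreconnected_Icc).image _ (by fun_prop)

lemma infDist_le_and_exists_eq_of_mem_collar (h : IsNormalFrame γ N τ) (hr : r < τ) {x : Plane}
    (hx : x ∈ collar γ N r) : Metric.infDist x (range γ) ≤ r ∧
      ∃ s, x = γ s + Metric.infDist x (range γ) • N s := by
  obtain ⟨⟨s, t⟩, ⟨-, ht0, htr⟩, rfl⟩ := hx
  have ht : |t| = t := abs_of_nonneg ht0
  dsimp only
  rw [h.infDist_add_smul s (ht.trans_le (htr.trans hr.le)), ht]
  exact ⟨htr, s, rfl⟩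

lemma infDist_eq_zero_of_mem_collars (h : IsNormalFrame γ N τ) (hr : r < τ) {x : Plane}
    (hx : x ∈ collar γ N r) (hx' : x ∈ collar γ (-N) r) :
    Metric.infDist x (range γ) = 0 := by
  obtain ⟨hdr, s, hs⟩ := h.infDist_le_and_exists_eq_of_mem_collar hr hx
  obtain ⟨-, s', hs'⟩ := h.neg.infDist_le_and_exists_eq_of_mem_collar hr hx'
  set d := Metric.infDist x (range γ)
  have hd : |d| < τ := by
    rw [abs_of_nonneg Metric.infDist_nonneg]
    exact hdr.trans_lt hr
  have heq : γ s + d • N s = γ s' + (-d) • N s' := by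
    rw [← hs, neg_smul, ← smul_neg]
    exact hs'
  exact self_eq_neg.1 (h.eq_and_eq_of_add_smul_eq hd (by rwa [abs_neg]) heq).2

lemma mem_collar_or (h : IsNormalFrame γ N τ) {x : Plane} (hx : Metric.infDist x (range γ) ≤ r) :
    x ∈ collar γ N r ∨ x ∈ collar γ (-N) r := by
  obtain ⟨s, hs | hs⟩ := h.exists_eq_add_infDist_smul_or x
  · exact Or.inl (hs ▸ h.mem_collar s Metric.infDist_nonneg hx)
  · exact Or.inr (hs ▸ h.neg.mem_collar s Metric.infDist_nonneg hx)

lemma crossing_neg (h : IsNormalFrame γ N τ) (hr : r < τ) (x : Plane) :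
    crossing γ (-N) r x = (crossing γ N r x)⁻¹ := by
  unfold crossing
  rw [neg_neg]
  split_ifs with hneg hpos
  · simp [h.infDist_eq_zero_of_mem_collars hr hpos hneg]
  · rw [inv_inv]
  · rfl
  · rw [circle_exp_pi_inv]

lemma crossing_of_mem {x : Plane} (hx : x ∈ collar γ N r) :
    crossing γ N r x = Circle.exp (Real.pi * Metric.infDist x (range γ) / r) :=
  if_pos hx

lemma crossing_of_mem_neg (h : IsNormalFrame γ N τ) (hr : r < τ) {x : Plane}
    (hx : x ∈ collar γ (-N) r) :
    crossing γ N r x = (Circle.exp (Real.pi * Metric.infDist x (range γ) / r))⁻¹ := by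
  rw [← crossing_of_mem hx, h.crossing_neg hr, inv_inv]

lemma crossing_of_le (h : IsNormalFrame γ N τ) (hr0 : 0 < r) (hr : r < τ) {x : Plane}
    (hx : r ≤ Metric.infDist x (range γ)) : crossing γ N r x = Circle.exp Real.pi := by
  unfold crossing
  split_ifs with hpos hneg
  · rw [le_antisymm (h.infDist_le_and_exists_eq_of_mem_collar hr hpos).1 hx,
      mul_div_cancel_right₀ _ hr0.ne']
  · rw [le_antisymm (h.neg.infDist_le_and_exists_eq_of_mem_collar hr hneg).1 hx,
      mul_div_cancel_right₀ _ hr0.ne', circle_exp_pi_inv]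
  · rfl

lemma continuous_crossing (h : IsNormalFrame γ N τ) (hr0 : 0 < r) (hr : r < τ) :
    Continuous (crossing γ N r) := by
  have hdist : Continuous fun x : Plane => Metric.infDist x (range γ) :=
    Metric.continuous_infDist_pt _
  have hpos : ContinuousOn (crossing γ N r) (collar γ N r) :=
    ContinuousOn.congr (f := fun x => Circle.exp (Real.pi * Metric.infDist x (range γ) / r))
      (by fun_prop) fun x hx => crossing_of_mem hx
  have hneg : ContinuousOn (crossing γ N r) (collar γ (-N) r) :=
    ContinuousOn.congr (f := fun x => (Circle.exp (Real.pi * Metric.infDist x (range γ) / r))⁻¹)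
      (by fun_prop) fun x hx => h.crossing_of_mem_neg hr hx
  have hfar : ContinuousOn (crossing γ N r) {x | r ≤ Metric.infDist x (range γ)} :=
    continuousOn_const.congr fun x hx => h.crossing_of_le hr0 hr hx
  have hclosed := (h.isCompact_collar r).isClosed
  have hclosed' := (h.neg.isCompact_collar r).isClosed
  rw [← continuousOn_univ]
  refine ((hpos.union_of_isClosed hneg hclosed hclosed').union_of_isClosed hfar
    (hclosed.union hclosed') (isClosed_le continuous_const hdist)).mono fun x _ => ?_
  exact (le_total (Metric.infDist x (range γ)) r).imp h.mem_collar_or id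

lemma mem_range_of_crossing_eq_one (h : IsNormalFrame γ N τ) (hr0 : 0 < r) (hr : r < τ) {x : Plane}
    (hx : crossing γ N r x = 1) : x ∈ range γ := by
  have hpi := Real.pi_pos
  have hd : 0 ≤ Metric.infDist x (range γ) := Metric.infDist_nonneg
  rw [h.isCompact_range.isClosed.mem_iff_infDist_zero (range_nonempty γ)]
  rcases le_total (Metric.infDist x (range γ)) r with hxr | hxr
  · have hexp : Circle.exp (Real.pi * Metric.infDist x (range γ) / r) = 1 := by
      rcases h.mem_collar_or hxr with hpos | hneg
      · rwa [← crossing_of_mem hpos]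
      · rwa [h.crossing_of_mem_neg hr hneg, inv_eq_one] at hx
    have hle : Real.pi * Metric.infDist x (range γ) / r ≤ Real.pi :=
      (div_le_iff₀ hr0).2 (by gcongr)
    have := eq_zero_of_circle_exp_eq_one (by rw [abs_of_nonneg (by positivity)]; linarith) hexp
    simpa [hpi.ne', hr0.ne'] using this
  · rw [h.crossing_of_le hr0 hr hxr] at hx
    exact (hpi.ne' <| eq_zero_of_circle_exp_eq_one
      (by rw [abs_of_pos hpi]; linarith) hx).elim

lemma arg_crossing_add_smul (h : IsNormalFrame γ N τ) {Θ : Plane → ℝ} (hΘ : Continuous Θ)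
    (hexp : ∀ x, Circle.exp (Θ x) = crossing γ N r x) (s : ℝ) {t : ℝ} (ht : 0 ≤ t) (htr : t ≤ r)
    (hr : r < τ) : Θ (γ s + t • N s) = Θ (γ 0) + Real.pi * t / r := by
  have : Continuous fun x : Plane => Metric.infDist x (range γ) := Metric.continuous_infDist_pt _
  have := eq_of_circle_exp_eq_one (h.isPreconnected_collar r)
    (g := fun x => Θ x - Real.pi * Metric.infDist x (range γ) / r) (by fun_prop)
    (fun y hy => by rw [Circle.exp_sub, hexp, crossing_of_mem hy, div_self'])
    (h.mem_collar s ht htr) (h.self_mem_collar 0 (ht.trans htr))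
  rw [Metric.infDist_zero_of_mem (mem_range_self 0), h.infDist_add_smul s
    (by rw [abs_of_nonneg ht]; linarith), abs_of_nonneg ht, mul_zero, zero_div, sub_zero] at this
  linarith

/-- Along a connected set that joins the two sides of `γ`, the argument of `crossing` passes through
its value on `γ`. -/
theorem exists_mem_range_of_isPreconnected (h : IsNormalFrame γ N τ) {s t s' t' : ℝ} (ht : 0 < t)
    (htτ : t < τ) (ht' : 0 < t') (htτ' : t' < τ) {K : Set Plane} (hK : IsPreconnected K)
    (hpos : γ s + t • N s ∈ K) (hneg : γ s' + t' • (-N) s' ∈ K) : ∃ z ∈ K, z ∈ range γ := by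
  obtain ⟨r, hmax, hr⟩ := exists_between (max_lt htτ htτ')
  obtain ⟨htr, htr'⟩ := max_lt_iff.1 hmax
  have hr0 := ht.trans htr
  obtain ⟨Θ, hΘ, hexp⟩ := exists_continuous_arg (h.continuous_crossing hr0 hr)
  have hexp' : ∀ x, Circle.exp (-Θ x) = crossing γ (-N) r x := fun x => by
    rw [Circle.exp_neg, hexp, h.crossing_neg hr]
  have harg := h.arg_crossing_add_smul hΘ hexp s ht.le htr.le hr
  have harg' := h.neg.arg_crossing_add_smul (Θ := fun x => -Θ x) hΘ.neg hexp' s' ht'.le htr'.le hr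
  have hjump : 0 < Real.pi * t / r := by positivity
  have hjump' : 0 < Real.pi * t' / r := by positivity
  obtain ⟨z, hz, hzΘ⟩ := hK.intermediate_value hneg hpos hΘ.continuousOn
    (show Θ (γ 0) ∈ _ from ⟨by linarith, by linarith⟩)
  refine ⟨z, hz, h.mem_range_of_crossing_eq_one hr0 hr ?_⟩
  rw [← hexp, hzΘ, hexp, crossing_of_mem (h.self_mem_collar 0 hr0.le),
    Metric.infDist_zero_of_mem (mem_range_self 0), mul_zero, zero_div, Circle.exp_zero]

end IsNormalFrame

/-! ### Unions of balls around a dense sample of a tube -/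

/-- `Y` is a finite `ε / 2`-net of points in the closed `σ`-tube around the curve `γ`, with `ε`
small. -/
structure IsTubeSample (γ N : ℝ → Plane) (τ σ ε : ℝ) (Y : Finset Plane) : Prop where
  frame : IsNormalFrame γ N τ
  pos : 0 < ε
  le : ε ≤ σ
  small : 16 * ε ≤ τ - σ
  subset : ∀ c ∈ Y, Metric.infDist c (range γ) ≤ σ
  dense : ∀ x, Metric.infDist x (range γ) ≤ σ → ∃ c ∈ Y, dist x c ≤ ε / 2

/-- The height over the foot point `γ s`, on the side of the normal `N`, at which one leaves the
union of the closed `ε`-balls with centres in `Y`. -/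
noncomputable def height (γ N : ℝ → Plane) (ε : ℝ) (Y : Finset Plane) (s : ℝ) : ℝ :=
  sInf {t | 0 ≤ t ∧ Metric.infDist (γ s + t • N s) (Y : Set Plane) = ε}

/-- The boundary curve, on the side of the normal `N`, of the union of the closed `ε`-balls with
centres in `Y`. -/
noncomputable def edge (γ N : ℝ → Plane) (ε : ℝ) (Y : Finset Plane) (s : ℝ) : Plane :=
  γ s + height γ N ε Y s • N s

lemma exists_dist_eq_infDist {Y : Finset Plane} (hY : Y.Nonempty) (x : Plane) :
    ∃ c ∈ Y, dist x c = Metric.infDist x Y :=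
  let ⟨c, hc, hd⟩ := Y.finite_toSet.isCompact.exists_infDist_eq_dist hY x
  ⟨c, hc, hd.symm⟩

lemma iUnion_closedBall_eq {Y : Finset Plane} (hY : Y.Nonempty) (ε : ℝ) :
    ⋃ c ∈ Y, Metric.closedBall c ε = {x | Metric.infDist x (Y : Set Plane) ≤ ε} := by
  ext x
  simp only [mem_iUnion, Metric.mem_closedBall, exists_prop, mem_ofPred_eq]
  constructor
  · rintro ⟨c, hc, hx⟩
    exact (Metric.infDist_le_dist_of_mem (Finset.mem_coe.2 hc)).trans hx
  · intro hx
    obtain ⟨c, hc, hd⟩ := exists_dist_eq_infDist hY x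
    exact ⟨c, hc, hd.trans_le hx⟩

lemma IsNormalFrame.dist_add_smul {γ N : ℝ → Plane} {τ : ℝ} (h : IsNormalFrame γ N τ)
    (s t t' : ℝ) : dist (γ s + t • N s) (γ s + t' • N s) = |t - t'| := by
  rw [dist_add_left, dist_eq_norm, ← sub_smul, norm_smul_of_norm_eq_one (h.norm_eq s)]

namespace IsTubeSample
variable {γ N : ℝ → Plane} {τ σ ε : ℝ} {Y : Finset Plane}

lemma neg (h : IsTubeSample γ N τ σ ε Y) : IsTubeSample γ (-N) τ σ ε Y :=
  ⟨h.frame.neg, h.pos, h.le, h.small, h.subset, h.dense⟩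

lemma tube_pos (h : IsTubeSample γ N τ σ ε Y) : 0 < σ := h.pos.trans_le h.le

lemma nonempty (h : IsTubeSample γ N τ σ ε Y) : Y.Nonempty :=
  let ⟨c, hc, _⟩ := h.dense (γ 0)
    ((Metric.infDist_zero_of_mem (mem_range_self 0)).trans_le h.tube_pos.le)
  ⟨c, hc⟩

lemma infDist_range_sub_le (h : IsTubeSample γ N τ σ ε Y) (x : Plane) :
    Metric.infDist x (range γ) - σ ≤ Metric.infDist x (Y : Set Plane) := by
  obtain ⟨c, hc, hd⟩ := exists_dist_eq_infDist h.nonempty x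
  linarith [h.subset c hc, Metric.infDist_le_infDist_add_dist (s := range γ) (x := x) (y := c)]

lemma sub_le_infDist_add_smul (h : IsTubeSample γ N τ σ ε Y) (s : ℝ) {t : ℝ} (ht : 0 ≤ t)
    (htτ : t ≤ τ) : t - σ ≤ Metric.infDist (γ s + t • N s) (Y : Set Plane) := by
  have habs : |t| = t := abs_of_nonneg ht
  have hdist := h.frame.infDist_add_smul s (t := t) (habs.trans_le htτ)
  linarith [h.infDist_range_sub_le (γ s + t • N s)]

lemma infDist_add_smul_le (h : IsTubeSample γ N τ σ ε Y) (s : ℝ) {t : ℝ} (ht : 0 ≤ t) :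
    Metric.infDist (γ s + t • N s) (Y : Set Plane) ≤ t - min t σ + ε / 2 := by
  have habs : |min t σ| = min t σ := abs_of_nonneg (le_min ht h.tube_pos.le)
  have hτ : |min t σ| ≤ τ := by
    rw [habs]
    linarith [min_le_right t σ, h.small, h.pos]
  obtain ⟨c, hc, hd⟩ := h.dense (γ s + min t σ • N s)
    ((h.frame.infDist_add_smul s hτ).trans_le (habs.trans_le (min_le_right _ _)))
  refine (Metric.infDist_le_dist_of_mem (Finset.mem_coe.2 hc)).trans
    ((dist_triangle _ (γ s + min t σ • N s) c).trans ?_)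
  rw [h.frame.dist_add_smul, abs_of_nonneg (sub_nonneg.2 (min_le_left t σ))]
  linarith

/-- Sample points are at distance at least `τ - σ` from the centre of the tangent disc of radius
`τ`. -/
lemma inner_le (h : IsTubeSample γ N τ σ ε Y) {s t : ℝ} {c : Plane} (hc : c ∈ Y) (ht : σ ≤ t)
    (ht' : t ≤ σ + ε) (hd : dist (γ s + t • N s) c ≤ ε) :
    inner ℝ (N s) (c - γ s) ≤ σ + ε / 8 := by
  have hτ := h.frame.radius_pos
  have hε := h.pos
  have hsmall := h.small
  have hfar : τ - σ ≤ ‖γ s + τ • N s - c‖ := by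
    have hcentre := h.frame.infDist_add_smul s (t := τ) (by rw [abs_of_pos hτ])
    rw [abs_of_pos hτ] at hcentre
    have htriangle :=
      Metric.infDist_le_infDist_add_dist (s := range γ) (x := γ s + τ • N s) (y := c)
    rw [hcentre, dist_eq_norm] at htriangle
    linarith [h.subset c hc]
  have hnear : ‖γ s + σ • N s - c‖ ≤ 2 * ε := by
    rw [← dist_eq_norm]
    refine (dist_triangle _ (γ s + t • N s) c).trans ?_
    rw [h.frame.dist_add_smul, abs_sub_comm, abs_of_nonneg (sub_nonneg.2 ht)]
    linarith
  have hfar_sq := pow_le_pow_left₀ (by linarith) hfar 2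
  have hnear_sq := pow_le_pow_left₀ (norm_nonneg _) hnear 2
  rw [h.frame.norm_sq_add_smul_sub] at hfar_sq hnear_sq
  set a := inner ℝ (N s) (c - γ s)
  have hupper : 2 * (τ - σ) * (a - σ) ≤ 4 * ε ^ 2 := by nlinarith
  by_contra! hlt
  have hlower : 2 * (16 * ε) * (ε / 8) < 2 * (τ - σ) * (a - σ) :=
    mul_lt_mul' (by linarith) (by linarith) (by positivity) (by linarith)
  linarith [hupper, hlower]

lemma infDist_lt_of_lt (h : IsTubeSample γ N τ σ ε Y) {s t t' : ℝ} (ht : 0 ≤ t) (htt' : t < t')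
    (ht'τ : t' ≤ τ) (hd : Metric.infDist (γ s + t' • N s) (Y : Set Plane) ≤ ε) :
    Metric.infDist (γ s + t • N s) (Y : Set Plane) < ε := by
  have hε := h.pos
  rcases lt_or_ge t (σ + ε / 2) with hlow | hhigh
  · refine (h.infDist_add_smul_le s ht).trans_lt ?_
    rcases min_choice t σ with hmin | hmin <;> rw [hmin] <;> linarith
  · have ht' : t' ≤ σ + ε := by
      linarith [h.sub_le_infDist_add_smul s (ht.trans htt'.le) ht'τ]
    obtain ⟨c, hc, hcd⟩ := exists_dist_eq_infDist h.nonempty (γ s + t' • N s)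
    have hinner := h.inner_le hc (by linarith) ht' (hcd.trans_le hd)
    refine (Metric.infDist_le_dist_of_mem (Finset.mem_coe.2 hc)).trans_lt
      (lt_of_lt_of_le ?_ (hcd.trans_le hd))
    rw [dist_eq_norm, dist_eq_norm, ← sq_lt_sq₀ (norm_nonneg _) (norm_nonneg _),
      h.frame.norm_sq_add_smul_sub, h.frame.norm_sq_add_smul_sub]
    nlinarith

lemma exists_infDist_add_smul_eq (h : IsTubeSample γ N τ σ ε Y) (s : ℝ) :
    ∃ t ∈ Icc (σ + ε / 2) (σ + ε), Metric.infDist (γ s + t • N s) (Y : Set Plane) = ε := by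
  have hε := h.pos
  have hσ := h.tube_pos
  have hsmall := h.small
  have hcont : Continuous fun t : ℝ => Metric.infDist (γ s + t • N s) (Y : Set Plane) :=
    (Metric.continuous_infDist_pt _).comp (by fun_prop)
  have hupper : ∀ t, σ ≤ t →
      Metric.infDist (γ s + t • N s) (Y : Set Plane) ≤ t - σ + ε / 2 := fun t ht => by
    simpa only [min_eq_right ht] using h.infDist_add_smul_le s (hσ.le.trans ht)
  have hlower : ∀ t, σ ≤ t → t ≤ τ → t - σ ≤ Metric.infDist (γ s + t • N s) (Y : Set Plane) :=
    fun t ht htτ => h.sub_le_infDist_add_smul s (hσ.le.trans ht) htτ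
  obtain ⟨t, ht, htd⟩ := intermediate_value_Icc (by linarith : σ ≤ σ + 2 * ε) hcont.continuousOn
    (⟨by linarith [hupper σ le_rfl], by linarith [hlower (σ + 2 * ε) (by linarith) (by linarith)]⟩ :
      ε ∈ Icc _ _)
  dsimp only at htd
  exact ⟨t, ⟨by linarith [hupper t ht.1], by linarith [hlower t ht.1 (by linarith [ht.2])]⟩, htd⟩

lemma height_mem_and_infDist (h : IsTubeSample γ N τ σ ε Y) (s : ℝ) :
    height γ N ε Y s ∈ Icc (σ + ε / 2) (σ + ε) ∧
      Metric.infDist (edge γ N ε Y s) (Y : Set Plane) = ε := by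
  obtain ⟨t, ht, htd⟩ := h.exists_infDist_add_smul_eq s
  have hleast : IsLeast {t | 0 ≤ t ∧ Metric.infDist (γ s + t • N s) (Y : Set Plane) = ε} t := by
    refine ⟨⟨by linarith [ht.1, h.pos, h.tube_pos], htd⟩, fun t' ht' => le_of_not_gt fun hlt => ?_⟩
    exact (h.infDist_lt_of_lt ht'.1 hlt (by linarith [ht.2, h.pos, h.small]) htd.le).ne ht'.2
  rw [edge, height, hleast.csInf_eq]
  exact ⟨ht, htd⟩

lemma height_mem (h : IsTubeSample γ N τ σ ε Y) (s : ℝ) :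
    height γ N ε Y s ∈ Icc (σ + ε / 2) (σ + ε) := (h.height_mem_and_infDist s).1

lemma infDist_edge (h : IsTubeSample γ N τ σ ε Y) (s : ℝ) :
    Metric.infDist (edge γ N ε Y s) (Y : Set Plane) = ε := (h.height_mem_and_infDist s).2

lemma height_pos (h : IsTubeSample γ N τ σ ε Y) (s : ℝ) : 0 < height γ N ε Y s := by
  linarith [(h.height_mem s).1, h.pos, h.tube_pos]

lemma height_lt (h : IsTubeSample γ N τ σ ε Y) (s : ℝ) : height γ N ε Y s < τ := by
  linarith [(h.height_mem s).2, h.pos, h.small]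

lemma abs_height (h : IsTubeSample γ N τ σ ε Y) (s : ℝ) :
    |height γ N ε Y s| = height γ N ε Y s := abs_of_pos (h.height_pos s)

lemma abs_height_lt (h : IsTubeSample γ N τ σ ε Y) (s : ℝ) : |height γ N ε Y s| < τ :=
  (h.abs_height s).trans_lt (h.height_lt s)

lemma infDist_lt_iff_lt_height (h : IsTubeSample γ N τ σ ε Y) {s t : ℝ} (ht : 0 ≤ t)
    (htτ : t ≤ τ) :
    Metric.infDist (γ s + t • N s) (Y : Set Plane) < ε ↔ t < height γ N ε Y s := by
  refine ⟨fun hd => lt_of_not_ge fun hle => ?_, fun hlt =>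
    h.infDist_lt_of_lt ht hlt (h.height_lt s).le (h.infDist_edge s).le⟩
  rcases hle.eq_or_lt with rfl | hlt
  · exact hd.ne (h.infDist_edge s)
  · exact (h.infDist_lt_of_lt (h.height_pos s).le hlt htτ hd.le).ne (h.infDist_edge s)

lemma infDist_le_iff_le_height (h : IsTubeSample γ N τ σ ε Y) {s t : ℝ} (ht : 0 ≤ t)
    (htτ : t ≤ τ) :
    Metric.infDist (γ s + t • N s) (Y : Set Plane) ≤ ε ↔ t ≤ height γ N ε Y s := by
  refine ⟨fun hd => le_of_not_gt fun hlt => ?_, fun hle => ?_⟩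
  · exact (h.infDist_lt_of_lt (h.height_pos s).le hlt htτ hd).ne (h.infDist_edge s)
  · rcases hle.eq_or_lt with rfl | hlt
    · exact (h.infDist_edge s).le
    · exact ((h.infDist_lt_iff_lt_height ht htτ).2 hlt).le

lemma eq_height (h : IsTubeSample γ N τ σ ε Y) {s t : ℝ} (ht : 0 ≤ t) (htτ : t ≤ τ)
    (hd : Metric.infDist (γ s + t • N s) (Y : Set Plane) = ε) : t = height γ N ε Y s :=
  ((h.infDist_le_iff_le_height ht htτ).1 hd.le).eq_of_not_lt fun hlt =>
    ((h.infDist_lt_iff_lt_height ht htτ).2 hlt).ne hd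

lemma continuous_height (h : IsTubeSample γ N τ σ ε Y) : Continuous (height γ N ε Y) := by
  have hγ := h.frame.continuous
  have hN := h.frame.continuous_normal
  have hcont (t : ℝ) (s : ℝ) :
      ContinuousAt (fun s => Metric.infDist (γ s + t • N s) (Y : Set Plane)) s :=
    ((Metric.continuous_infDist_pt _).comp (by fun_prop)).continuousAt
  refine continuous_iff_continuousAt.2 fun s => tendsto_order.2 ⟨fun a ha => ?_, fun a ha => ?_⟩
  · have hmax : max a 0 < height γ N ε Y s := max_lt ha (h.height_pos s)
    have hτ' : max a 0 ≤ τ := hmax.le.trans (h.height_lt s).le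
    filter_upwards [(hcont (max a 0) s).eventually_lt_const
      ((h.infDist_lt_iff_lt_height (le_max_right a 0) hτ').2 hmax)] with s' hs'
    exact (le_max_left a 0).trans_lt ((h.infDist_lt_iff_lt_height (le_max_right a 0) hτ').1 hs')
  · have hmin : height γ N ε Y s < min a τ := lt_min ha (h.height_lt s)
    have hpos : 0 ≤ min a τ := (h.height_pos s).le.trans hmin.le
    have hfar := lt_of_not_ge
      (mt (h.infDist_le_iff_le_height hpos (min_le_right a τ)).1 (not_le.2 hmin))
    filter_upwards [(hcont (min a τ) s).eventually_const_lt hfar] with s' hs'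
    exact (lt_of_not_ge (mt (h.infDist_le_iff_le_height hpos (min_le_right a τ)).2
      (not_le.2 hs'))).trans_le (min_le_left a τ)

lemma continuous_edge (h : IsTubeSample γ N τ σ ε Y) : Continuous (edge γ N ε Y) :=
  h.frame.continuous.add (h.continuous_height.smul h.frame.continuous_normal)

lemma periodic_edge (h : IsTubeSample γ N τ σ ε Y) : Function.Periodic (edge γ N ε Y) 1 := by
  intro s
  simp only [edge, height, h.frame.periodic s, h.frame.periodic_normal s]

lemma infDist_edge_range (h : IsTubeSample γ N τ σ ε Y) (s : ℝ) :
    Metric.infDist (edge γ N ε Y s) (range γ) = height γ N ε Y s := by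
  rw [edge, h.frame.infDist_add_smul s (h.abs_height_lt s).le, h.abs_height]

lemma isSimpleClosedCurve_edge (h : IsTubeSample γ N τ σ ε Y) :
    IsSimpleClosedCurve (edge γ N ε Y) where
  continuousOn := h.continuous_edge.continuousOn
  closed := by simpa using (h.periodic_edge 0).symm
  injOn _ hs _ hs' he := h.frame.injOn hs hs' <|
    (h.frame.eq_and_eq_of_add_smul_eq (h.abs_height_lt _) (h.abs_height_lt _) he).1

lemma trace_edge (h : IsTubeSample γ N τ σ ε Y) : trace (edge γ N ε Y) = range (edge γ N ε Y) := by
  simpa [trace] using h.periodic_edge.image_Icc one_pos 0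

lemma disjoint_range_edge (h : IsTubeSample γ N τ σ ε Y) :
    Disjoint (range (edge γ N ε Y)) (range (edge γ (-N) ε Y)) := by
  rw [Set.disjoint_left]
  rintro _ ⟨s, rfl⟩ ⟨s', hs'⟩
  rw [edge, edge, Pi.neg_apply, smul_neg, ← neg_smul] at hs'
  have heq := (h.frame.eq_and_eq_of_add_smul_eq
    (by rw [abs_neg]; exact h.neg.abs_height_lt s') (h.abs_height_lt s) hs').2
  linarith [h.height_pos s, h.neg.height_pos s']

lemma mem_range_edge_of_infDist_eq (h : IsTubeSample γ N τ σ ε Y) {x : Plane}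
    (hx : Metric.infDist x (Y : Set Plane) = ε) :
    x ∈ range (edge γ N ε Y) ∪ range (edge γ (-N) ε Y) := by
  have hτ : Metric.infDist x (range γ) ≤ τ := by
    linarith [h.infDist_range_sub_le x, h.small, h.pos]
  obtain ⟨s, hs | hs⟩ := h.frame.exists_eq_add_infDist_smul_or x
  · exact Or.inl ⟨s, by rw [edge, ← h.eq_height Metric.infDist_nonneg hτ (hs ▸ hx), ← hs]⟩
  · exact Or.inr ⟨s, by rw [edge, ← h.neg.eq_height Metric.infDist_nonneg hτ (hs ▸ hx), ← hs]⟩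

lemma edge_mem_frontier (h : IsTubeSample γ N τ σ ε Y) (s : ℝ) :
    edge γ N ε Y s ∈ frontier {x | Metric.infDist x (Y : Set Plane) ≤ ε} := by
  refine ⟨subset_closure (h.infDist_edge s).le, fun hint => ?_⟩
  have hcont : Continuous fun t : ℝ => γ s + t • N s := by fun_prop
  have hinside : ∀ᶠ t in 𝓝[>] height γ N ε Y s,
      Metric.infDist (γ s + t • N s) (Y : Set Plane) ≤ ε :=
    nhdsWithin_le_nhds (hcont.continuousAt (mem_interior_iff_mem_nhds.1 hint))
  obtain ⟨t, ht, htI⟩ := (hinside.and (Ioo_mem_nhdsGT (h.height_lt s))).exists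
  exact htI.1.not_ge <|
    (h.infDist_le_iff_le_height ((h.height_pos s).trans htI.1).le htI.2.le).1 ht

lemma frontier_eq (h : IsTubeSample γ N τ σ ε Y) :
    frontier (⋃ c ∈ Y, Metric.closedBall c ε) = range (edge γ N ε Y) ∪ range (edge γ (-N) ε Y) := by
  rw [iUnion_closedBall_eq h.nonempty]
  refine Subset.antisymm (fun x hx => h.mem_range_edge_of_infDist_eq
    (frontier_le_subset_eq (Metric.continuous_infDist_pt _) continuous_const hx)) ?_
  rintro _ (⟨s, rfl⟩ | ⟨s, rfl⟩)
  · exact h.edge_mem_frontier s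
  · exact h.neg.edge_mem_frontier s

lemma isBoundaryPair (h : IsTubeSample γ N τ σ ε Y) :
    IsBoundaryPair (⋃ c ∈ Y, Metric.closedBall c ε) (edge γ N ε Y) (edge γ (-N) ε Y) where
  simple₀ := h.isSimpleClosedCurve_edge
  simple₁ := h.neg.isSimpleClosedCurve_edge
  disjoint := by rw [h.trace_edge, h.neg.trace_edge]; exact h.disjoint_range_edge
  union := by rw [h.trace_edge, h.neg.trace_edge, h.frontier_eq]

end IsTubeSample

namespace IsBoundaryPair
variable {S : Set Plane} {g₀ g₁ k₀ k₁ : ℝ → Plane}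

lemma swap (h : IsBoundaryPair S g₀ g₁) : IsBoundaryPair S g₁ g₀ :=
  ⟨h.simple₁, h.simple₀, h.disjoint.symm, by rw [union_comm, h.union]⟩

lemma trace_subset_or (h : IsBoundaryPair S g₀ g₁) {k : ℝ → Plane} (hk : IsSimpleClosedCurve k)
    (hkS : trace k ⊆ frontier S) : trace k ⊆ trace g₀ ∨ trace k ⊆ trace g₁ :=
  isPreconnected_iff_subset_of_disjoint_closed.1 hk.isPreconnected_trace _ _
    h.simple₀.isCompact_trace.isClosed h.simple₁.isCompact_trace.isClosed
    (h.union ▸ hkS) (by rw [h.disjoint.inter_eq, inter_empty])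

lemma trace_eq_of_subset (h : IsBoundaryPair S g₀ g₁) (hk : IsBoundaryPair S k₀ k₁)
    (hsub : trace g₀ ⊆ trace k₀) : trace g₀ = trace k₀ ∧ trace g₁ = trace k₁ := by
  have hsub₀ : trace k₀ ⊆ trace g₀ :=
    (h.trace_subset_or hk.simple₀ (hk.union ▸ subset_union_left)).resolve_right fun hsub' =>
      (trace_nonempty g₀).not_subset_empty (h.disjoint.le_bot.trans' <|
        subset_inter Subset.rfl (hsub.trans hsub'))
  have heq₀ : trace g₀ = trace k₀ := hsub.antisymm hsub₀
  refine ⟨heq₀, ?_⟩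
  rw [← union_sdiff_cancel_left (s := trace g₀) (t := trace g₁) h.disjoint.le_bot,
    ← union_sdiff_cancel_left (s := trace k₀) (t := trace k₁) hk.disjoint.le_bot, h.union,
    hk.union, heq₀]

lemma trace_eq (h : IsBoundaryPair S g₀ g₁) (hk : IsBoundaryPair S k₀ k₁) :
    trace g₀ = trace k₀ ∧ trace g₁ = trace k₁ ∨ trace g₀ = trace k₁ ∧ trace g₁ = trace k₀ :=
  (hk.trace_subset_or h.simple₀ (h.union ▸ subset_union_left)).imp
    (h.trace_eq_of_subset hk) (h.trace_eq_of_subset hk.swap)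

end IsBoundaryPair

/-! ### Closest points are vertices -/

/-- `v` is a closest point of `B` to `y`. -/
def IsNearest {α : Type*} [PseudoMetricSpace α] (B : Set α) (y v : α) : Prop :=
  v ∈ B ∧ ∀ z ∈ B, dist y v ≤ dist y z

/-- The points that lie on two of the circles of radius `ε` with centres in `Y`. -/
def vertices {α : Type*} [PseudoMetricSpace α] (Y : Finset α) (ε : ℝ) : Set α :=
  {p | ∃ c ∈ Y, ∃ c' ∈ Y, c ≠ c' ∧ dist p c = ε ∧ dist p c' = ε}

/-- The points of the circles of radius `ε` with centres in `Y` that are equidistant from two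
vertices. -/
def ties {α : Type*} [PseudoMetricSpace α] (Y : Finset α) (ε : ℝ) : Set α :=
  {y | (∃ c ∈ Y, dist y c = ε) ∧
    ∃ v ∈ vertices Y ε, ∃ v' ∈ vertices Y ε, v ≠ v' ∧ dist y v = dist y v'}

lemma dist_midpoint_of_mem_segment {E : Type*} [SeminormedAddCommGroup E] [NormedSpace ℝ E]
    {y z p : E} (hz : z ∈ segment ℝ y p) :
    dist (midpoint ℝ y p) z = |dist z p - dist y z| / 2 := by
  rw [segment_eq_image_lineMap] at hz
  obtain ⟨θ, hθ, rfl⟩ := hz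
  have habs : |(⅟2 : ℝ) - θ| = |1 - θ - θ| / 2 := by
    rw [invOf_eq_inv, show (1 : ℝ) - θ - θ = 2 * (2⁻¹ - θ) by ring, abs_mul, abs_two,
      mul_div_cancel_left₀ _ two_ne_zero]
  rw [midpoint, dist_lineMap_lineMap, dist_lineMap_right, dist_left_lineMap,
    Real.norm_of_nonneg hθ.1, Real.norm_of_nonneg (sub_nonneg.2 hθ.2), ← sub_mul, abs_mul,
    abs_of_nonneg (dist_nonneg (x := y)), Real.dist_eq, habs, mul_div_right_comm]

lemma eventually_infDist_eq_dist {α : Type*} [PseudoMetricSpace α] {Y : Finset α} {c p : α}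
    (hc : c ∈ Y) (hlt : ∀ c' ∈ Y, c' ≠ c → dist p c < dist p c') :
    ∀ᶠ q in 𝓝 p, Metric.infDist q (Y : Set α) = dist q c := by
  have hall : ∀ᶠ q in 𝓝 p, ∀ c' ∈ Y, c' ≠ c → dist q c < dist q c' := by
    refine (Filter.eventually_all_finset Y).2 fun c' hc' => ?_
    by_cases hne : c' = c
    · simp [hne]
    · filter_upwards [(continuous_id.dist continuous_const).continuousAt.eventually_lt
        (continuous_id.dist continuous_const).continuousAt (hlt c' hc' hne)] with q hq _ using hq
  filter_upwards [hall] with q hq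
  refine le_antisymm (Metric.infDist_le_dist_of_mem (Finset.mem_coe.2 hc))
    ((Metric.le_infDist ⟨c, Finset.mem_coe.2 hc⟩).2 fun c' hc' => ?_)
  rcases eq_or_ne c' c with rfl | hne
  · exact le_rfl
  · exact (hq c' hc' hne).le

lemma eq_zero_and_nonneg_of_isLocalMax {a b : ℝ}
    (h : IsLocalMax (fun θ => a * Real.cos θ + b * Real.sin θ) 0) : b = 0 ∧ 0 ≤ a := by
  have hderiv : HasDerivAt (fun θ => a * Real.cos θ + b * Real.sin θ) b 0 := by
    simpa using! ((Real.hasDerivAt_cos 0).const_mul a).add ((Real.hasDerivAt_sin 0).const_mul b)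
  have hb : b = 0 := h.hasDerivAt_eq_zero hderiv
  refine ⟨hb, ?_⟩
  obtain ⟨θ, hle, hθ⟩ :=
    ((h.filter_mono nhdsWithin_le_nhds).and (Ioo_mem_nhdsGT Real.pi_pos)).exists
  have hcos : Real.cos θ < 1 :=
    Real.cos_zero ▸ Real.cos_lt_cos_of_nonneg_of_le_pi le_rfl hθ.2.le hθ.1
  simp only [hb, zero_mul, add_zero, Real.cos_zero, mul_one] at hle
  nlinarith

lemma norm_cos_smul_add_sin_smul_perp (θ : ℝ) (v : Plane) :
    ‖Real.cos θ • v + Real.sin θ • perp v‖ = ‖v‖ := by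
  rw [← sq_eq_sq₀ (norm_nonneg _) (norm_nonneg _), norm_add_sq_real, norm_smul, norm_smul,
    perp.norm_map, real_inner_smul_left, real_inner_smul_right, real_inner_comm, inner_perp_self,
    mul_pow, mul_pow, Real.norm_eq_abs, Real.norm_eq_abs, sq_abs, sq_abs]
  linear_combination ‖v‖ ^ 2 * Real.cos_sq_add_sin_sq θ

lemma exists_sub_eq_smul_of_isLocalMinOn_sphere {c y p : Plane} {ε : ℝ} (hε : 0 < ε)
    (hpc : dist p c = ε) (hmin : IsLocalMinOn (dist y) (Metric.sphere c ε) p) :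
    ∃ a : ℝ, 0 ≤ a ∧ y - c = a • (p - c) := by
  set v := p - c with hv
  set w := y - c
  have hnorm : ‖v‖ = ε := by rw [← hpc, dist_eq_norm]
  let q : ℝ → Plane := fun θ => c + (Real.cos θ • v + Real.sin θ • perp v)
  have hq0 : q 0 = p := by simp [q, hv]
  have hq_mem (θ : ℝ) : q θ ∈ Metric.sphere c ε := by
    rw [mem_sphere_iff_norm, add_sub_cancel_left, norm_cos_smul_add_sin_smul_perp, hnorm]
  have hdist (θ : ℝ) : dist y (q θ) ^ 2 = ‖w‖ ^ 2 + ‖v‖ ^ 2 -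
      2 * (inner ℝ v w * Real.cos θ + inner ℝ (perp v) w * Real.sin θ) := by
    rw [dist_eq_norm, ← sub_sub, norm_sub_sq_real, norm_cos_smul_add_sin_smul_perp,
      inner_add_right, real_inner_smul_right, real_inner_smul_right, real_inner_comm,
      real_inner_comm (perp v)]
    ring
  have hlocal : IsLocalMax
      (fun θ => inner ℝ v w * Real.cos θ + inner ℝ (perp v) w * Real.sin θ) 0 := by
    have htendsto : Tendsto q (𝓝 0) (𝓝[Metric.sphere c ε] q 0) :=
      tendsto_nhdsWithin_iff.2 ⟨Continuous.tendsto (by fun_prop) 0, Eventually.of_forall hq_mem⟩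
    rw [← hq0] at hmin
    filter_upwards [htendsto.eventually hmin] with θ hθ
    linarith [pow_le_pow_left₀ dist_nonneg hθ 2, hdist 0, hdist θ]
  obtain ⟨hperp, hinner⟩ := eq_zero_and_nonneg_of_isLocalMax hlocal
  have hcauchy : inner ℝ v w = ‖v‖ * ‖w‖ := by
    rw [← sq_eq_sq₀ hinner (by positivity), mul_pow, ← inner_sq_add_inner_perp_sq, hperp]
    ring
  refine ⟨‖w‖ / ε, by positivity, ?_⟩
  rw [div_eq_inv_mul, mul_smul, inner_eq_norm_mul_iff_real.1 hcauchy, hnorm,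
    inv_smul_smul₀ hε.ne']

/-- The bound is minus the power of the point `γ s + t • N s` with respect to the tangent circle of
radius `τ`. -/
lemma IsNormalFrame.le_norm_sq_of_inner_nonneg {γ N : ℝ → Plane} {τ : ℝ} (h : IsNormalFrame γ N τ)
    {s t : ℝ} {w : Plane} (ht : t ≤ τ) (hw : 0 ≤ inner ℝ (N s) w)
    (hmem : γ s + t • N s + w ∈ range γ) : τ ^ 2 - (τ - t) ^ 2 ≤ ‖w‖ ^ 2 := by
  have hτ := h.radius_pos
  obtain ⟨s', hs'⟩ := hmem
  have hfar := h.le_norm_sq s τ s'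
  have hsub : γ s + τ • N s - γ s' = (τ - t) • N s - w := by
    rw [hs', sub_smul]
    abel
  rw [abs_of_pos hτ, div_self hτ.ne', sub_self, zero_mul, add_zero, hsub, norm_sub_sq_real,
    norm_smul_of_norm_eq_one (h.norm_eq s), sq_abs, real_inner_smul_left] at hfar
  linarith [mul_nonneg (sub_nonneg.2 ht) hw]

namespace IsTubeSample
variable {γ N : ℝ → Plane} {τ σ ε : ℝ} {Y : Finset Plane}

lemma dist_edge_le_of_isNearest (h : IsTubeSample γ N τ σ ε Y) {s : ℝ} {p : Plane}
    (hp : IsNearest (range (edge γ (-N) ε Y)) (edge γ N ε Y s) p) :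
    dist (edge γ N ε Y s) p ≤ 2 * σ + 2 * ε := by
  refine (hp.2 _ (mem_range_self s)).trans ?_
  rw [edge, edge, Pi.neg_apply, smul_neg, ← neg_smul, h.frame.dist_add_smul, sub_neg_eq_add,
    abs_of_pos (add_pos (h.height_pos s) (h.neg.height_pos s))]
  linarith [(h.height_mem s).2, (h.neg.height_mem s).2]

lemma le_dist_edge_of_mem_range (h : IsTubeSample γ N τ σ ε Y) (s : ℝ) {z : Plane}
    (hz : z ∈ range γ) : σ ≤ dist (edge γ N ε Y s) z := by
  refine le_trans ?_ (Metric.infDist_le_dist_of_mem hz)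
  rw [h.infDist_edge_range]
  linarith [(h.height_mem s).1, h.pos]

lemma exists_mem_range_mem_segment (h : IsTubeSample γ N τ σ ε Y) {s : ℝ} {p : Plane}
    (hp : p ∈ range (edge γ (-N) ε Y)) (hd : dist (edge γ N ε Y s) p ≤ 2 * σ + 2 * ε) :
    ∃ z ∈ range γ, z ∈ segment ℝ (edge γ N ε Y s) p ∧ dist (edge γ N ε Y s) z ≤ σ + 2 * ε ∧
      dist z p ≤ σ + 2 * ε ∧ dist (midpoint ℝ (edge γ N ε Y s) p) z ≤ ε := by
  obtain ⟨s', rfl⟩ := hp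
  obtain ⟨z, hz, hzγ⟩ := h.frame.exists_mem_range_of_isPreconnected (h.height_pos s)
    (h.height_lt s) (h.neg.height_pos s') (h.neg.height_lt s')
    (convex_segment (edge γ N ε Y s) (edge γ (-N) ε Y s')).isPreconnected
    (left_mem_segment ℝ _ _) (right_mem_segment ℝ _ _)
  have hleft := h.le_dist_edge_of_mem_range s hzγ
  have hright := h.neg.le_dist_edge_of_mem_range s' hzγ
  rw [dist_comm] at hright
  have hsum := dist_add_dist_of_mem_segment hz
  refine ⟨z, hzγ, hz, by linarith, by linarith, ?_⟩
  rw [dist_midpoint_of_mem_segment hz, div_le_iff₀ two_pos, abs_le]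
  constructor <;> linarith

lemma inner_edge_sub_nonneg (h : IsTubeSample γ N τ σ ε Y) {s : ℝ} {c : Plane} (hc : c ∈ Y)
    (hd : dist (edge γ N ε Y s) c ≤ ε) : 0 ≤ inner ℝ (N s) (edge γ N ε Y s - c) := by
  have hmem := h.height_mem s
  have hε := h.pos
  have hinner := h.inner_le hc (by linarith [hmem.1]) hmem.2 hd
  rw [edge, add_comm, add_sub_assoc, ← neg_sub c, ← sub_eq_add_neg, inner_sub_right,
    real_inner_smul_right, real_inner_self_eq_norm_sq, h.frame.norm_eq]
  linarith [hmem.1]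

lemma isLocalMinOn_sphere_of_isNearest (h : IsTubeSample γ N τ σ ε Y) {s : ℝ} {p c : Plane}
    (hp : IsNearest (range (edge γ (-N) ε Y)) (edge γ N ε Y s) p) (hc : c ∈ Y)
    (hlt : ∀ c' ∈ Y, c' ≠ c → dist p c < dist p c') :
    IsLocalMinOn (dist (edge γ N ε Y s)) (Metric.sphere c ε) p := by
  have hcompl : ∀ᶠ q in 𝓝 p, q ∉ range (edge γ N ε Y) :=
    (h.periodic_edge.compact_of_continuous one_ne_zero
      h.continuous_edge).isClosed.isOpen_compl.mem_nhds
      (Set.disjoint_right.1 h.disjoint_range_edge hp.1)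
  filter_upwards [nhdsWithin_le_nhds (eventually_infDist_eq_dist hc hlt),
    nhdsWithin_le_nhds hcompl, self_mem_nhdsWithin] with q hinf hq hqc
  exact hp.2 q ((h.mem_range_edge_of_infDist_eq (hinf.trans hqc)).resolve_left hq)

lemma exists_edge_sub_eq_smul_of_isNearest (h : IsTubeSample γ N τ σ ε Y) {s : ℝ} {p c : Plane}
    (hp : IsNearest (range (edge γ (-N) ε Y)) (edge γ N ε Y s) p) (hc : c ∈ Y) (hpc : dist p c = ε)
    (hlt : ∀ c' ∈ Y, c' ≠ c → dist p c < dist p c') :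
    ∃ a : ℝ, 1 ≤ a ∧ edge γ N ε Y s - c = a • (p - c) := by
  obtain ⟨a, ha, hya⟩ := exists_sub_eq_smul_of_isLocalMinOn_sphere h.pos hpc
    (h.isLocalMinOn_sphere_of_isNearest hp hc hlt)
  have hfar : ε ≤ dist (edge γ N ε Y s) c :=
    (h.infDist_edge s).symm.trans_le (Metric.infDist_le_dist_of_mem (Finset.mem_coe.2 hc))
  rw [dist_eq_norm, hya, norm_smul, Real.norm_of_nonneg ha, ← dist_eq_norm, hpc] at hfar
  exact ⟨a, (le_mul_iff_one_le_left h.pos).1 hfar, hya⟩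

/-- If only one circle passed through the closest point `p`, its centre `c` would lie on the line
through `p` and the edge point, and the segment from `p` to the edge point, which points away from
`c`, would be too short to cross `γ`. -/
lemma mem_vertices_of_isNearest (h : IsTubeSample γ N τ σ ε Y) {s : ℝ} {p : Plane}
    (hp : IsNearest (range (edge γ (-N) ε Y)) (edge γ N ε Y s) p) : p ∈ vertices Y ε := by
  obtain ⟨z, hzγ, hzseg, -, hzp, -⟩ :=
    h.exists_mem_range_mem_segment hp.1 (h.dist_edge_le_of_isNearest hp)
  obtain ⟨s', rfl⟩ := hp.1
  set p := edge γ (-N) ε Y s'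
  have hinf : Metric.infDist p (Y : Set Plane) = ε := h.neg.infDist_edge s'
  obtain ⟨c, hc, hpc⟩ := exists_dist_eq_infDist h.nonempty p
  rw [hinf] at hpc
  by_contra hno
  have hlt : ∀ c' ∈ Y, c' ≠ c → dist p c < dist p c' := fun c' hc' hne => by
    rw [hpc]
    exact lt_of_le_of_ne (hinf ▸ Metric.infDist_le_dist_of_mem (Finset.mem_coe.2 hc'))
      fun heq => hno ⟨c, hc, c', hc', hne.symm, hpc, heq.symm⟩
  obtain ⟨a, ha, hya⟩ := h.exists_edge_sub_eq_smul_of_isNearest hp hc hpc hlt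
  rw [segment_symm, segment_eq_image_lineMap] at hzseg
  obtain ⟨μ, hμ, rfl⟩ := hzseg
  have hz : AffineMap.lineMap p (edge γ N ε Y s) μ = p + (μ * (a - 1)) • (p - c) := by
    rw [AffineMap.lineMap_apply_module', ← sub_sub_sub_cancel_right _ p c, hya, mul_smul, sub_smul,
      one_smul, add_comm]
  rw [hz] at hzγ hzp
  rw [dist_eq_norm, add_sub_cancel_left] at hzp
  have hfar := h.neg.frame.le_norm_sq_of_inner_nonneg (h.neg.height_lt s').le (by
    rw [real_inner_smul_right]
    exact mul_nonneg (mul_nonneg hμ.1 (sub_nonneg.2 ha)) (h.neg.inner_edge_sub_nonneg hc hpc.le))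
    hzγ
  nlinarith [pow_le_pow_left₀ (norm_nonneg _) hzp 2, h.pos, h.small, h.le,
    (h.neg.height_mem s').1, h.neg.height_lt s']

end IsTubeSample

lemma finite_of_forall_eq_or_eq {α : Type*} {S : Set α}
    (h : ∀ p₁ ∈ S, ∀ p₂ ∈ S, p₁ ≠ p₂ → ∀ p ∈ S, p = p₁ ∨ p = p₂) : S.Finite := by
  rcases S.subsingleton_or_nontrivial with hs | ⟨p₁, h₁, p₂, h₂, hne⟩
  · exact hs.finite
  · exact (Set.toFinite {p₁, p₂}).subset fun p hp => h p₁ h₁ p₂ h₂ hne p hp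

lemma finite_vertices (Y : Finset Plane) (ε : ℝ) : (vertices Y ε).Finite := by
  have hsub : vertices Y ε ⊆ ⋃ q ∈ Y.offDiag, {p | dist p q.1 = ε ∧ dist p q.2 = ε} := by
    rintro p ⟨c, hc, c', hc', hne, hpc, hpc'⟩
    exact mem_iUnion₂_of_mem (Finset.mem_offDiag.2 ⟨hc, hc', hne⟩ : (c, c') ∈ _) ⟨hpc, hpc'⟩
  refine (Y.offDiag.finite_toSet.biUnion fun q hq => ?_).subset hsub
  refine finite_of_forall_eq_or_eq fun p₁ h₁ p₂ h₂ hne p hp => ?_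
  exact EuclideanGeometry.eq_of_dist_eq_of_dist_eq_of_finrank_eq_two (by simp)
    (Finset.mem_offDiag.1 hq).2.2 hne h₁.1 h₂.1 hp.1 h₁.2 h₂.2 hp.2

lemma collinear_perpBisector {v v' : Plane} (hv : v ≠ v') :
    Collinear ℝ (AffineSubspace.perpBisector v v' : Set Plane) := by
  have : Fact (Module.finrank ℝ Plane = 1 + 1) := ⟨by simp⟩
  rw [collinear_iff_finrank_le_one, ← direction_affineSpan, AffineSubspace.affineSpan_coe,
    AffineSubspace.direction_perpBisector]
  exact (Submodule.finrank_orthogonal_span_singleton (vsub_ne_zero.2 hv.symm)).le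

lemma finite_perpBisector_inter_sphere {v v' : Plane} (hv : v ≠ v') (c : Plane) (ε : ℝ) :
    {y : Plane | dist y v = dist y v' ∧ dist y c = ε}.Finite := by
  refine finite_of_forall_eq_or_eq fun p₁ h₁ p₂ h₂ hne p hp => ?_
  by_contra! hne'
  have hspherical : EuclideanGeometry.Cospherical {p, p₁, p₂} :=
    ⟨c, ε, by simp [h₁.2, h₂.2, hp.2]⟩
  refine affineIndependent_iff_not_collinear_set.1
    (hspherical.affineIndependent_of_ne hne'.1 hne'.2 hne)
    ((collinear_perpBisector hv).subset ?_)
  simp [insert_subset_iff, AffineSubspace.mem_perpBisector_iff_dist_eq, h₁.1, h₂.1, hp.1]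

lemma finite_ties (Y : Finset Plane) (ε : ℝ) : (ties Y ε).Finite := by
  have hV := finite_vertices Y ε
  have hsub : ties Y ε ⊆ ⋃ c ∈ Y, ⋃ q ∈ (vertices Y ε).offDiag,
      {y | dist y q.1 = dist y q.2 ∧ dist y c = ε} := by
    rintro y ⟨⟨c, hc, hyc⟩, v, hv, v', hv', hne, heq⟩
    exact mem_iUnion₂_of_mem hc
      (mem_iUnion₂_of_mem (⟨hv, hv', hne⟩ : (v, v') ∈ (vertices Y ε).offDiag) ⟨heq, hyc⟩)
  exact (Y.finite_toSet.biUnion fun c _ => hV.offDiag.biUnion fun q hq =>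
    finite_perpBisector_inter_sphere hq.2.2 c ε).subset hsub

/-! ### Partitions and piecewise continuity -/

/-- `0 = a 0 < a 1 < ⋯ < a N = 1`; the values `a j` with `j > N` are irrelevant. -/
structure IsPartition (a : ℕ → ℝ) (N : ℕ) : Prop where
  first : a 0 = 0
  last : a N = 1
  lt : ∀ j < N, a j < a (j + 1)

namespace IsPartition
variable {a : ℕ → ℝ} {N : ℕ}

lemma pos (h : IsPartition a N) : 0 < N := by
  refine Nat.pos_of_ne_zero fun hN => zero_ne_one (α := ℝ) ?_
  rw [← h.first, ← h.last, hN]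

lemma strictMonoOn (h : IsPartition a N) : StrictMonoOn a (Iic N) :=
  strictMonoOn_of_lt_add_one ordConnected_Iic fun j _ _ hj => h.lt j hj

lemma Icc_subset (h : IsPartition a N) {j : ℕ} (hj : j < N) :
    Icc (a j) (a (j + 1)) ⊆ Icc 0 1 := by
  rw [← h.first, ← h.last]
  exact Icc_subset_Icc (h.strictMonoOn.monotoneOn (Nat.zero_le N) hj.le (Nat.zero_le j))
    (h.strictMonoOn.monotoneOn (Nat.succ_le_of_lt hj) self_mem_Iic hj)

lemma Ioc_subset (h : IsPartition a N) {j : ℕ} (hj : j < N) :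
    Ioc (a j) (a (j + 1)) ⊆ Ioc 0 1 := fun _ hu =>
  ⟨(h.Icc_subset hj (left_mem_Icc.2 (h.lt j hj).le)).1.trans_lt hu.1,
    (h.Icc_subset hj (Ioc_subset_Icc_self hu)).2⟩

lemma exists_mem_Ioc (h : IsPartition a N) {u : ℝ} (hu : u ∈ Ioc (0 : ℝ) 1) :
    ∃ j < N, u ∈ Ioc (a j) (a (j + 1)) := by
  rw [← h.first, ← h.last] at hu
  simpa only [mem_iUnion, Finset.mem_range, exists_prop] using Ioc_subset_biUnion_Ioc N a hu

lemma eq_of_mem_Ioc (h : IsPartition a N) {i j : ℕ} (hi : i < N) (hj : j < N) {u : ℝ}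
    (hui : u ∈ Ioc (a i) (a (i + 1))) (huj : u ∈ Ioc (a j) (a (j + 1))) : i = j := by
  by_contra hne
  rcases lt_or_gt_of_ne hne with hij | hij
  · exact (hui.2.trans (h.strictMonoOn.monotoneOn (mem_Iic.2 hi) (mem_Iic.2 hj.le) hij)).not_gt
      huj.1
  · exact (huj.2.trans (h.strictMonoOn.monotoneOn (mem_Iic.2 hj) (mem_Iic.2 hi.le) hij)).not_gt
      hui.1

end IsPartition

lemma exists_strictMonoOn_image_eq {α : Type*} [LinearOrder α] {t : Finset α} {N : ℕ}
    (ht : t.card = N + 1) : ∃ a : ℕ → α, StrictMonoOn a (Iic N) ∧ a '' Iic N = t := by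
  have hval : ∀ i ≤ N, (Fin.ofNat (N + 1) i : ℕ) = i := fun i hi =>
    Nat.mod_eq_of_lt (Nat.lt_succ_of_le hi)
  refine ⟨fun j => t.orderEmbOfFin ht (Fin.ofNat (N + 1) j), fun i hi j hj hij => ?_, ?_⟩
  · rwa [OrderEmbedding.lt_iff_lt, Fin.lt_def, hval i hi, hval j hj]
  · rw [← t.range_orderEmbOfFin ht]
    refine Subset.antisymm (image_subset_iff.2 fun j _ => mem_range_self _) ?_
    rintro _ ⟨i, rfl⟩
    exact ⟨i, Nat.le_of_lt_succ i.2, congr_arg _ (Fin.ext (hval i (Nat.le_of_lt_succ i.2)))⟩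

lemma exists_isPartition_disjoint {W : Set ℝ} (hW : W.Finite) :
    ∃ (N : ℕ) (a : ℕ → ℝ), IsPartition a N ∧ ∀ j < N, Disjoint (Ioo (a j) (a (j + 1))) W := by
  classical
  obtain ⟨t, ht⟩ := ((hW.inter_of_left (Icc 0 1)).union (toFinite {0, 1})).exists_finset_coe
  have ht_Icc : (t : Set ℝ) ⊆ Icc 0 1 := ht ▸
    union_subset inter_subset_right (insert_subset (by simp) (singleton_subset_iff.2 (by simp)))
  have hzero : (0 : ℝ) ∈ (t : Set ℝ) := by simp [ht]
  have hone : (1 : ℝ) ∈ (t : Set ℝ) := by simp [ht]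
  obtain ⟨N, hN⟩ := Nat.exists_eq_add_of_lt (Finset.card_pos.2 ⟨0, Finset.mem_coe.1 hzero⟩)
  rw [zero_add] at hN
  obtain ⟨a, ha, hat⟩ := exists_strictMonoOn_image_eq hN
  have hmem : ∀ j ≤ N, a j ∈ (t : Set ℝ) := fun j hj => hat ▸ mem_image_of_mem a hj
  rw [← hat] at hzero hone
  obtain ⟨i, hi, hai⟩ := hzero
  obtain ⟨k, hk, hak⟩ := hone
  refine ⟨N, a, ⟨?_, ?_, fun j hj => ha hj.le (Nat.succ_le_of_lt hj) j.lt_succ_self⟩,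
    fun j hj => Set.disjoint_left.2 fun u hu huW => ?_⟩
  · exact le_antisymm (hai ▸ ha.monotoneOn (Nat.zero_le N) hi (Nat.zero_le i))
      (ht_Icc (hmem 0 (Nat.zero_le N))).1
  · exact le_antisymm (ht_Icc (hmem N le_rfl)).2 (hak ▸ ha.monotoneOn hk self_mem_Iic hk)
  · obtain ⟨m, hm, rfl⟩ : u ∈ a '' Iic N := by
      rw [hat, ht]
      exact Or.inl ⟨huW, (ht_Icc (hmem j hj.le)).1.trans hu.1.le,
        hu.2.le.trans (ht_Icc (hmem (j + 1) hj)).2⟩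
    have hjm := (ha.lt_iff_lt hj.le hm).1 hu.1
    have hmj := (ha.lt_iff_lt hm (Nat.succ_le_of_lt hj)).1 hu.2
    omega

section OneSidedLimits
variable {α E : Type*} [LinearOrder α] [TopologicalSpace α] [OrderTopology α] [TopologicalSpace E]
  {f : α → E} {a b : α}

lemma tendsto_nhdsGT_of_continuousOn (hf : ContinuousOn f (Icc a b)) (hab : a < b) :
    Tendsto f (𝓝[>] a) (𝓝 (f a)) :=
  ((continuousWithinAt_Icc_iff_Ici hab).1 (hf a (left_mem_Icc.2 hab.le))).mono Ioi_subset_Ici_self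

lemma tendsto_nhdsLT_of_continuousOn (hf : ContinuousOn f (Icc a b)) (hab : a < b) :
    Tendsto f (𝓝[<] b) (𝓝 (f b)) :=
  ((continuousWithinAt_Icc_iff_Iic hab).1 (hf b (right_mem_Icc.2 hab.le))).mono Iio_subset_Iic_self

end OneSidedLimits

lemma IsPartition.isPiecewiseContinuous {a : ℕ → ℝ} {N : ℕ} (h : IsPartition a N)
    {F : ℝ → Plane} {f : ℕ → ℝ → Plane}
    (hf : ∀ j < N, ContinuousOn (f j) (Icc (a j) (a (j + 1))))
    (hF : ∀ j < N, EqOn F (f j) (Ioo (a j) (a (j + 1)))) : IsPiecewiseContinuous F := by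
  refine ⟨N, a, fun j => f (j - 1) (a j), fun j => if j < N then f j (a j) else f 0 (a 0),
    h.pos, h.first, h.last, h.lt, fun j hj => ?_, fun j hj => ?_, fun j hj => ?_, ?_⟩
  · exact ((hf j hj).mono Ioo_subset_Icc_self).congr (hF j hj)
  · rw [if_pos hj]
    refine (tendsto_nhdsGT_of_continuousOn (hf j hj) (h.lt j hj)).congr' ?_
    filter_upwards [Ioo_mem_nhdsGT (h.lt j hj)] with u hu using (hF j hj hu).symm
  · rw [Nat.add_sub_cancel]
    refine (tendsto_nhdsLT_of_continuousOn (hf j hj) (h.lt j hj)).congr' ?_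
    filter_upwards [Ioo_mem_nhdsLT (h.lt j hj)] with u hu using (hF j hj hu).symm
  · rw [if_neg (lt_irrefl N), if_pos h.pos]

lemma IsSimpleClosedCurve.finite_preimage {g : ℝ → Plane} (hg : IsSimpleClosedCurve g)
    {Z : Set Plane} (hZ : Z.Finite) : {u ∈ Ioc (0 : ℝ) 1 | g u ∈ Z}.Finite :=
  Set.Finite.of_finite_image (f := g) (hZ.subset (image_subset_iff.2 fun _ hu => hu.2))
    (hg.injOn_Ioc.mono fun _ hu => hu.1)

section NearestSelection
variable {X α : Type*} [TopologicalSpace X] [PseudoMetricSpace α] {g q : X → α} {B V : Set α}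

lemma eventually_eq_of_isNearest {x : X} (hg : ContinuousAt g x) (hV : V.Finite)
    (hq : ∀ᶠ x' in 𝓝 x, IsNearest B (g x') (q x') ∧ q x' ∈ V)
    (huniq : ∀ v ∈ V, IsNearest B (g x) v → v = q x) : ∀ᶠ x' in 𝓝 x, q x' = q x := by
  have hqx := hq.self_of_nhds.1
  have hcloser : ∀ᶠ x' in 𝓝 x, ∀ v ∈ V ∩ B, v ≠ q x → dist (g x') (q x) < dist (g x') v := by
    refine (hV.inter_of_left B).eventually_all.2 fun v hv => ?_
    by_cases hne : v = q x
    · exact Eventually.of_forall fun _ h => absurd hne h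
    · have hlt : dist (g x) (q x) < dist (g x) v :=
        lt_of_not_ge fun hle => hne (huniq v hv.1 ⟨hv.2, fun z hz => hle.trans (hqx.2 z hz)⟩)
      exact ((hg.dist continuousAt_const).eventually_lt (hg.dist continuousAt_const) hlt).mono
        fun _ h _ => h
  filter_upwards [hcloser, hq] with x' hx' ⟨hnear, hmem⟩
  by_contra hne
  exact (hx' _ ⟨hmem, hnear.1⟩ hne).not_ge (hnear.2 _ hqx.1)

lemma exists_forall_eq_of_isNearest [T1Space α] {S : Set X} (hS : IsPreconnected S)
    (hSo : IsOpen S) (hne : S.Nonempty) (hg : ContinuousOn g S) (hV : V.Finite)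
    (hq : ∀ x ∈ S, IsNearest B (g x) (q x) ∧ q x ∈ V)
    (huniq : ∀ x ∈ S, ∀ v ∈ V, IsNearest B (g x) v → v = q x) : ∃ v, ∀ x ∈ S, q x = v := by
  have hconst : ContinuousOn q S := fun x hx =>
    (continuousAt_const.congr ((eventually_eq_of_isNearest (hg.continuousAt (hSo.mem_nhds hx)) hV
      (eventually_of_mem (hSo.mem_nhds hx) hq) (huniq x hx)).mono
        fun _ h => h.symm)).continuousWithinAt
  obtain ⟨x₀, hx₀⟩ := hne
  exact ⟨q x₀, fun x hx =>
    hS.constant_of_mapsTo hV.isDiscrete hconst (fun x hx => (hq x hx).2) hx hx₀⟩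

end NearestSelection

/-- Closest-point selections with finitely many values and finitely many ties are constant between
the ties. -/
lemma isPiecewiseContinuous_midpoint {g : ℝ → Plane} (hg : IsSimpleClosedCurve g) {B : Set Plane}
    {p : Plane → Plane} (hp : ∀ u ∈ Icc (0 : ℝ) 1, IsNearest B (g u) (p (g u))) {V Z : Set Plane}
    (hV : V.Finite) (hZ : Z.Finite)
    (hpV : ∀ u ∈ Icc (0 : ℝ) 1, ∀ v, IsNearest B (g u) v → v ∈ V)
    (hties : ∀ u ∈ Icc (0 : ℝ) 1, g u ∉ Z → ∀ v ∈ V, ∀ v' ∈ V,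
      dist (g u) v = dist (g u) v' → v = v') :
    IsPiecewiseContinuous fun u => midpoint ℝ (g u) (p (g u)) := by
  obtain ⟨N, a, ha, hdisj⟩ := exists_isPartition_disjoint (hg.finite_preimage hZ)
  have hconst : ∀ j < N, ∃ v, ∀ u ∈ Ioo (a j) (a (j + 1)), p (g u) = v := by
    intro j hj
    have hIcc : Ioo (a j) (a (j + 1)) ⊆ Icc 0 1 := Ioo_subset_Icc_self.trans (ha.Icc_subset hj)
    refine exists_forall_eq_of_isNearest (B := B) (g := g) isPreconnected_Ioo isOpen_Ioo
      (nonempty_Ioo.2 (ha.lt j hj)) (hg.continuousOn.mono hIcc) hV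
      (fun u hu => ⟨hp u (hIcc hu), hpV u (hIcc hu) _ (hp u (hIcc hu))⟩) fun u hu v hv hnear => ?_
    have hnZ : g u ∉ Z := fun hmem => Set.disjoint_left.1 (hdisj j hj) hu
      ⟨ha.Ioc_subset hj (Ioo_subset_Ioc_self hu), hmem⟩
    have hpu := hp u (hIcc hu)
    exact hties u (hIcc hu) hnZ v hv _ (hpV u (hIcc hu) _ hpu)
      (le_antisymm (hnear.2 _ hpu.1) (hpu.2 v hnear.1))
  choose! v hv using hconst
  refine ha.isPiecewiseContinuous (f := fun j u => midpoint ℝ (g u) (v j)) (fun j hj => ?_)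
    fun j hj u hu => congr_arg (midpoint ℝ (g u)) (hv j hj u hu)
  have hcont : Continuous fun y : Plane => midpoint ℝ y (v j) := by
    simp only [midpoint_eq_smul_add]
    fun_prop
  exact hcont.comp_continuousOn (hg.continuousOn.mono (ha.Icc_subset hj))

/-! ### Existence of completions -/

lemma lineMap_sub_div {a b : ℝ} (hab : a ≠ b) (x : ℝ) :
    (AffineMap.lineMap a b x - a) / (b - a) = x := by
  rw [AffineMap.lineMap_apply_ring', add_sub_cancel_right,
    mul_div_cancel_right₀ x (sub_ne_zero.2 hab.symm)]

lemma lineMap_image_Icc {a b : ℝ} (hab : a ≤ b) :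
    AffineMap.lineMap a b '' Icc (0 : ℝ) 1 = Icc a b := by
  rw [← segment_eq_image_lineMap, segment_eq_Icc hab]

lemma lineMap_image_Ioo {a b : ℝ} (hab : a < b) :
    AffineMap.lineMap a b '' Ioo (0 : ℝ) 1 = Ioo a b := by
  rw [← openSegment_eq_image_lineMap, openSegment_eq_Ioo hab]

/-- The end of the time during which the evenly timed completion runs through the `j`-th piece:
the whole of `[j / N, (j + 1) / N]` if there is no jump from `l (j + 1)` to `r (j + 1)`, and half
of it otherwise. -/
noncomputable def runEnd (N : ℕ) (l r : ℕ → Plane) (j : ℕ) : ℝ :=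
  open scoped Classical in
  if l (j + 1) = r (j + 1) then ((j + 1 : ℕ) : ℝ) / N
  else ((j : ℝ) / N + ((j + 1 : ℕ) : ℝ) / N) / 2

/-- The completion that devotes the time `[j / N, (j + 1) / N]` to the `j`-th piece and to the
jump after it. -/
noncomputable def evenCompletion (F : ℝ → Plane) (N : ℕ) (a : ℕ → ℝ) (l r : ℕ → Plane) (x : ℝ) :
    Plane :=
  let j := ⌈N * x⌉₊ - 1
  if x ≤ 0 then r 0
  else if x < runEnd N l r j then
    F (AffineMap.lineMap (a j) (a (j + 1)) ((x - (j : ℝ) / N) / (runEnd N l r j - (j : ℝ) / N)))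
  else AffineMap.lineMap (l (j + 1)) (r (j + 1))
    ((x - runEnd N l r j) / (((j + 1 : ℕ) : ℝ) / N - runEnd N l r j))

section EvenCompletion
variable {F : ℝ → Plane} {N : ℕ} {a : ℕ → ℝ} {l r : ℕ → Plane} {x : ℝ} {j : ℕ}

lemma natCast_div_lt_succ_div (hN : 0 < N) (j : ℕ) : (j : ℝ) / N < ((j + 1 : ℕ) : ℝ) / N :=
  div_lt_div_of_pos_right (Nat.cast_lt.2 j.lt_succ_self) (Nat.cast_pos.2 hN)

lemma lt_runEnd (hN : 0 < N) (l r : ℕ → Plane) (j : ℕ) : (j : ℝ) / N < runEnd N l r j := by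
  have hlt := natCast_div_lt_succ_div hN j
  unfold runEnd
  split_ifs
  exacts [hlt, left_lt_add_div_two.2 hlt]

lemma runEnd_le (hN : 0 < N) (l r : ℕ → Plane) (j : ℕ) :
    runEnd N l r j ≤ ((j + 1 : ℕ) : ℝ) / N := by
  have hlt := natCast_div_lt_succ_div hN j
  unfold runEnd
  split_ifs
  exacts [le_rfl, (add_div_two_lt_right.2 hlt).le]

lemma runEnd_eq_iff (hN : 0 < N) :
    runEnd N l r j = ((j + 1 : ℕ) : ℝ) / N ↔ l (j + 1) = r (j + 1) := by
  have hlt := natCast_div_lt_succ_div hN j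
  unfold runEnd
  split_ifs with hlr
  exacts [iff_of_true rfl hlr, iff_of_false (add_div_two_lt_right.2 hlt).ne hlr]

lemma ceil_mul_eq_of_mem_Ioc (hN : 0 < N) (hx : x ∈ Ioc ((j : ℝ) / N) (((j + 1 : ℕ) : ℝ) / N)) :
    ⌈N * x⌉₊ = j + 1 := by
  have hN' : (0 : ℝ) < N := Nat.cast_pos.2 hN
  exact (Nat.ceil_eq_iff j.succ_ne_zero).2 ⟨(div_lt_iff₀' hN').1 hx.1, (le_div_iff₀' hN').1 hx.2⟩

lemma evenCompletion_of_lt (hN : 0 < N) (hx : (j : ℝ) / N < x) (hx' : x < runEnd N l r j) :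
    evenCompletion F N a l r x = F (AffineMap.lineMap (a j) (a (j + 1))
      ((x - (j : ℝ) / N) / (runEnd N l r j - (j : ℝ) / N))) := by
  have hceil := ceil_mul_eq_of_mem_Ioc hN ⟨hx, hx'.le.trans (runEnd_le hN l r j)⟩
  have hpos : ¬ x ≤ 0 := (lt_of_le_of_lt (by positivity) hx).not_ge
  simp only [evenCompletion, hceil, Nat.add_sub_cancel, if_neg hpos, if_pos hx']

lemma evenCompletion_of_le (hN : 0 < N) (hx : runEnd N l r j ≤ x)
    (hx' : x ≤ ((j + 1 : ℕ) : ℝ) / N) :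
    evenCompletion F N a l r x = AffineMap.lineMap (l (j + 1)) (r (j + 1))
      ((x - runEnd N l r j) / (((j + 1 : ℕ) : ℝ) / N - runEnd N l r j)) := by
  have hlt := (lt_runEnd hN l r j).trans_le hx
  have hceil := ceil_mul_eq_of_mem_Ioc hN ⟨hlt, hx'⟩
  have hpos : ¬ x ≤ 0 := (lt_of_le_of_lt (by positivity) hlt).not_ge
  simp only [evenCompletion, hceil, Nat.add_sub_cancel, if_neg hpos, if_neg hx.not_gt]

end EvenCompletion

lemma IsPiecewiseContinuousWith.isCompletion_evenCompletion {F : ℝ → Plane} {N : ℕ} {a : ℕ → ℝ}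
    {l r : ℕ → Plane} (h : IsPiecewiseContinuousWith F N a l r) :
    IsCompletion F (evenCompletion F N a l r) := by
  have hN := h.pos
  refine ⟨N, a, l, r, fun j => (j : ℝ) / N, runEnd N l r, h, by simp,
    div_self (Nat.cast_ne_zero.2 hN.ne'),
    fun j _ => ⟨lt_runEnd hN l r j, runEnd_le hN l r j, runEnd_eq_iff hN⟩,
    if_pos le_rfl, fun j _ x hx => ?_, fun j _ x hx => ?_⟩
  · have hlt := lt_runEnd hN l r j
    have hmem := lineMap_image_Ioo hlt ▸ mem_image_of_mem _ hx
    rw [evenCompletion_of_lt hN hmem.1 hmem.2, lineMap_sub_div hlt.ne]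
  · have hle := runEnd_le hN l r j
    have hmem := lineMap_image_Icc hle ▸ mem_image_of_mem _ hx
    rw [evenCompletion_of_le hN hmem.1 hmem.2]
    rcases hle.eq_or_lt with heq | hlt
    · simp only [(runEnd_eq_iff hN).1 heq, AffineMap.lineMap_same, AffineMap.const_apply]
    · rw [lineMap_sub_div hlt.ne]

lemma IsPiecewiseContinuous.exists_isCompletion {F : ℝ → Plane} (h : IsPiecewiseContinuous F) :
    ∃ G, IsCompletion F G :=
  let ⟨_, _, _, _, hF⟩ := h
  ⟨_, hF.isCompletion_evenCompletion⟩

/-! ### Monotonicity of closest points -/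

section IsOver
variable {E : Type*} [NormedAddCommGroup E] [InnerProductSpace ℝ E] {B : Set E} {y y' v v' m m' : E}

/-- `m` lies on a segment between the midpoints of `y` and two closest points to `y`: the points
of a completed medial fit that come from the boundary point `y` have this form. -/
def IsOver (B : Set E) (y m : E) : Prop :=
  ∃ v v', IsNearest B y v ∧ IsNearest B y v' ∧ m ∈ segment ℝ (midpoint ℝ y v) (midpoint ℝ y v')

lemma IsNearest.isOver (h : IsNearest B y v) : IsOver B y (midpoint ℝ y v) :=
  ⟨v, v, h, h, left_mem_segment ℝ _ _⟩

lemma IsNearest.inner_nonneg (h : IsNearest B y v) (h' : IsNearest B y' v') :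
    0 ≤ inner ℝ (y - y') (v - v') := by
  have hv := pow_le_pow_left₀ dist_nonneg (h.2 v' h'.1) 2
  have hv' := pow_le_pow_left₀ dist_nonneg (h'.2 v h.1) 2
  simp only [dist_eq_norm, norm_sub_sq_real] at hv hv'
  rw [inner_sub_left, inner_sub_right, inner_sub_right]
  linarith

lemma IsNearest.norm_sq_le_inner_midpoint (h : IsNearest B y v) (h' : IsNearest B y' v') :
    ‖y - y'‖ ^ 2 / 2 ≤ inner ℝ (y - y') (midpoint ℝ y v - midpoint ℝ y' v') := by
  have hmid : midpoint ℝ y v - midpoint ℝ y' v' = (2 : ℝ)⁻¹ • ((y - y') + (v - v')) := by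
    simp only [midpoint_eq_smul_add, invOf_eq_inv, ← smul_sub]
    congr 1
    abel
  rw [hmid, inner_smul_right, inner_add_right, real_inner_self_eq_norm_sq]
  linarith [h.inner_nonneg h']

lemma le_inner_sub_of_mem_segment {d w c : E} {k : ℝ} (h : k ≤ inner ℝ d (v - c))
    (h' : k ≤ inner ℝ d (v' - c)) (hw : w ∈ segment ℝ v v') : k ≤ inner ℝ d (w - c) := by
  rw [inner_sub_right, le_sub_iff_add_le] at h h' ⊢
  exact (convex_halfSpace_ge (innerₛₗ ℝ d).isLinear _).segment_subset h h' hw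

/-- Closest points are monotone in the sense of Minty. -/
lemma norm_sub_le_of_isOver (h : IsOver B y m) (h' : IsOver B y' m') :
    ‖y - y'‖ ≤ 2 * ‖m - m'‖ := by
  obtain ⟨v, w, hv, hw, hm⟩ := h
  obtain ⟨v', w', hv', hw', hm'⟩ := h'
  have hmono : ∀ q, IsNearest B y q →
      ‖y - y'‖ ^ 2 / 2 ≤ inner ℝ (y - y') (midpoint ℝ y q - m') := fun q hq => by
    rw [← inner_neg_neg, neg_sub, neg_sub]
    refine le_inner_sub_of_mem_segment ?_ ?_ hm' <;> rw [norm_sub_rev]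
    exacts [hv'.norm_sq_le_inner_midpoint hq, hw'.norm_sq_le_inner_midpoint hq]
  have hinner := (le_inner_sub_of_mem_segment (hmono v hv) (hmono w hw) hm).trans
    (real_inner_le_norm (y - y') (m - m'))
  rcases (norm_nonneg (y - y')).eq_or_lt with hzero | hpos
  · exact hzero ▸ mul_nonneg zero_le_two (norm_nonneg _)
  · exact le_of_mul_le_mul_left (by linarith) hpos

lemma eq_of_isOver (h : IsOver B y m) (h' : IsOver B y' m) : y = y' := by
  have hle := norm_sub_le_of_isOver h h'
  rw [sub_self, norm_zero, mul_zero] at hle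
  exact sub_eq_zero.1 (norm_le_zero_iff.1 hle)

lemma exists_lipschitzOnWith_forall_isOver_iff {M : Set E} (h : ∀ m ∈ M, ∃ y, IsOver B y m) :
    ∃ π : E → E, LipschitzOnWith 2 π M ∧ ∀ m ∈ M, ∀ y, IsOver B y m ↔ π m = y := by
  choose! π hπ using h
  refine ⟨π, .of_dist_le_mul fun m hm m' hm' => ?_, fun m hm y =>
    ⟨eq_of_isOver (hπ m hm), fun hy => hy ▸ hπ m hm⟩⟩
  rw [dist_eq_norm, dist_eq_norm]
  exact norm_sub_le_of_isOver (hπ m hm) (hπ m' hm')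

end IsOver

lemma exists_isNearest_of_tendsto {X E : Type*} [NormedAddCommGroup E] [NormedSpace ℝ E]
    {B : Set E} (hB : IsClosed B) {g q : X → E} {𝓕 : Filter X} [𝓕.NeBot]
    (hq : ∀ᶠ u in 𝓕, IsNearest B (g u) (q u)) {y L : E} (hg : Tendsto g 𝓕 (𝓝 y))
    (hL : Tendsto (fun u => midpoint ℝ (g u) (q u)) 𝓕 (𝓝 L)) :
    ∃ v, IsNearest B y v ∧ L = midpoint ℝ y v := by
  have hlim : Tendsto q 𝓕 (𝓝 ((2 : ℝ) • L - y)) := by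
    refine ((hL.const_smul (2 : ℝ)).sub hg).congr fun u => ?_
    simp [midpoint_eq_smul_add]
  refine ⟨(2 : ℝ) • L - y, ⟨hB.mem_of_tendsto hlim (hq.mono fun u hu => hu.1),
    fun z hz => le_of_tendsto_of_tendsto (hg.dist hlim) (hg.dist tendsto_const_nhds)
      (hq.mono fun u hu => hu.2 z hz)⟩, ?_⟩
  simp [midpoint_eq_smul_add]

/-! ### Completions of medial fits -/

lemma IsSimpleClosedCurve.of_injOn_Ioc {G : ℝ → Plane} (hcont : ContinuousOn G (Icc 0 1))
    (hclosed : G 0 = G 1) (hinj : InjOn G (Ioc 0 1)) : IsSimpleClosedCurve G := by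
  refine ⟨hcont, hclosed, fun u hu v hv huv => ?_⟩
  wlog hlt : u < v generalizing u v
  · rcases (not_lt.1 hlt).eq_or_lt with heq | hgt
    exacts [heq.symm, (this v hv u hu huv.symm hgt).symm]
  rcases hu.1.eq_or_lt with rfl | hpos
  · exact absurd (hinj ⟨hlt, hv.2.le⟩ ⟨zero_lt_one, le_rfl⟩ (huv.symm.trans hclosed)) hv.2.ne
  · exact hinj ⟨hpos, hu.2.le⟩ ⟨hpos.trans hlt, hv.2.le⟩ huv

lemma trace_eq_image_Ioc {g : ℝ → Plane} (hg : g 0 = g 1) : trace g = g '' Ioc 0 1 := by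
  rw [trace, ← Ioc_insert_left zero_le_one, image_insert_eq, hg]
  exact insert_eq_of_mem (mem_image_of_mem g ⟨zero_lt_one, le_rfl⟩)

lemma continuousOn_Icc_of_tendsto {α E : Type*} [LinearOrder α] [TopologicalSpace α]
    [OrderTopology α] [TopologicalSpace E] {f : α → E} {a b : α}
    (hf : ContinuousOn f (Ioo a b)) (ha : Tendsto f (𝓝[>] a) (𝓝 (f a)))
    (hb : Tendsto f (𝓝[<] b) (𝓝 (f b))) : ContinuousOn f (Icc a b) := by
  intro x hx
  rcases hx.1.eq_or_lt with rfl | hax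
  · exact (continuousWithinAt_Ioi_iff_Ici.1 ha).mono Icc_subset_Ici_self
  rcases hx.2.eq_or_lt with rfl | hxb
  · exact (continuousWithinAt_Iio_iff_Iic.1 hb).mono Icc_subset_Iic_self
  · exact (hf.continuousAt (Ioo_mem_nhds hax hxb)).continuousWithinAt

section LineMap
variable {a b : ℝ}

lemma continuousOn_Icc_of_comp_lineMap {E : Type*} [TopologicalSpace E] {G : ℝ → E} (hab : a < b)
    (hG : ContinuousOn (fun y => G (AffineMap.lineMap a b y)) (Icc (0 : ℝ) 1)) :
    ContinuousOn G (Icc a b) := by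
  have hinv : ∀ x : ℝ, AffineMap.lineMap a b ((x - a) / (b - a)) = x := fun x => by
    rw [AffineMap.lineMap_apply_ring', div_mul_cancel₀ _ (sub_ne_zero.2 hab.ne'), sub_add_cancel]
  have hcomp := hG.comp (f := fun x => (x - a) / (b - a)) (s := Icc a b) (by fun_prop)
    fun x hx => ⟨div_nonneg (sub_nonneg.2 hx.1) (sub_nonneg.2 hab.le),
      (div_le_one (sub_pos.2 hab)).2 (sub_le_sub_right hx.2 a)⟩
  simpa only [Function.comp_def, hinv] using hcomp

lemma tendsto_lineMap_nhdsGT (hab : a < b) :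
    Tendsto (AffineMap.lineMap a b : ℝ → ℝ) (𝓝[>] 0) (𝓝[>] a) := by
  refine tendsto_nhdsWithin_iff.2 ⟨?_, ?_⟩
  · exact (AffineMap.lineMap_continuous.tendsto' 0 a (by simp)).mono_left nhdsWithin_le_nhds
  · filter_upwards [self_mem_nhdsWithin] with y hy using (left_lt_lineMap_iff_pos hab).2 hy

lemma tendsto_lineMap_nhdsLT (hab : a < b) :
    Tendsto (AffineMap.lineMap a b : ℝ → ℝ) (𝓝[<] 1) (𝓝[<] b) := by
  refine tendsto_nhdsWithin_iff.2 ⟨?_, ?_⟩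
  · exact (AffineMap.lineMap_continuous.tendsto' 1 b (by simp)).mono_left nhdsWithin_le_nhds
  · filter_upwards [self_mem_nhdsWithin] with y hy using (lineMap_lt_right_iff_lt_one hab).2 hy

end LineMap

/-- The completed curve passes the parameter `u ∈ (a j, a (j + 1)]` of the fit at time `x`, where
`[s j, t j]` is the time of the `j`-th piece and `[t j, s (j + 1)]` that of the jump after it. -/
def IsPassage (a s t : ℕ → ℝ) (j : ℕ) (u x : ℝ) : Prop :=
  (∃ y ∈ Ioo (0 : ℝ) 1, AffineMap.lineMap (a j) (a (j + 1)) y = u ∧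
    AffineMap.lineMap (s j) (t j) y = x) ∨
  (u = a (j + 1) ∧ ∃ y ∈ Icc (0 : ℝ) 1, AffineMap.lineMap (t j) (s (j + 1)) y = x)

/-- A completed medial fit together with its partition, one-sided limits and time scale. -/
structure IsMedialCompletion (g : ℝ → Plane) (B : Set Plane) (p : Plane → Plane) (G : ℝ → Plane)
    (N : ℕ) (a : ℕ → ℝ) (l r : ℕ → Plane) (s t : ℕ → ℝ) : Prop where
  simple : IsSimpleClosedCurve g
  closed : IsClosed B
  nearest : ∀ u ∈ Icc (0 : ℝ) 1, IsNearest B (g u) (p (g u))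
  piecewise : IsPiecewiseContinuousWith (fun u => midpoint ℝ (g u) (p (g u))) N a l r
  first : s 0 = 0
  last : s N = 1
  times : ∀ j < N, s j < t j ∧ t j ≤ s (j + 1) ∧ (t j = s (j + 1) ↔ l (j + 1) = r (j + 1))
  start : G 0 = r 0
  run : ∀ j < N, ∀ y ∈ Ioo (0 : ℝ) 1, G (AffineMap.lineMap (s j) (t j) y) =
    midpoint ℝ (g (AffineMap.lineMap (a j) (a (j + 1)) y))
      (p (g (AffineMap.lineMap (a j) (a (j + 1)) y)))
  jump : ∀ j < N, ∀ y ∈ Icc (0 : ℝ) 1, G (AffineMap.lineMap (t j) (s (j + 1)) y) =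
    AffineMap.lineMap (l (j + 1)) (r (j + 1)) y

namespace IsMedialCompletion
variable {g : ℝ → Plane} {B : Set Plane} {p : Plane → Plane} {G : ℝ → Plane} {N : ℕ}
  {a : ℕ → ℝ} {l r : ℕ → Plane} {s t : ℕ → ℝ} {j j' : ℕ} {u u' x x' : ℝ} {y y' m m' : Plane}

lemma isPartition (h : IsMedialCompletion g B p G N a l r s t) : IsPartition a N :=
  ⟨h.piecewise.first, h.piecewise.last, h.piecewise.lt⟩

lemma isPartition_time (h : IsMedialCompletion g B p G N a l r s t) : IsPartition s N :=
  ⟨h.first, h.last, fun j hj => (h.times j hj).1.trans_le (h.times j hj).2.1⟩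

lemma apply_runEnd (h : IsMedialCompletion g B p G N a l r s t) (hj : j < N) :
    G (t j) = l (j + 1) := by
  simpa using h.jump j hj 0 (by simp)

lemma apply_node (h : IsMedialCompletion g B p G N a l r s t) (hj : j ≤ N) : G (s j) = r j := by
  cases j with
  | zero => rw [h.first, h.start]
  | succ k => simpa using h.jump k hj 1 (by simp)

lemma apply_zero (h : IsMedialCompletion g B p G N a l r s t) : G 0 = G 1 := by
  rw [h.start, ← h.last, h.apply_node le_rfl, h.piecewise.wrap]

lemma continuousOn_run (h : IsMedialCompletion g B p G N a l r s t) (hj : j < N) :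
    ContinuousOn G (Icc (s j) (t j)) := by
  have hlt := h.piecewise.lt j hj
  refine continuousOn_Icc_of_comp_lineMap (h.times j hj).1 (continuousOn_Icc_of_tendsto ?_ ?_ ?_)
  · refine ContinuousOn.congr (f := (fun u => midpoint ℝ (g u) (p (g u))) ∘
      AffineMap.lineMap (a j) (a (j + 1))) ?_ (h.run j hj)
    exact (h.piecewise.continuousOn j hj).comp AffineMap.lineMap_continuous.continuousOn
      fun y hy => lineMap_image_Ioo hlt ▸ mem_image_of_mem _ hy
  · rw [AffineMap.lineMap_apply_zero, h.apply_node hj.le]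
    refine ((h.piecewise.right j hj).comp (tendsto_lineMap_nhdsGT hlt)).congr' ?_
    filter_upwards [Ioo_mem_nhdsGT zero_lt_one] with y hy using (h.run j hj y hy).symm
  · rw [AffineMap.lineMap_apply_one, h.apply_runEnd hj]
    refine ((h.piecewise.left j hj).comp (tendsto_lineMap_nhdsLT hlt)).congr' ?_
    filter_upwards [Ioo_mem_nhdsLT zero_lt_one] with y hy using (h.run j hj y hy).symm

lemma continuousOn_jump (h : IsMedialCompletion g B p G N a l r s t) (hj : j < N) :
    ContinuousOn G (Icc (t j) (s (j + 1))) := by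
  rcases (h.times j hj).2.1.eq_or_lt with heq | hlt
  · rw [heq, Icc_self]
    exact continuousOn_singleton _ _
  · exact continuousOn_Icc_of_comp_lineMap hlt
      (AffineMap.lineMap_continuous.continuousOn.congr (h.jump j hj))

lemma continuousOn (h : IsMedialCompletion g B p G N a l r s t) : ContinuousOn G (Icc 0 1) := by
  have hinit : ∀ k ≤ N, ContinuousOn G (Icc (s 0) (s k)) := by
    intro k hk
    induction k with
    | zero => exact Icc_self (s 0) ▸ continuousOn_singleton _ _
    | succ k ih =>
      obtain ⟨hrun, hjump, -⟩ := h.times k hk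
      rw [← Icc_union_Icc_eq_Icc (h.isPartition_time.strictMonoOn.monotoneOn (Nat.zero_le N)
        (Nat.le_of_succ_le hk) (Nat.zero_le k)) (hrun.le.trans hjump),
        ← Icc_union_Icc_eq_Icc hrun.le hjump]
      exact (ih (Nat.le_of_succ_le hk)).union_of_isClosed ((h.continuousOn_run hk).union_of_isClosed
        (h.continuousOn_jump hk) isClosed_Icc isClosed_Icc) isClosed_Icc
        (isClosed_Icc.union isClosed_Icc)
  simpa only [h.first, h.last] using hinit N le_rfl

lemma exists_isNearest_left (h : IsMedialCompletion g B p G N a l r s t) (hj : j < N) :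
    ∃ v, IsNearest B (g (a (j + 1))) v ∧ l (j + 1) = midpoint ℝ (g (a (j + 1))) v := by
  have hlt := h.piecewise.lt j hj
  have hIcc := h.isPartition.Icc_subset hj
  refine exists_isNearest_of_tendsto h.closed (q := fun u => p (g u)) ?_
    (tendsto_nhdsLT_of_continuousOn (h.simple.continuousOn.mono hIcc) hlt) (h.piecewise.left j hj)
  filter_upwards [Ioo_mem_nhdsLT hlt] with u hu using h.nearest u (hIcc (Ioo_subset_Icc_self hu))

lemma exists_isNearest_right_of_lt (h : IsMedialCompletion g B p G N a l r s t) (hj : j < N) :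
    ∃ v, IsNearest B (g (a j)) v ∧ r j = midpoint ℝ (g (a j)) v := by
  have hlt := h.piecewise.lt j hj
  have hIcc := h.isPartition.Icc_subset hj
  refine exists_isNearest_of_tendsto h.closed (q := fun u => p (g u)) ?_
    (tendsto_nhdsGT_of_continuousOn (h.simple.continuousOn.mono hIcc) hlt) (h.piecewise.right j hj)
  filter_upwards [Ioo_mem_nhdsGT hlt] with u hu using h.nearest u (hIcc (Ioo_subset_Icc_self hu))

lemma exists_isNearest_right (h : IsMedialCompletion g B p G N a l r s t) (hj : j ≤ N) :
    ∃ v, IsNearest B (g (a j)) v ∧ r j = midpoint ℝ (g (a j)) v := by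
  rcases hj.eq_or_lt with rfl | hj
  · rw [h.piecewise.last, ← h.simple.closed, ← h.piecewise.first, h.piecewise.wrap]
    exact h.exists_isNearest_right_of_lt h.piecewise.pos
  · exact h.exists_isNearest_right_of_lt hj

lemma isOver_of_mem_segment (h : IsMedialCompletion g B p G N a l r s t) (hj : j < N)
    (hm : m ∈ segment ℝ (l (j + 1)) (r (j + 1))) : IsOver B (g (a (j + 1))) m := by
  obtain ⟨v, hv, hl⟩ := h.exists_isNearest_left hj
  obtain ⟨v', hv', hr⟩ := h.exists_isNearest_right (Nat.succ_le_of_lt hj)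
  rw [hl, hr] at hm
  exact ⟨v, v', hv, hv', hm⟩

lemma exists_isPassage_time (h : IsMedialCompletion g B p G N a l r s t)
    (hx : x ∈ Ioc (0 : ℝ) 1) : ∃ j < N, ∃ u, IsPassage a s t j u x := by
  obtain ⟨j, hj, hxj⟩ := h.isPartition_time.exists_mem_Ioc hx
  obtain ⟨hrun, hjump, -⟩ := h.times j hj
  rcases lt_or_ge x (t j) with hxt | hxt
  · obtain ⟨y, hy, hyx⟩ := (lineMap_image_Ioo hrun).ge ⟨hxj.1, hxt⟩
    exact ⟨j, hj, _, Or.inl ⟨y, hy, rfl, hyx⟩⟩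
  · exact ⟨j, hj, _, Or.inr ⟨rfl, (lineMap_image_Icc hjump).ge ⟨hxt, hxj.2⟩⟩⟩

lemma exists_isPassage_param (h : IsMedialCompletion g B p G N a l r s t)
    (hu : u ∈ Ioc (0 : ℝ) 1) : ∃ j < N, ∃ x, IsPassage a s t j u x := by
  obtain ⟨j, hj, huj⟩ := h.isPartition.exists_mem_Ioc hu
  rcases huj.2.eq_or_lt with heq | hlt
  · exact ⟨j, hj, _, Or.inr ⟨heq, 0, left_mem_Icc.2 zero_le_one, rfl⟩⟩
  · obtain ⟨y, hy, hyu⟩ := (lineMap_image_Ioo (h.piecewise.lt j hj)).ge ⟨huj.1, hlt⟩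
    exact ⟨j, hj, _, Or.inl ⟨y, hy, hyu, rfl⟩⟩

lemma param_mem_Ioc (h : IsMedialCompletion g B p G N a l r s t) (hj : j < N)
    (hux : IsPassage a s t j u x) : u ∈ Ioc (a j) (a (j + 1)) := by
  have hlt := h.piecewise.lt j hj
  rcases hux with ⟨y, hy, rfl, -⟩ | ⟨rfl, -⟩
  · exact Ioo_subset_Ioc_self ((lineMap_image_Ioo hlt).le (mem_image_of_mem _ hy))
  · exact ⟨hlt, le_rfl⟩

lemma time_mem_Icc (h : IsMedialCompletion g B p G N a l r s t) (hj : j < N)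
    (hux : IsPassage a s t j u x) : x ∈ Icc (0 : ℝ) 1 := by
  obtain ⟨hrun, hjump, -⟩ := h.times j hj
  refine h.isPartition_time.Icc_subset hj ?_
  rcases hux with ⟨y, hy, -, rfl⟩ | ⟨-, y, hy, rfl⟩
  · have hmem := (lineMap_image_Ioo hrun).le (mem_image_of_mem _ hy)
    exact ⟨hmem.1.le, hmem.2.le.trans hjump⟩
  · have hmem := (lineMap_image_Icc hjump).le (mem_image_of_mem _ hy)
    exact ⟨hrun.le.trans hmem.1, hmem.2⟩

lemma isOver_of_isPassage (h : IsMedialCompletion g B p G N a l r s t) (hj : j < N)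
    (hux : IsPassage a s t j u x) : IsOver B (g u) (G x) := by
  have hu := h.isPartition.Icc_subset hj (Ioc_subset_Icc_self (h.param_mem_Ioc hj hux))
  rcases hux with ⟨y, hy, rfl, rfl⟩ | ⟨rfl, y, hy, rfl⟩
  · rw [h.run j hj y hy]
    exact (h.nearest _ hu).isOver
  · refine h.isOver_of_mem_segment hj ?_
    rw [h.jump j hj y hy, segment_eq_image_lineMap]
    exact mem_image_of_mem _ hy

lemma param_eq_of_isOver (h : IsMedialCompletion g B p G N a l r s t) (hu : u ∈ Ioc (0 : ℝ) 1)
    (hu' : u' ∈ Ioc (0 : ℝ) 1) (hm : IsOver B (g u) m) (hm' : IsOver B (g u') m) : u = u' :=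
  h.simple.injOn_Ioc hu hu' (eq_of_isOver hm hm')

lemma injOn_Ioc (h : IsMedialCompletion g B p G N a l r s t) : InjOn G (Ioc 0 1) := by
  intro x hx x' hx' hxx
  obtain ⟨j, hj, u, hux⟩ := h.exists_isPassage_time hx
  obtain ⟨j', hj', u', hux'⟩ := h.exists_isPassage_time hx'
  have hu := h.param_mem_Ioc hj hux
  have hu' := h.param_mem_Ioc hj' hux'
  obtain rfl : u = u' := h.param_eq_of_isOver (h.isPartition.Ioc_subset hj hu)
    (h.isPartition.Ioc_subset hj' hu') (h.isOver_of_isPassage hj hux)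
    (hxx ▸ h.isOver_of_isPassage hj' hux')
  obtain rfl : j = j' := h.isPartition.eq_of_mem_Ioc hj hj' hu hu'
  have hlt := h.piecewise.lt j hj
  rcases hux with ⟨y, hy, hyu, rfl⟩ | ⟨rfl, y, hy, rfl⟩ <;>
    rcases hux' with ⟨y', hy', hyu', rfl⟩ | ⟨hu', y', hy', rfl⟩
  · rw [AffineMap.lineMap_injective ℝ hlt.ne (hyu.trans hyu'.symm)]
  · exact absurd (hyu.trans hu') ((lineMap_lt_right_iff_lt_one hlt).2 hy.2).ne
  · exact absurd hyu' ((lineMap_lt_right_iff_lt_one hlt).2 hy'.2).ne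
  · rw [h.jump j hj y hy, h.jump j hj y' hy'] at hxx
    by_cases hlr : l (j + 1) = r (j + 1)
    · rw [(h.times j hj).2.2.2 hlr, AffineMap.lineMap_same_apply, AffineMap.lineMap_same_apply]
    · rw [AffineMap.lineMap_injective ℝ hlr hxx]

theorem isSimpleClosedCurve (h : IsMedialCompletion g B p G N a l r s t) :
    IsSimpleClosedCurve G :=
  .of_injOn_Ioc h.continuousOn h.apply_zero h.injOn_Ioc

lemma exists_isOver (h : IsMedialCompletion g B p G N a l r s t) (hm : m ∈ trace G) :
    ∃ y ∈ trace g, IsOver B y m := by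
  obtain ⟨x, hx, rfl⟩ := trace_eq_image_Ioc h.apply_zero ▸ hm
  obtain ⟨j, hj, u, hux⟩ := h.exists_isPassage_time hx
  exact ⟨g u, ⟨u, h.isPartition.Icc_subset hj (Ioc_subset_Icc_self (h.param_mem_Ioc hj hux)), rfl⟩,
    h.isOver_of_isPassage hj hux⟩

lemma exists_mem_trace (h : IsMedialCompletion g B p G N a l r s t) (hy : y ∈ trace g) :
    ∃ m ∈ trace G, IsOver B y m := by
  obtain ⟨u, hu, rfl⟩ := trace_eq_image_Ioc h.simple.closed ▸ hy
  obtain ⟨j, hj, x, hux⟩ := h.exists_isPassage_param hu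
  exact ⟨G x, ⟨x, h.time_mem_Icc hj hux, rfl⟩, h.isOver_of_isPassage hj hux⟩

lemma exists_isPassage_of_isOver (h : IsMedialCompletion g B p G N a l r s t)
    (hu : u ∈ Ioc (0 : ℝ) 1) (hm : m ∈ trace G) (hum : IsOver B (g u) m) :
    ∃ j < N, ∃ x, IsPassage a s t j u x ∧ G x = m := by
  obtain ⟨x, hx, rfl⟩ := trace_eq_image_Ioc h.apply_zero ▸ hm
  obtain ⟨j, hj, u', hux⟩ := h.exists_isPassage_time hx
  obtain rfl : u = u' := h.param_eq_of_isOver hu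
    (h.isPartition.Ioc_subset hj (h.param_mem_Ioc hj hux)) hum (h.isOver_of_isPassage hj hux)
  exact ⟨j, hj, x, hux, rfl⟩

lemma segment_subset_of_isOver (h : IsMedialCompletion g B p G N a l r s t) (hy : y ∈ trace g)
    (hm : m ∈ trace G) (hm' : m' ∈ trace G) (hym : IsOver B y m) (hym' : IsOver B y m') :
    ∀ q ∈ segment ℝ m m', q ∈ trace G ∧ IsOver B y q := by
  obtain ⟨u, hu, rfl⟩ := trace_eq_image_Ioc h.simple.closed ▸ hy
  obtain ⟨j, hj, x, hux, rfl⟩ := h.exists_isPassage_of_isOver hu hm hym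
  obtain ⟨j', hj', x', hux', rfl⟩ := h.exists_isPassage_of_isOver hu hm' hym'
  obtain rfl : j = j' :=
    h.isPartition.eq_of_mem_Ioc hj hj' (h.param_mem_Ioc hj hux) (h.param_mem_Ioc hj' hux')
  have hlt := h.piecewise.lt j hj
  intro q hq
  rcases hux with ⟨y, hy, hyu, rfl⟩ | ⟨rfl, y, hy, rfl⟩ <;>
    rcases hux' with ⟨y', hy', hyu', rfl⟩ | ⟨hu', y', hy', rfl⟩
  · rw [AffineMap.lineMap_injective ℝ hlt.ne (hyu.trans hyu'.symm), segment_same,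
      mem_singleton_iff] at hq
    exact hq ▸ ⟨hm', hym'⟩
  · exact absurd (hyu.trans hu') ((lineMap_lt_right_iff_lt_one hlt).2 hy.2).ne
  · exact absurd hyu' ((lineMap_lt_right_iff_lt_one hlt).2 hy'.2).ne
  · have hseg : q ∈ segment ℝ (l (j + 1)) (r (j + 1)) := by
      rw [h.jump j hj y hy, h.jump j hj y' hy'] at hq
      refine (convex_segment _ _).segment_subset ?_ ?_ hq <;> rw [segment_eq_image_lineMap]
      exacts [mem_image_of_mem _ hy, mem_image_of_mem _ hy']
    refine ⟨?_, h.isOver_of_mem_segment hj hseg⟩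
    obtain ⟨z, hz, rfl⟩ := segment_eq_image_lineMap ℝ (l (j + 1)) (r (j + 1)) ▸ hseg
    exact ⟨_, h.time_mem_Icc hj (Or.inr ⟨rfl, z, hz, rfl⟩), h.jump j hj z hz⟩

/-- The boundary point is a continuous function of the fitted point, not conversely: so
connectedness of `A` is applied to the closed images of the two parts of the fit on which `ψ` has
a sign. -/
lemma exists_isOver_eq_zero (h : IsMedialCompletion g B p G N a l r s t) {A : Set Plane}
    (hA : IsPreconnected A) (hAg : A ⊆ trace g) {ψ : Plane → ℝ} (hψ : Continuous ψ)
    (hy : y ∈ A) (hm : m ∈ trace G) (hym : IsOver B y m) (hψm : 0 ≤ ψ m)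
    (hy' : y' ∈ A) (hm' : m' ∈ trace G) (hym' : IsOver B y' m') (hψm' : ψ m' ≤ 0) :
    ∃ z ∈ A, ∃ q ∈ trace G, IsOver B z q ∧ ψ q = 0 := by
  obtain ⟨π, hπ, hover⟩ := exists_lipschitzOnWith_forall_isOver_iff fun q hq =>
    (h.exists_isOver hq).imp fun _ hz => hz.2
  have hclosed : ∀ S : Set Plane, IsClosed S → IsClosed (π '' (trace G ∩ S)) := fun S hS =>
    ((h.isSimpleClosedCurve.isCompact_trace.inter_right hS).image_of_continuousOn
      (hπ.continuousOn.mono inter_subset_left)).isClosed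
  have hcover : A ⊆ π '' (trace G ∩ {q | 0 ≤ ψ q}) ∪ π '' (trace G ∩ {q | ψ q ≤ 0}) := by
    intro z hz
    obtain ⟨q, hq, hzq⟩ := h.exists_mem_trace (hAg hz)
    exact (le_total 0 (ψ q)).imp (fun hψq => ⟨q, ⟨hq, hψq⟩, (hover q hq z).1 hzq⟩)
      fun hψq => ⟨q, ⟨hq, hψq⟩, (hover q hq z).1 hzq⟩
  obtain ⟨z, hz, ⟨q, ⟨hq, hψq⟩, hqz⟩, ⟨q', ⟨hq', hψq'⟩, hqz'⟩⟩ :=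
    isPreconnected_closed_iff.1 hA _ _ (hclosed _ (isClosed_le continuous_const hψ))
      (hclosed _ (isClosed_le hψ continuous_const)) hcover
      ⟨y, hy, m, ⟨hm, hψm⟩, (hover m hm y).1 hym⟩
      ⟨y', hy', m', ⟨hm', hψm'⟩, (hover m' hm' y').1 hym'⟩
  obtain ⟨x, hx, hψx⟩ := (convex_segment q q').isPreconnected.intermediate_value
    (right_mem_segment ℝ q q') (left_mem_segment ℝ q q') hψ.continuousOn ⟨hψq', hψq⟩
  obtain ⟨hxG, hzx⟩ := h.segment_subset_of_isOver (hAg hz) hq hq' ((hover q hq z).2 hqz)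
    ((hover q' hq' z).2 hqz') x hx
  exact ⟨z, hz, x, hxG, hzx, hψx⟩

end IsMedialCompletion

/-! ### Medial fits of a dense sample -/

/-- `g` parametrizes the boundary curve on the side of `N`, and `p` chooses closest points on the
other boundary curve: the data of a medial fit. -/
structure IsMedialSelection (γ N : ℝ → Plane) (ε : ℝ) (Y : Finset Plane) (g : ℝ → Plane)
    (p : Plane → Plane) : Prop where
  simple : IsSimpleClosedCurve g
  trace_eq : trace g = range (edge γ N ε Y)
  nearest : ∀ u ∈ Icc (0 : ℝ) 1, IsNearest (range (edge γ (-N) ε Y)) (g u) (p (g u))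

lemma exists_isNearest_of_isCompact {α : Type*} [PseudoMetricSpace α] {B : Set α} (hB : IsCompact B)
    (hne : B.Nonempty) (y : α) : ∃ v, IsNearest B y v := by
  obtain ⟨v, hv, hd⟩ := hB.exists_infDist_eq_dist hne y
  exact ⟨v, hv, fun z hz => hd ▸ Metric.infDist_le_dist_of_mem hz⟩

lemma IsBoundaryPair.exists_isMedialFit {S : Set Plane} {g₀ g₁ : ℝ → Plane}
    (h : IsBoundaryPair S g₀ g₁) : ∃ F, IsMedialFit S F := by
  choose p hp using exists_isNearest_of_isCompact h.simple₁.isCompact_trace (trace_nonempty g₁)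
  exact ⟨_, g₀, g₁, p, h, fun y _ => hp y, rfl⟩

namespace IsMedialSelection
variable {γ N : ℝ → Plane} {τ σ ε : ℝ} {Y : Finset Plane} {g G : ℝ → Plane} {p : Plane → Plane}

lemma exists_edge_eq (hs : IsMedialSelection γ N ε Y g p) {u : ℝ} (hu : u ∈ Icc (0 : ℝ) 1) :
    ∃ s, edge γ N ε Y s = g u :=
  hs.trace_eq.le (mem_image_of_mem g hu)

lemma isPiecewiseContinuous (hs : IsMedialSelection γ N ε Y g p) (h : IsTubeSample γ N τ σ ε Y) :
    IsPiecewiseContinuous fun u => midpoint ℝ (g u) (p (g u)) := by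
  refine isPiecewiseContinuous_midpoint hs.simple hs.nearest (finite_vertices Y ε)
    (finite_ties Y ε) (fun u hu v hv => ?_) fun u hu hties v hv v' hv' hd => ?_
  · obtain ⟨s, hsu⟩ := hs.exists_edge_eq hu
    rw [← hsu] at hv
    exact h.mem_vertices_of_isNearest hv
  · by_contra hne
    refine hties ⟨?_, v, hv, v', hv', hne, hd⟩
    obtain ⟨s, hsu⟩ := hs.exists_edge_eq hu
    obtain ⟨c, hc, hcd⟩ := exists_dist_eq_infDist h.nonempty (g u)
    exact ⟨c, hc, by rw [hcd, ← hsu, h.infDist_edge]⟩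

lemma exists_isMedialCompletion (hs : IsMedialSelection γ N ε Y g p)
    (h : IsTubeSample γ N τ σ ε Y)
    (hG : IsCompletion (fun u => midpoint ℝ (g u) (p (g u))) G) : ∃ K a l r s t,
      IsMedialCompletion g (range (edge γ (-N) ε Y)) p G K a l r s t := by
  obtain ⟨K, a, l, r, s, t, hpc, hfirst, hlast, htimes, hstart, hrun, hjump⟩ := hG
  have hclosed : IsClosed (range (edge γ (-N) ε Y)) :=
    h.neg.trace_edge ▸ h.neg.isSimpleClosedCurve_edge.isCompact_trace.isClosed
  exact ⟨K, a, l, r, s, t, hs.simple, hclosed, hs.nearest, hpc, hfirst, hlast, htimes, hstart,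
    hrun, hjump⟩

end IsMedialSelection

namespace IsTubeSample
variable {γ N : ℝ → Plane} {τ σ ε : ℝ} {Y : Finset Plane} {F : ℝ → Plane}

lemma exists_isMedialSelection (h : IsTubeSample γ N τ σ ε Y)
    (hF : IsMedialFit (⋃ c ∈ Y, Metric.closedBall c ε) F) : ∃ g p,
      F = (fun u => midpoint ℝ (g u) (p (g u))) ∧
        (IsMedialSelection γ N ε Y g p ∨ IsMedialSelection γ (-N) ε Y g p) := by
  obtain ⟨g₀, g₁, p, hg, hp, rfl⟩ := hF
  have hnear : ∀ u ∈ Icc (0 : ℝ) 1, IsNearest (trace g₁) (g₀ u) (p (g₀ u)) :=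
    fun u hu => hp _ (mem_image_of_mem g₀ hu)
  refine ⟨g₀, p, rfl, (hg.trace_eq h.isBoundaryPair).imp ?_ ?_⟩ <;>
    rw [h.trace_edge, h.neg.trace_edge] <;> rintro ⟨h₀, h₁⟩ <;> rw [h₁] at hnear
  · exact ⟨hg.simple₀, h₀, hnear⟩
  · exact ⟨hg.simple₀, h₀, by rwa [neg_neg]⟩

theorem isPiecewiseContinuous_of_isMedialFit (h : IsTubeSample γ N τ σ ε Y)
    (hF : IsMedialFit (⋃ c ∈ Y, Metric.closedBall c ε) F) : IsPiecewiseContinuous F := by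
  obtain ⟨g, p, rfl, hs | hs⟩ := h.exists_isMedialSelection hF
  exacts [hs.isPiecewiseContinuous h, hs.isPiecewiseContinuous h.neg]

theorem isSimpleClosedCurve_of_isCompletion (h : IsTubeSample γ N τ σ ε Y)
    (hF : IsMedialFit (⋃ c ∈ Y, Metric.closedBall c ε) F) {G : ℝ → Plane}
    (hG : IsCompletion F G) : IsSimpleClosedCurve G := by
  obtain ⟨g, p, rfl, hs | hs⟩ := h.exists_isMedialSelection hF
  · obtain ⟨K, a, l, r, s, t, hG⟩ := hs.exists_isMedialCompletion h hG
    exact hG.isSimpleClosedCurve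
  · obtain ⟨K, a, l, r, s, t, hG⟩ := hs.exists_isMedialCompletion h.neg hG
    exact hG.isSimpleClosedCurve

end IsTubeSample

/-! ### Hausdorff distance of the completed fit -/

section ChordBound
variable {E : Type*} [NormedAddCommGroup E] [InnerProductSpace ℝ E]

lemma norm_sq_smul_add_smul {a b : ℝ} (hab : a + b = 1) (x y : E) :
    ‖a • x + b • y‖ ^ 2 = a * ‖x‖ ^ 2 + b * ‖y‖ ^ 2 - a * b * ‖x - y‖ ^ 2 := by
  obtain rfl : b = 1 - a := by linarith
  rw [norm_add_sq_real, norm_sub_sq_real, norm_smul, norm_smul, mul_pow, mul_pow,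
    Real.norm_eq_abs, Real.norm_eq_abs, sq_abs, sq_abs, real_inner_smul_left,
    real_inner_smul_right]
  ring

lemma sq_sub_le_of_mem_segment {q z z₁ z₂ : E} {r : ℝ} (hr : 0 ≤ r) (h₁ : r ≤ ‖z₁ - q‖)
    (h₂ : r ≤ ‖z₂ - q‖) (hz : z ∈ segment ℝ z₁ z₂) :
    r ^ 2 - ‖z₁ - z₂‖ ^ 2 / 4 ≤ ‖z - q‖ ^ 2 := by
  obtain ⟨a, b, ha, hb, hab, rfl⟩ := hz
  have hcomb : a • z₁ + b • z₂ - q = a • (z₁ - q) + b • (z₂ - q) := by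
    rw [smul_sub, smul_sub, sub_add_sub_comm, ← add_smul, hab, one_smul]
  have hends : r ^ 2 ≤ a * ‖z₁ - q‖ ^ 2 + b * ‖z₂ - q‖ ^ 2 := calc
    r ^ 2 = a * r ^ 2 + b * r ^ 2 := by rw [← add_mul, hab, one_mul]
    _ ≤ a * ‖z₁ - q‖ ^ 2 + b * ‖z₂ - q‖ ^ 2 := by gcongr
  have hprod : a * b * ‖z₁ - z₂‖ ^ 2 ≤ 1 / 4 * ‖z₁ - z₂‖ ^ 2 := by
    gcongr
    nlinarith [sq_nonneg (a - b)]
  rw [hcomb, norm_sq_smul_add_smul hab, sub_sub_sub_cancel_right]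
  linarith

lemma exists_mem_segment_dist_le {E : Type*} [SeminormedAddCommGroup E] [NormedSpace ℝ E]
    {x x₁ x₂ z₁ z₂ : E} {r : ℝ} (hx : x ∈ segment ℝ x₁ x₂) (h₁ : dist x₁ z₁ ≤ r)
    (h₂ : dist x₂ z₂ ≤ r) : ∃ z ∈ segment ℝ z₁ z₂, dist x z ≤ r := by
  obtain ⟨a, b, ha, hb, hab, rfl⟩ := hx
  refine ⟨a • z₁ + b • z₂, ⟨a, b, ha, hb, hab, rfl⟩, (dist_add_add_le _ _ _ _).trans ?_⟩
  rw [dist_smul₀, dist_smul₀, Real.norm_of_nonneg ha, Real.norm_of_nonneg hb]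
  calc a * dist x₁ z₁ + b * dist x₂ z₂ ≤ a * r + b * r := by gcongr
    _ = r := by rw [← add_mul, hab, one_mul]

end ChordBound

namespace IsNormalFrame
variable {γ N T : ℝ → Plane} {τ : ℝ}

lemma le_norm_sub_add_smul (h : IsNormalFrame γ N τ) (s s' : ℝ) :
    τ ≤ ‖γ s' - (γ s + τ • N s)‖ := by
  have hle := h.le_norm_sq s τ s'
  rw [abs_of_pos h.radius_pos, div_self h.radius_pos.ne', sub_self, zero_mul, add_zero,
    norm_sub_rev] at hle
  exact le_of_pow_le_pow_left₀ two_ne_zero (norm_nonneg _) hle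

lemma infDist_mul_le_of_eq_add_smul (h : IsNormalFrame γ N τ) {z₁ z₂ z : Plane} {s t : ℝ}
    (h₁ : z₁ ∈ range γ) (h₂ : z₂ ∈ range γ) (hz : z ∈ segment ℝ z₁ z₂) (ht : 0 ≤ t)
    (htτ : t ≤ τ) (hzs : z = γ s + t • N s) : t * τ ≤ ‖z₁ - z₂‖ ^ 2 / 4 := by
  have hfar : ∀ x ∈ range γ, τ ≤ ‖x - (γ s + τ • N s)‖ := by
    rintro _ ⟨s', rfl⟩
    exact h.le_norm_sub_add_smul s s'
  have hle := sq_sub_le_of_mem_segment h.radius_pos.le (hfar _ h₁) (hfar _ h₂) hz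
  rw [hzs, add_sub_add_left_eq_sub, ← sub_smul, norm_smul_of_norm_eq_one (h.norm_eq s),
    sq_abs] at hle
  nlinarith

lemma infDist_mul_le_of_mem_segment (h : IsNormalFrame γ N τ) {z₁ z₂ z : Plane} (h₁ : z₁ ∈ range γ)
    (h₂ : z₂ ∈ range γ) (hz : z ∈ segment ℝ z₁ z₂) (hd : Metric.infDist z (range γ) ≤ τ) :
    Metric.infDist z (range γ) * τ ≤ ‖z₁ - z₂‖ ^ 2 / 4 := by
  obtain ⟨s, hs | hs⟩ := h.exists_eq_add_infDist_smul_or z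
  · exact h.infDist_mul_le_of_eq_add_smul h₁ h₂ hz Metric.infDist_nonneg hd hs
  · exact h.neg.infDist_mul_le_of_eq_add_smul h₁ h₂ hz Metric.infDist_nonneg hd hs

/-- Relative to `γ s`, the point of the curve closest to `m` has a small tangential component, hence
a quadratically small normal one. -/
lemma norm_sub_le_of_inner_eq_zero (h : IsNormalFrame γ N τ) {s r δ : ℝ} {m : Plane}
    (hT : ‖T s‖ = 1) (hTN : ∀ v, inner ℝ (T s) v ^ 2 + inner ℝ (N s) v ^ 2 = ‖v‖ ^ 2)
    (hm : inner ℝ (T s) (m - γ s) = 0) (hr : ‖m - γ s‖ ≤ r)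
    (hδ : Metric.infDist m (range γ) ≤ δ) :
    ‖m - γ s‖ ≤ 2 * δ + (r + δ) ^ 2 / (2 * τ) := by
  obtain ⟨_, ⟨s', rfl⟩, hfoot⟩ := h.isCompact_range.exists_infDist_eq_dist (range_nonempty γ) m
  rw [hfoot, dist_eq_norm] at hδ
  have hsplit : γ s' - γ s = (m - γ s) - (m - γ s') := by abel
  have hnorm : ‖γ s' - γ s‖ ≤ r + δ := hsplit ▸ (norm_sub_le _ _).trans (add_le_add hr hδ)
  have htan : |inner ℝ (T s) (γ s' - γ s)| ≤ δ := by
    rw [hsplit, inner_sub_right, hm, zero_sub, abs_neg]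
    refine (abs_real_inner_le_norm _ _).trans ?_
    rwa [hT, one_mul]
  have hnormal : |inner ℝ (N s) (γ s' - γ s)| ≤ (r + δ) ^ 2 / (2 * τ) :=
    (le_div_iff₀' (by linarith [h.radius_pos])).2
      ((h.disc s s').trans (pow_le_pow_left₀ (norm_nonneg _) hnorm 2))
  have hpyth : ‖γ s' - γ s‖ ≤ |inner ℝ (T s) (γ s' - γ s)| + |inner ℝ (N s) (γ s' - γ s)| := by
    refine le_of_pow_le_pow_left₀ two_ne_zero (by positivity) ?_
    rw [← hTN, add_sq, sq_abs, sq_abs]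
    have := mul_nonneg (abs_nonneg (inner ℝ (T s) (γ s' - γ s)))
      (abs_nonneg (inner ℝ (N s) (γ s' - γ s)))
    linarith
  linarith [norm_sub_le_norm_sub_add_norm_sub m (γ s') (γ s)]

end IsNormalFrame

/-- The constant `D` for which the medial fit deviates from the foot points of the boundary curve
by at most `ε + √(D ε)`. -/
noncomputable def deviationConst (τ σ : ℝ) : ℝ := 16 * σ * τ / (τ - σ)

/-- The constant `κ` for which the completed medial fit lies in the `κ ε`-tube around the curve. -/
noncomputable def tubeConst (τ σ : ℝ) : ℝ := 1 + deviationConst τ σ / τ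

/-- The constant `c` for which the Hausdorff distance of the completed medial fit from the curve is
at most `c ε`. -/
noncomputable def hausdorffConst (τ σ : ℝ) : ℝ :=
  2 * tubeConst τ σ + (36 * (deviationConst τ σ + σ) + 2 * tubeConst τ σ ^ 2 * σ) / (2 * τ)

lemma deviationConst_pos {τ σ : ℝ} (hσ : 0 < σ) (hστ : σ < τ) : 0 < deviationConst τ σ :=
  div_pos (mul_pos (by linarith) (hσ.trans hστ)) (sub_pos.2 hστ)

lemma tubeConst_pos {τ σ : ℝ} (hσ : 0 < σ) (hστ : σ < τ) : 0 < tubeConst τ σ :=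
  add_pos one_pos (div_pos (deviationConst_pos hσ hστ) (hσ.trans hστ))

lemma tubeConst_le_hausdorffConst {τ σ : ℝ} (hσ : 0 < σ) (hστ : σ < τ) :
    tubeConst τ σ ≤ hausdorffConst τ σ := by
  have hτ := hσ.trans hστ
  have hD := deviationConst_pos hσ hστ
  have hκ := tubeConst_pos hσ hστ
  have : 0 ≤ (36 * (deviationConst τ σ + σ) + 2 * tubeConst τ σ ^ 2 * σ) / (2 * τ) := by positivity
  rw [hausdorffConst]
  linarith

lemma hausdorffConst_pos {τ σ : ℝ} (hσ : 0 < σ) (hστ : σ < τ) : 0 < hausdorffConst τ σ :=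
  (tubeConst_pos hσ hστ).trans_le (tubeConst_le_hausdorffConst hσ hστ)

namespace IsTubeSample
variable {γ N : ℝ → Plane} {τ σ ε s : ℝ} {Y : Finset Plane} {m v : Plane}

lemma tube_lt (h : IsTubeSample γ N τ σ ε Y) : σ < τ := by linarith [h.small, h.pos]

lemma dist_le_of_dist_edge_le (h : IsTubeSample γ N τ σ ε Y) {z : Plane} (hz : z ∈ range γ)
    (hd : dist (edge γ N ε Y s) z ≤ σ + 2 * ε) : dist z (γ s) ≤ √(deviationConst τ σ * ε) := by
  obtain ⟨s', rfl⟩ := hz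
  have hτ := h.frame.radius_pos
  have hε := h.pos
  have hσ := h.tube_pos
  have hgap := sub_pos.2 h.tube_lt
  have hmem := h.height_mem s
  have hsq := pow_le_pow_left₀ dist_nonneg hd 2
  have hfoot := h.frame.le_norm_sq s (height γ N ε Y s) s'
  rw [h.abs_height, ← edge, ← dist_eq_norm (edge γ N ε Y s)] at hfoot
  have hcoef : (τ - σ) / (2 * τ) ≤ 1 - height γ N ε Y s / τ := by
    rw [one_sub_div hτ.ne', div_le_div_iff₀ (by positivity) hτ]
    nlinarith [hmem.2, h.small]
  have hheight : σ ^ 2 ≤ height γ N ε Y s ^ 2 :=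
    pow_le_pow_left₀ hσ.le (by linarith [hmem.1]) 2
  have hle : (τ - σ) / (2 * τ) * ‖γ s' - γ s‖ ^ 2 ≤ 8 * σ * ε := by
    have hscale := mul_le_mul_of_nonneg_right hcoef (sq_nonneg ‖γ s' - γ s‖)
    nlinarith [h.le, hscale]
  rw [div_mul_eq_mul_div, div_le_iff₀ (by positivity)] at hle
  rw [dist_eq_norm]
  refine Real.le_sqrt_of_sq_le ?_
  rw [deviationConst, div_mul_eq_mul_div, le_div_iff₀ hgap]
  linarith

lemma exists_dist_midpoint_le (h : IsTubeSample γ N τ σ ε Y)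
    (hv : IsNearest (range (edge γ (-N) ε Y)) (edge γ N ε Y s) v) :
    ∃ z ∈ range γ, dist (midpoint ℝ (edge γ N ε Y s) v) z ≤ ε ∧
      dist z (γ s) ≤ √(deviationConst τ σ * ε) := by
  obtain ⟨z, hz, -, hdist, -, hmid⟩ :=
    h.exists_mem_range_mem_segment hv.1 (h.dist_edge_le_of_isNearest hv)
  exact ⟨z, hz, hmid, h.dist_le_of_dist_edge_le hz hdist⟩

lemma exists_mem_segment_of_isOver (h : IsTubeSample γ N τ σ ε Y)
    (hm : IsOver (range (edge γ (-N) ε Y)) (edge γ N ε Y s) m) :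
    ∃ z₁ ∈ range γ, ∃ z₂ ∈ range γ, ∃ z ∈ segment ℝ z₁ z₂, dist m z ≤ ε ∧
      dist z₁ (γ s) ≤ √(deviationConst τ σ * ε) ∧ dist z₂ (γ s) ≤ √(deviationConst τ σ * ε) := by
  obtain ⟨v₁, v₂, hv₁, hv₂, hm⟩ := hm
  obtain ⟨z₁, hz₁, hmid₁, hd₁⟩ := h.exists_dist_midpoint_le hv₁
  obtain ⟨z₂, hz₂, hmid₂, hd₂⟩ := h.exists_dist_midpoint_le hv₂
  obtain ⟨z, hz, hmz⟩ := exists_mem_segment_dist_le hm hmid₁ hmid₂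
  exact ⟨z₁, hz₁, z₂, hz₂, z, hz, hmz, hd₁, hd₂⟩

lemma dist_le_of_isOver (h : IsTubeSample γ N τ σ ε Y)
    (hm : IsOver (range (edge γ (-N) ε Y)) (edge γ N ε Y s) m) :
    dist m (γ s) ≤ ε + √(deviationConst τ σ * ε) := by
  obtain ⟨z₁, -, z₂, -, z, hz, hmz, hd₁, hd₂⟩ := h.exists_mem_segment_of_isOver hm
  exact (dist_triangle m z (γ s)).trans
    (add_le_add hmz ((convex_closedBall (γ s) _).segment_subset hd₁ hd₂ hz))

lemma infDist_le_of_isOver (h : IsTubeSample γ N τ σ ε Y)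
    (hsmall : deviationConst τ σ * ε ≤ τ ^ 2)
    (hm : IsOver (range (edge γ (-N) ε Y)) (edge γ N ε Y s) m) :
    Metric.infDist m (range γ) ≤ tubeConst τ σ * ε := by
  obtain ⟨z₁, hz₁, z₂, hz₂, z, hz, hmz, hd₁, hd₂⟩ := h.exists_mem_segment_of_isOver hm
  have hτ := h.frame.radius_pos
  have hD := deviationConst_pos h.tube_pos h.tube_lt
  have hzγ : Metric.infDist z (range γ) ≤ τ := by
    refine (Metric.infDist_le_dist_of_mem (mem_range_self s)).trans ?_
    refine ((convex_closedBall (γ s) _).segment_subset hd₁ hd₂ hz).trans ?_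
    exact (Real.sqrt_le_left hτ.le).2 hsmall
  have hchord : ‖z₁ - z₂‖ ^ 2 ≤ 4 * (deviationConst τ σ * ε) := by
    have hle : ‖z₁ - z₂‖ ≤ 2 * √(deviationConst τ σ * ε) := by
      rw [← dist_eq_norm]
      linarith [dist_triangle_right z₁ z₂ (γ s)]
    refine (pow_le_pow_left₀ (norm_nonneg _) hle 2).trans_eq ?_
    rw [mul_pow, Real.sq_sqrt (mul_pos hD h.pos).le]
    norm_num
  have hzD : Metric.infDist z (range γ) ≤ deviationConst τ σ / τ * ε := by
    rw [div_mul_eq_mul_div, le_div_iff₀ hτ]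
    linarith [h.frame.infDist_mul_le_of_mem_segment hz₁ hz₂ hz hzγ]
  rw [tubeConst, add_mul, one_mul]
  linarith [Metric.infDist_le_infDist_add_dist (s := range γ) (x := m) (y := z)]

end IsTubeSample

lemma uniformContinuous_of_periodic {α : Type*} [UniformSpace α] {f : ℝ → α} {c : ℝ} (hc : 0 < c)
    (hf : Continuous f) (hper : Function.Periodic f c) : UniformContinuous f := by
  have : Fact (0 < c) := ⟨hc⟩
  have hlift : Continuous (hper.lift : AddCircle c → α) := hf.quotient_lift _
  have hmk : UniformContinuous (QuotientAddGroup.mk' (AddSubgroup.zmultiples c)) :=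
    uniformContinuous_of_continuousAt_zero _ (AddCircle.continuous_mk' c).continuousAt
  exact (CompactSpace.uniformContinuous_of_continuous hlift).comp hmk

namespace IsClosedFrame
variable {γ T : ℝ → Plane} {ℓ τ : ℝ}

lemma exists_half_le_inner_tangent (h : IsClosedFrame γ T ℓ τ) :
    ∃ w > 0, ∀ s s', |s - s'| ≤ w → 1 / 2 ≤ inner ℝ (T s) (T s') := by
  obtain ⟨w, hw, hT⟩ := Metric.uniformContinuous_iff.1
    (uniformContinuous_of_periodic one_pos h.continuous_tangent h.periodic_tangent) 1 one_pos
  refine ⟨w / 2, half_pos hw, fun s s' hs => ?_⟩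
  have hlt : ‖T s - T s'‖ < 1 := dist_eq_norm (T s) (T s') ▸ hT (hs.trans_lt (half_lt_self hw))
  have hsq := pow_lt_one₀ (norm_nonneg _) hlt two_ne_zero
  rw [norm_sub_sq_real, h.norm_eq, h.norm_eq] at hsq
  linarith

lemma le_inner_sub (h : IsClosedFrame γ T ℓ τ) {w : ℝ}
    (hw : ∀ s s', |s - s'| ≤ w → 1 / 2 ≤ inner ℝ (T s) (T s')) {s a b : ℝ} (hab : a ≤ b)
    (ha : s - w ≤ a) (hb : b ≤ s + w) : ℓ / 2 * (b - a) ≤ inner ℝ (T s) (γ b - γ a) := by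
  have hderiv : ∀ x, HasDerivAt (fun x => inner ℝ (T s) (γ x)) (ℓ * inner ℝ (T s) (T x)) x :=
    fun x => by simpa [real_inner_smul_right] using (hasDerivAt_const x (T s)).inner ℝ (h.deriv x)
  rw [inner_sub_right]
  refine (convex_Icc a b).mul_sub_le_image_sub_of_le_deriv
    (fun x _ => (hderiv x).continuousAt.continuousWithinAt)
    (fun x _ => (hderiv x).differentiableAt.differentiableWithinAt) (fun x hx => ?_)
    a (left_mem_Icc.2 hab) b (right_mem_Icc.2 hab) hab
  rw [interior_Icc] at hx
  have hle := hw s x (abs_le.2 ⟨by linarith [hx.2], by linarith [hx.1]⟩)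
  rw [(hderiv x).deriv]
  nlinarith [h.speed_pos]

lemma norm_sub_le (h : IsClosedFrame γ T ℓ τ) (s s' : ℝ) : ‖γ s' - γ s‖ ≤ ℓ * |s' - s| :=
  convex_univ.norm_image_sub_le_of_norm_hasDerivWithin_le
    (fun x _ => (h.deriv x).hasDerivWithinAt)
    (fun x _ => by rw [norm_smul, h.norm_eq x, Real.norm_of_nonneg h.speed_pos.le, mul_one])
    (mem_univ s) (mem_univ s')

end IsClosedFrame

namespace IsClosedFrame
variable {γ T : ℝ → Plane} {ℓ τ w R d s₀ : ℝ} {m : Plane}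

lemma inner_sub_nonneg_of_dist_le (h : IsClosedFrame γ T ℓ τ)
    (hw : ∀ s s', |s - s'| ≤ w → 1 / 2 ≤ inner ℝ (T s) (T s')) (hd : 0 ≤ d) (hdw : d ≤ w)
    (hR : R ≤ ℓ / 2 * d) (hm : dist m (γ (s₀ + d)) ≤ R) : 0 ≤ inner ℝ (T s₀) (m - γ s₀) := by
  have hγ := h.le_inner_sub hw (s := s₀) (a := s₀) (b := s₀ + d) (by linarith) (by linarith)
    (by linarith)
  have hdev := neg_le_of_abs_le (abs_real_inner_le_norm (T s₀) (m - γ (s₀ + d)))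
  rw [h.norm_eq, one_mul, ← dist_eq_norm] at hdev
  rw [← sub_add_sub_cancel m (γ (s₀ + d)), inner_add_right]
  linarith

lemma inner_sub_nonpos_of_dist_le (h : IsClosedFrame γ T ℓ τ)
    (hw : ∀ s s', |s - s'| ≤ w → 1 / 2 ≤ inner ℝ (T s) (T s')) (hd : 0 ≤ d) (hdw : d ≤ w)
    (hR : R ≤ ℓ / 2 * d) (hm : dist m (γ (s₀ - d)) ≤ R) : inner ℝ (T s₀) (m - γ s₀) ≤ 0 := by
  have hγ := h.le_inner_sub hw (s := s₀) (a := s₀ - d) (b := s₀) (by linarith) (by linarith)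
    (by linarith)
  have hdev := le_of_abs_le (abs_real_inner_le_norm (T s₀) (m - γ (s₀ - d)))
  rw [h.norm_eq, one_mul, ← dist_eq_norm] at hdev
  rw [← neg_sub (γ (s₀ - d)), inner_neg_right] at hγ
  rw [← sub_add_sub_cancel m (γ (s₀ - d)), inner_add_right]
  linarith

end IsClosedFrame

lemma sq_add_sqrt_mul_le {D σ ε : ℝ} (hD : 0 ≤ D) (hε : 0 ≤ ε) (hεσ : ε ≤ σ) :
    (ε + √(D * ε)) ^ 2 ≤ 2 * (D + σ) * ε := by
  refine (add_sq_le (a := ε) (b := √(D * ε))).trans ?_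
  rw [Real.sq_sqrt (mul_nonneg hD hε)]
  nlinarith

namespace IsMedialSelection
variable {γ N T g G : ℝ → Plane} {p : Plane → Plane} {τ σ ε ℓ w : ℝ} {Y : Finset Plane}

lemma exists_mem_trace_inner_eq_zero (hs : IsMedialSelection γ N ε Y g p)
    (h : IsTubeSample γ N τ σ ε Y) (hC : IsClosedFrame γ T ℓ τ)
    (hw : ∀ s s', |s - s'| ≤ w → 1 / 2 ≤ inner ℝ (T s) (T s'))
    (hsmall : 2 * (deviationConst τ σ + σ) * ε ≤ (ℓ / 2 * w) ^ 2) (hw₀ : 0 ≤ w)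
    (hG : IsCompletion (fun u => midpoint ℝ (g u) (p (g u))) G) (s₀ : ℝ) :
    ∃ m ∈ trace G, ∃ s, IsOver (range (edge γ (-N) ε Y)) (edge γ N ε Y s) m ∧
      ‖m - γ s₀‖ ≤ 3 * (ε + √(deviationConst τ σ * ε)) ∧ inner ℝ (T s₀) (m - γ s₀) = 0 := by
  obtain ⟨K, a, l, r, sj, tj, hG⟩ := hs.exists_isMedialCompletion h hG
  set R := ε + √(deviationConst τ σ * ε) with hR
  have hℓ := hC.speed_pos
  have hε := h.pos
  have : 0 ≤ R := by positivity
  have hRw : R ≤ ℓ / 2 * w := le_of_pow_le_pow_left₀ two_ne_zero (by positivity)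
    ((sq_add_sqrt_mul_le (deviationConst_pos h.tube_pos h.tube_lt).le hε.le h.le).trans hsmall)
  obtain ⟨d, hd, hdw, hRd⟩ : ∃ d, 0 ≤ d ∧ d ≤ w ∧ R = ℓ / 2 * d :=
    ⟨R / (ℓ / 2), by positivity, (div_le_iff₀' (by positivity)).2 hRw, by field_simp⟩
  have hedge : ∀ s, edge γ N ε Y s ∈ trace g := fun s => hs.trace_eq ▸ mem_range_self s
  obtain ⟨m₁, hm₁, hover₁⟩ := hG.exists_mem_trace (hedge (s₀ + d))
  obtain ⟨m₂, hm₂, hover₂⟩ := hG.exists_mem_trace (hedge (s₀ - d))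
  obtain ⟨_, ⟨s, hsd, rfl⟩, m, hm, hover, hm₀⟩ := hG.exists_isOver_eq_zero
    (isPreconnected_Icc.image _ h.continuous_edge.continuousOn)
    (image_subset_iff.2 fun s _ => hedge s)
    (show Continuous fun m => inner ℝ (T s₀) (m - γ s₀) by fun_prop)
    (mem_image_of_mem _ (right_mem_Icc.2 (by linarith))) hm₁ hover₁
    (hC.inner_sub_nonneg_of_dist_le hw hd hdw hRd.le (h.dist_le_of_isOver hover₁))
    (mem_image_of_mem _ (left_mem_Icc.2 (by linarith))) hm₂ hover₂
    (hC.inner_sub_nonpos_of_dist_le hw hd hdw hRd.le (h.dist_le_of_isOver hover₂))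
  refine ⟨m, hm, s, hover, ?_, hm₀⟩
  have hs₀ : |s - s₀| ≤ d := abs_le.2 ⟨by linarith [hsd.1], by linarith [hsd.2]⟩
  have hγ : ‖γ s - γ s₀‖ ≤ ℓ * d :=
    (hC.norm_sub_le s₀ s).trans (mul_le_mul_of_nonneg_left hs₀ hℓ.le)
  have hdist := h.dist_le_of_isOver hover
  rw [dist_eq_norm, ← hR] at hdist
  linarith [norm_sub_le_norm_sub_add_norm_sub m (γ s) (γ s₀)]

lemma exists_mem_range_dist_le (hs : IsMedialSelection γ N ε Y g p)
    (h : IsTubeSample γ N τ σ ε Y) (hsmall : deviationConst τ σ * ε ≤ τ ^ 2)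
    (hG : IsCompletion (fun u => midpoint ℝ (g u) (p (g u))) G) {m : Plane} (hm : m ∈ trace G) :
    ∃ z ∈ range γ, dist m z ≤ hausdorffConst τ σ * ε := by
  obtain ⟨K, a, l, r, sj, tj, hG⟩ := hs.exists_isMedialCompletion h hG
  obtain ⟨y, hy, hover⟩ := hG.exists_isOver hm
  obtain ⟨s, rfl⟩ : y ∈ range (edge γ N ε Y) := hs.trace_eq ▸ hy
  obtain ⟨z, hz, hmz⟩ := h.frame.isCompact_range.exists_infDist_eq_dist (range_nonempty γ) m
  refine ⟨z, hz, hmz ▸ (h.infDist_le_of_isOver hsmall hover).trans ?_⟩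
  exact mul_le_mul_of_nonneg_right (tubeConst_le_hausdorffConst h.tube_pos h.tube_lt) h.pos.le

lemma exists_mem_trace_dist_le (hs : IsMedialSelection γ N ε Y g p)
    (h : IsTubeSample γ N τ σ ε Y) (hC : IsClosedFrame γ T ℓ τ)
    (hTN : ∀ s v, inner ℝ (T s) v ^ 2 + inner ℝ (N s) v ^ 2 = ‖v‖ ^ 2)
    (hw : ∀ s s', |s - s'| ≤ w → 1 / 2 ≤ inner ℝ (T s) (T s')) (hw₀ : 0 ≤ w)
    (hsmall : deviationConst τ σ * ε ≤ τ ^ 2)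
    (hsmall' : 2 * (deviationConst τ σ + σ) * ε ≤ (ℓ / 2 * w) ^ 2)
    (hG : IsCompletion (fun u => midpoint ℝ (g u) (p (g u))) G) (s₀ : ℝ) :
    ∃ m ∈ trace G, dist (γ s₀) m ≤ hausdorffConst τ σ * ε := by
  obtain ⟨m, hm, s, hover, hle, hm₀⟩ :=
    hs.exists_mem_trace_inner_eq_zero h hC hw hsmall' hw₀ hG s₀
  refine ⟨m, hm, ?_⟩
  have hτ := h.frame.radius_pos
  have hR := sq_add_sqrt_mul_le (deviationConst_pos h.tube_pos h.tube_lt).le h.pos.le h.le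
  have hdev := h.frame.norm_sub_le_of_inner_eq_zero (hC.norm_eq s₀) (hTN s₀) hm₀ hle
    (h.infDist_le_of_isOver hsmall hover)
  rw [dist_comm, dist_eq_norm]
  refine hdev.trans ?_
  rw [hausdorffConst, add_mul, div_mul_eq_mul_div, ← mul_assoc]
  gcongr
  refine (add_sq_le (a := 3 * _)).trans ?_
  nlinarith [mul_le_mul_of_nonneg_left h.le (mul_nonneg (sq_nonneg (tubeConst τ σ)) h.pos.le)]

lemma hausdorffEDist_le (hs : IsMedialSelection γ N ε Y g p) (h : IsTubeSample γ N τ σ ε Y)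
    (hC : IsClosedFrame γ T ℓ τ)
    (hTN : ∀ s v, inner ℝ (T s) v ^ 2 + inner ℝ (N s) v ^ 2 = ‖v‖ ^ 2)
    (hw : ∀ s s', |s - s'| ≤ w → 1 / 2 ≤ inner ℝ (T s) (T s')) (hw₀ : 0 ≤ w)
    (hsmall : deviationConst τ σ * ε ≤ τ ^ 2)
    (hsmall' : 2 * (deviationConst τ σ + σ) * ε ≤ (ℓ / 2 * w) ^ 2)
    (hG : IsCompletion (fun u => midpoint ℝ (g u) (p (g u))) G) :
    Metric.hausdorffEDist (trace G) (range γ) ≤ ENNReal.ofReal (hausdorffConst τ σ * ε) := by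
  refine Metric.hausdorffEDist_le_of_mem_edist (fun m hm => ?_) ?_
  · obtain ⟨z, hz, hle⟩ := hs.exists_mem_range_dist_le h hsmall hG hm
    exact ⟨z, hz, edist_dist m z ▸ ENNReal.ofReal_le_ofReal hle⟩
  · rintro _ ⟨s, rfl⟩
    obtain ⟨m, hm, hle⟩ := hs.exists_mem_trace_dist_le h hC hTN hw hw₀ hsmall hsmall' hG s
    exact ⟨m, hm, edist_dist (γ s) m ▸ ENNReal.ofReal_le_ofReal hle⟩

end IsMedialSelection

lemma IsTubeSample.iSup_hausdorffEDist_le {γ T : ℝ → Plane} {τ σ ε ℓ w : ℝ} {Y : Finset Plane}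
    (h : IsTubeSample γ (fun s => perp (T s)) τ σ ε Y) (hC : IsClosedFrame γ T ℓ τ)
    (hw : ∀ s s', |s - s'| ≤ w → 1 / 2 ≤ inner ℝ (T s) (T s')) (hw₀ : 0 ≤ w)
    (hsmall : deviationConst τ σ * ε ≤ τ ^ 2)
    (hsmall' : 2 * (deviationConst τ σ + σ) * ε ≤ (ℓ / 2 * w) ^ 2) :
    ⨆ G ∈ completedMedialEstimators (⋃ c ∈ Y, Metric.closedBall c ε),
      Metric.hausdorffEDist (trace G) (range γ) ≤ ENNReal.ofReal (hausdorffConst τ σ * ε) := by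
  have hTN : ∀ s v, inner ℝ (T s) v ^ 2 + inner ℝ (perp (T s)) v ^ 2 = ‖v‖ ^ 2 := fun s v =>
    inner_sq_add_inner_perp_sq_of_norm_eq_one (hC.norm_eq s) v
  refine iSup₂_le fun G ⟨F, hF, hG⟩ => ?_
  obtain ⟨g, p, rfl, hs | hs⟩ := h.exists_isMedialSelection hF
  · exact hs.hausdorffEDist_le h hC hTN hw hw₀ hsmall hsmall' hG
  · refine hs.hausdorffEDist_le h.neg hC (fun s v => ?_) hw hw₀ hsmall hsmall' hG
    rw [Pi.neg_apply, inner_neg_left, neg_sq, hTN]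

/-! ### Small-ball probabilities -/

lemma IsNoiseDensity.exists_mul_rpow_le {σ β : ℝ} {φ : Plane → ℝ} (hσ : 0 < σ)
    (hφ : IsNoiseDensity σ β φ) : ∃ c > 0, ∃ η > 0, ∀ d, 0 < d → d < η → ∀ x : Plane,
      ‖x‖ ≤ σ - d → c * d ^ β ≤ φ x := by
  obtain ⟨C, hC, hequiv⟩ := hφ.edge
  have hnear := hequiv.isLittleO.def (half_pos one_pos)
  rw [Filter.eventually_comap] at hnear
  obtain ⟨b, hb : b < σ, hbσ⟩ := (mem_nhdsLT_iff_exists_Ioo_subset' hσ).1 hnear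
  refine ⟨C / 2, half_pos hC, min (σ - b) σ, lt_min (sub_pos.2 hb) hσ, fun d hd hdη x hx => ?_⟩
  obtain ⟨hdb, hdσ⟩ := lt_min_iff.1 hdη
  obtain ⟨z, hz⟩ := exists_norm_eq Plane (sub_pos.2 hdσ).le
  have hequiv_z := hbσ (show σ - d ∈ Ioo b σ from ⟨by linarith, by linarith⟩) z hz
  have hpos : 0 < C * d ^ β := by positivity
  simp only [Pi.sub_apply, hz, sub_sub_cancel, Real.norm_eq_abs, abs_of_pos hpos] at hequiv_z
  linarith [(abs_le.1 hequiv_z).1, hφ.nonincreasing x z (hx.trans hz.ge)]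

lemma exists_closedBall_subset_inter {E : Type*} [SeminormedAddCommGroup E] [NormedSpace ℝ E]
    {z : E} {σ δ : ℝ} (hδ : 0 ≤ δ) (hδσ : δ ≤ σ) (hz : ‖z‖ ≤ σ + δ / 4) :
    ∃ y, Metric.closedBall y (δ / 8) ⊆
      Metric.closedBall z δ ∩ Metric.closedBall 0 (σ - δ / 8) := by
  obtain ⟨y, hzy, hy⟩ := exists_dist_le_le (x := z) (z := 0) (δ := δ / 2) (ε := σ - δ / 4)
    (by linarith) (by linarith) (by rw [dist_zero_right]; linarith)
  rw [dist_comm] at hzy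
  exact ⟨y, subset_inter (Metric.closedBall_subset_closedBall' (by linarith))
    (Metric.closedBall_subset_closedBall' (by linarith))⟩

lemma IsNoiseDensity.exists_le_noiseLaw_closedBall {σ β : ℝ} {φ : Plane → ℝ} (hσ : 0 < σ)
    (hφ : IsNoiseDensity σ β φ) : ∃ c > 0, ∃ η > 0, ∀ δ, 0 < δ → δ < η → ∀ z : Plane,
      ‖z‖ ≤ σ + δ / 4 → ENNReal.ofReal (c * δ ^ (2 + β)) ≤
        noiseLaw φ (Metric.closedBall z δ) := by
  obtain ⟨c, hc, η, hη, hlow⟩ := hφ.exists_mul_rpow_le hσ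
  refine ⟨c * (1 / 8) ^ β * (1 / 8) ^ 2 * Real.pi, by positivity, min η σ, lt_min hη hσ,
    fun δ hδ hδησ z hz => ?_⟩
  obtain ⟨hδη, hδσ⟩ := lt_min_iff.1 hδησ
  obtain ⟨y, hy⟩ := exists_closedBall_subset_inter hδ.le hδσ.le hz
  obtain ⟨hyz, hyσ⟩ := subset_inter_iff.1 hy
  have hφy : ∀ x ∈ Metric.closedBall y (δ / 8),
      ENNReal.ofReal (c * (δ / 8) ^ β) ≤ ENNReal.ofReal (φ x) := fun x hx =>
    ENNReal.ofReal_le_ofReal (hlow (δ / 8) (by positivity) (by linarith) x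
      (mem_closedBall_zero_iff.1 (hyσ hx)))
  calc ENNReal.ofReal (c * (1 / 8) ^ β * (1 / 8) ^ 2 * Real.pi * δ ^ (2 + β))
      = ENNReal.ofReal (c * (δ / 8) ^ β) * volume (Metric.closedBall y (δ / 8)) := by
        rw [EuclideanSpace.volume_closedBall_fin_two, ← ENNReal.ofReal_pow (by positivity),
          ← ENNReal.ofReal_mul (by positivity), ← ENNReal.ofReal_mul (by positivity),
          div_eq_mul_one_div δ, Real.mul_rpow hδ.le (by norm_num), Real.rpow_add hδ,
          Real.rpow_two]
        ring_nf
    _ = ∫⁻ _ in Metric.closedBall y (δ / 8), ENNReal.ofReal (c * (δ / 8) ^ β) :=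
        (setLIntegral_const _ _).symm
    _ ≤ ∫⁻ x in Metric.closedBall y (δ / 8), ENNReal.ofReal (φ x) :=
        setLIntegral_mono' measurableSet_closedBall hφy
    _ ≤ ∫⁻ x in Metric.closedBall z δ, ENNReal.ofReal (φ x) := lintegral_mono_set hyz
    _ = noiseLaw φ (Metric.closedBall z δ) := by
        rw [noiseLaw, withDensity_apply _ measurableSet_closedBall]

lemma le_designLaw_Icc {h : ℝ → ℝ} {c s w : ℝ} (hc : 0 ≤ c) (hh : ∀ u ∈ Icc (0 : ℝ) 1, c ≤ h u)
    (hs : s ∈ Icc (0 : ℝ) 1) (hw : 0 ≤ w) (hw' : w ≤ 1 / 2) :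
    ENNReal.ofReal (c * w) ≤ designLaw h (Icc (s - w) (s + w)) := by
  obtain ⟨a, ha, hsw⟩ : ∃ a, Icc a (a + w) ⊆ Icc 0 1 ∧ Icc a (a + w) ⊆ Icc (s - w) (s + w) := by
    rcases le_total s (1 / 2) with hle | hle
    · exact ⟨s, Icc_subset_Icc hs.1 (by linarith), Icc_subset_Icc (by linarith) le_rfl⟩
    · exact ⟨s - w, Icc_subset_Icc (by linarith) (by linarith [hs.2]),
        Icc_subset_Icc le_rfl (by linarith)⟩
  calc ENNReal.ofReal (c * w) = ∫⁻ _ in Icc a (a + w), ENNReal.ofReal c := by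
        rw [setLIntegral_const, Real.volume_Icc, add_sub_cancel_left, ENNReal.ofReal_mul hc]
    _ ≤ ∫⁻ u in Icc a (a + w), ENNReal.ofReal (h u) :=
        setLIntegral_mono' measurableSet_Icc fun u hu => ENNReal.ofReal_le_ofReal (hh u (ha hu))
    _ = designLaw h (Icc a (a + w)) := by
        rw [designLaw, withDensity_apply _ measurableSet_Icc, Measure.restrict_restrict
          measurableSet_Icc, inter_eq_left.2 ha]
    _ ≤ designLaw h (Icc (s - w) (s + w)) := measure_mono hsw

lemma IsNormalFrame.norm_add_smul_sub_sq_le {γ N : ℝ → Plane} {τ t : ℝ}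
    (h : IsNormalFrame γ N τ) (ht : |t| ≤ τ) (s u : ℝ) :
    ‖γ s + t • N s - γ u‖ ^ 2 ≤ t ^ 2 + 2 * ‖γ u - γ s‖ ^ 2 := by
  have hnormal : |2 * t * inner ℝ (N s) (γ u - γ s)| ≤ ‖γ u - γ s‖ ^ 2 := by
    rw [abs_mul, abs_mul, abs_two]
    exact (by gcongr : _ ≤ 2 * τ * |inner ℝ (N s) (γ u - γ s)|).trans (h.disc s u)
  rw [h.norm_sq_add_smul_sub]
  linarith [neg_le_of_abs_le hnormal]

/-- By curvature, the discs of radius `σ + δ / 4` about a stretch of curve of length of order `√δ`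
contain a given point of the tube of radius `σ`. -/
lemma IsClosedFrame.exists_le_designLaw {γ T : ℝ → Plane} {ℓ τ σ : ℝ} {h : ℝ → ℝ}
    (hC : IsClosedFrame γ T ℓ τ) (hσ : 0 < σ) (hστ : σ ≤ τ) (hh : IsDesignDensity h) :
    ∃ c > 0, ∃ η > 0, ∀ δ, 0 < δ → δ < η → ∀ x, Metric.infDist x (range γ) ≤ σ →
      ENNReal.ofReal (c * √δ) ≤ designLaw h {u | ‖x - γ u‖ ≤ σ + δ / 4} := by
  obtain ⟨c, _, hc, hb⟩ := hh.bounds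
  have hℓ := hC.speed_pos
  have hF := hC.isNormalFrame
  obtain ⟨κ, hκ, hκσ⟩ : ∃ κ > 0, (ℓ * κ) ^ 2 = σ / 4 :=
    ⟨√(σ / 4) / ℓ, by positivity, by rw [mul_div_cancel₀ _ hℓ.ne', Real.sq_sqrt (by positivity)]⟩
  refine ⟨c * κ, by positivity, (1 / (2 * κ)) ^ 2, by positivity, fun δ hδ hδκ x hx => ?_⟩
  have hwidth : κ * √δ ≤ 1 / 2 := by
    have hlt := (Real.sqrt_lt' (by positivity)).2 hδκ
    rw [lt_div_iff₀ (by positivity)] at hlt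
    linarith
  obtain ⟨s, t, hxs, ht⟩ := hF.foot x
  rw [← comp_fract_of_periodic hC.periodic s, ← comp_fract_of_periodic hF.periodic_normal s] at hxs
  rw [← ht] at hx
  rw [mul_assoc]
  refine (le_designLaw_Icc hc.le (fun u hu => (hb u hu).1) (fract_mem_Icc s) (by positivity)
    hwidth).trans (measure_mono fun u hu => ?_)
  have hstretch : ‖γ u - γ (Int.fract s)‖ ^ 2 ≤ σ / 4 * δ := calc
    ‖γ u - γ (Int.fract s)‖ ^ 2 ≤ (ℓ * (κ * √δ)) ^ 2 := by
      gcongr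
      refine (hC.norm_sub_le _ _).trans ?_
      gcongr
      exact abs_le.2 ⟨by linarith [hu.1], by linarith [hu.2]⟩
    _ = σ / 4 * δ := by rw [← mul_assoc, mul_pow, hκσ, Real.sq_sqrt hδ.le]
  rw [Set.mem_ofPred_eq, hxs]
  refine le_of_pow_le_pow_left₀ two_ne_zero (by positivity) ?_
  nlinarith [hF.norm_add_smul_sub_sq_le (hx.trans hστ) (Int.fract s) u, sq_le_sq' (by
    linarith [neg_le_of_abs_le hx]) (le_of_abs_le hx)]

/-! ### Covering by the observations -/

section Independence
variable {Ω α β : Type*} [MeasurableSpace Ω] [MeasurableSpace α] [MeasurableSpace β]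
  {P : Measure Ω} [IsProbabilityMeasure P]

lemma measure_prodMk_mem_eq_lintegral {X : Ω → α} {Y : Ω → β} (hX : Measurable X)
    (hY : Measurable Y) (h : IndepFun X Y P) {s : Set (α × β)} (hs : MeasurableSet s) :
    P {ω | (X ω, Y ω) ∈ s} = ∫⁻ x, P.map Y {y | (x, y) ∈ s} ∂P.map X := by
  have : IsProbabilityMeasure (P.map Y) := Measure.isProbabilityMeasure_map hY.aemeasurable
  have hprod := (indepFun_iff_map_prod_eq_prod_map_map hX.aemeasurable hY.aemeasurable).1 h
  have hmap := Measure.map_apply (μ := P) (hX.prodMk hY) hs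
  rwa [hprod, Measure.prod_apply hs, eq_comm] at hmap

lemma measure_forall_notMem_le {X : ℕ → Ω → α} (hX : ∀ i, Measurable (X i)) (h : iIndepFun X P)
    {A : Set α} (hA : MeasurableSet A) {q : ℝ} (hq : ∀ i, ENNReal.ofReal q ≤ P {ω | X i ω ∈ A})
    (n : ℕ) : P {ω | ∀ i < n, X i ω ∉ A} ≤ ENNReal.ofReal (Real.exp (-(n * q))) := by
  have hinter : {ω | ∀ i < n, X i ω ∉ A} = ⋂ i ∈ Finset.range n, X i ⁻¹' Aᶜ := by
    ext ω
    simp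
  have hone : ∀ i ∈ Finset.range n, P (X i ⁻¹' Aᶜ) ≤ ENNReal.ofReal (Real.exp (-q)) :=
    fun i _ => calc
      P (X i ⁻¹' Aᶜ) = 1 - P (X i ⁻¹' A) := prob_compl_eq_one_sub (hX i hA)
      _ ≤ ENNReal.ofReal 1 - ENNReal.ofReal q := by
        rw [ENNReal.ofReal_one]
        exact tsub_le_tsub_left (hq i) 1
      _ ≤ ENNReal.ofReal (Real.exp (-q)) := by
        rw [tsub_le_iff_right]
        refine (ENNReal.ofReal_le_ofReal ?_).trans ENNReal.ofReal_add_le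
        linarith [Real.add_one_le_exp (-q)]
  rw [hinter, h.measure_inter_preimage_eq_mul (Finset.range n) fun i _ => hA.compl]
  refine (Finset.prod_le_pow_card _ _ _ hone).trans_eq ?_
  rw [Finset.card_range, ← ENNReal.ofReal_pow (Real.exp_pos _).le, ← Real.exp_nat_mul, mul_neg]

end Independence

/-- The observation model: independent pairs of a design point `U i` with density `h` and a noise
vector `e i` with density `φ`, independent of each other. -/
structure IsObservationModel {Ω : Type*} [MeasurableSpace Ω] (P : Measure Ω) (h : ℝ → ℝ)
    (φ : Plane → ℝ) (U : ℕ → Ω → ℝ) (e : ℕ → Ω → Plane) : Prop where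
  measurable_design : ∀ i, Measurable (U i)
  measurable_noise : ∀ i, Measurable (e i)
  map_design : ∀ i, P.map (U i) = designLaw h
  map_noise : ∀ i, P.map (e i) = noiseLaw φ
  indepFun : ∀ i, IndepFun (U i) (e i) P
  iIndepFun : iIndepFun (fun i ω => (U i ω, e i ω)) P

/-- Some point of the tube of radius `σ` about the curve has none of the first `n` observations
within `ρ`. -/
def uncovered {Ω : Type*} (γ : ℝ → Plane) (σ : ℝ) (U : ℕ → Ω → ℝ) (e : ℕ → Ω → Plane) (n : ℕ)
    (ρ : ℝ) : Set Ω :=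
  {ω | ∃ x, Metric.infDist x (range γ) ≤ σ ∧ ∀ i < n, ρ < dist x (observation γ U e i ω)}

namespace IsObservationModel
variable {Ω : Type*} [MeasurableSpace Ω] {P : Measure Ω} {h : ℝ → ℝ} {φ : Plane → ℝ}
  {U : ℕ → Ω → ℝ} {e : ℕ → Ω → Plane} {γ T : ℝ → Plane} {ℓ τ σ β : ℝ}

lemma ae_mem_Icc (hM : IsObservationModel P h φ U e) : ∀ᵐ ω ∂P, ∀ i, U i ω ∈ Icc (0 : ℝ) 1 := by
  refine ae_all_iff.2 fun i => ae_of_ae_map (hM.measurable_design i).aemeasurable ?_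
  rw [hM.map_design]
  exact (withDensity_absolutelyContinuous _ _).ae_le (ae_restrict_mem measurableSet_Icc)

lemma ae_norm_le (hM : IsObservationModel P h φ U e) (hφ : IsNoiseDensity σ β φ) :
    ∀ᵐ ω ∂P, ∀ i, ‖e i ω‖ ≤ σ := by
  refine ae_all_iff.2 fun i => ae_of_ae_map (p := fun x => ‖x‖ ≤ σ)
    (hM.measurable_noise i).aemeasurable ?_
  rw [hM.map_noise, noiseLaw, ae_withDensity_iff hφ.measurable.ennreal_ofReal]
  refine ae_of_all _ fun x hx => le_of_not_gt fun hlt => hx ?_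
  rw [hφ.eq_zero x hlt, ENNReal.ofReal_zero]

variable [IsProbabilityMeasure P]

lemma measure_observation_mem_closedBall (hM : IsObservationModel P h φ U e) (hγ : Continuous γ)
    (x : Plane) (δ : ℝ) (i : ℕ) : P {ω | observation γ U e i ω ∈ Metric.closedBall x δ} =
      ∫⁻ u, noiseLaw φ (Metric.closedBall (x - γ u) δ) ∂designLaw h := by
  have hmeas : MeasurableSet {z : ℝ × Plane | γ z.1 + z.2 ∈ Metric.closedBall x δ} :=
    (Metric.isClosed_closedBall.preimage (by fun_prop)).measurableSet
  refine (measure_prodMk_mem_eq_lintegral (hM.measurable_design i) (hM.measurable_noise i)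
    (hM.indepFun i) hmeas).trans ?_
  rw [hM.map_design, hM.map_noise]
  congr! with u
  ext v
  simp only [Set.mem_ofPred_eq, mem_closedBall_iff_norm, sub_sub_eq_add_sub, add_comm]

lemma exists_le_measure_observation_mem (hM : IsObservationModel P h φ U e)
    (hC : IsClosedFrame γ T ℓ τ) (hσ : 0 < σ) (hστ : σ ≤ τ) (hh : IsDesignDensity h)
    (hφ : IsNoiseDensity σ β φ) : ∃ c > 0, ∃ η > 0, ∀ δ, 0 < δ → δ < η →
      ∀ x, Metric.infDist x (range γ) ≤ σ → ∀ i, ENNReal.ofReal (c * δ ^ (2 + (β + 1 / 2))) ≤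
        P {ω | observation γ U e i ω ∈ Metric.closedBall x δ} := by
  obtain ⟨c₁, hc₁, η₁, hη₁, hdesign⟩ := hC.exists_le_designLaw hσ hστ hh
  obtain ⟨c₂, hc₂, η₂, hη₂, hnoise⟩ := hφ.exists_le_noiseLaw_closedBall hσ
  refine ⟨c₂ * c₁, by positivity, min η₁ η₂, by positivity, fun δ hδ hδη x hx i => ?_⟩
  obtain ⟨hδ₁, hδ₂⟩ := lt_min_iff.1 hδη
  have hγ := hC.isNormalFrame.continuous
  have hI : MeasurableSet {u | ‖x - γ u‖ ≤ σ + δ / 4} :=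
    (isClosed_le (by fun_prop) continuous_const).measurableSet
  calc ENNReal.ofReal (c₂ * c₁ * δ ^ (2 + (β + 1 / 2)))
      = ENNReal.ofReal (c₂ * δ ^ (2 + β)) * ENNReal.ofReal (c₁ * √δ) := by
        rw [← ENNReal.ofReal_mul (by positivity), mul_mul_mul_comm, Real.sqrt_eq_rpow,
          ← Real.rpow_add hδ, add_assoc]
    _ ≤ ENNReal.ofReal (c₂ * δ ^ (2 + β)) * designLaw h {u | ‖x - γ u‖ ≤ σ + δ / 4} := by
        gcongr
        exact hdesign δ hδ hδ₁ x hx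
    _ = ∫⁻ _ in {u | ‖x - γ u‖ ≤ σ + δ / 4}, ENNReal.ofReal (c₂ * δ ^ (2 + β)) ∂designLaw h :=
        (setLIntegral_const _ _).symm
    _ ≤ ∫⁻ u in {u | ‖x - γ u‖ ≤ σ + δ / 4},
          noiseLaw φ (Metric.closedBall (x - γ u) δ) ∂designLaw h :=
        setLIntegral_mono' hI fun u hu => hnoise δ hδ hδ₂ _ hu
    _ ≤ ∫⁻ u, noiseLaw φ (Metric.closedBall (x - γ u) δ) ∂designLaw h :=
        setLIntegral_le_lintegral _ _
    _ = P {ω | observation γ U e i ω ∈ Metric.closedBall x δ} :=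
        (hM.measure_observation_mem_closedBall hγ x δ i).symm

lemma measure_uncovered_le (hM : IsObservationModel P h φ U e) (hγ : Continuous γ) {δ q : ℝ}
    {A : Finset Plane}
    (hcover : ∀ x, Metric.infDist x (range γ) ≤ σ → ∃ y ∈ A, dist x y ≤ δ)
    (hq : ∀ y ∈ A, ∀ i, ENNReal.ofReal q ≤ P {ω | observation γ U e i ω ∈ Metric.closedBall y δ})
    (n : ℕ) : P (uncovered γ σ U e n (2 * δ)) ≤ ENNReal.ofReal (A.card * Real.exp (-(n * q))) := by
  have hpair : Measurable fun z : ℝ × Plane => γ z.1 + z.2 := by fun_prop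
  have hmeas : ∀ i, Measurable (observation γ U e i) := fun i =>
    hpair.comp ((hM.measurable_design i).prodMk (hM.measurable_noise i))
  have hindep : ProbabilityTheory.iIndepFun (observation γ U e) P :=
    hM.iIndepFun.comp (fun _ z => γ z.1 + z.2) fun _ => hpair
  have hsub : uncovered γ σ U e n (2 * δ) ⊆
      ⋃ y ∈ A, {ω | ∀ i < n, observation γ U e i ω ∉ Metric.closedBall y δ} := by
    rintro ω ⟨x, hx, hfar⟩
    obtain ⟨y, hy, hxy⟩ := hcover x hx
    refine mem_iUnion₂.2 ⟨y, hy, fun i hi hmem => (hfar i hi).not_ge ?_⟩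
    rw [two_mul]
    exact (dist_triangle_right _ _ y).trans (add_le_add hxy hmem)
  calc P (uncovered γ σ U e n (2 * δ))
      ≤ ∑ y ∈ A, P {ω | ∀ i < n, observation γ U e i ω ∉ Metric.closedBall y δ} :=
        (measure_mono hsub).trans (measure_biUnion_finset_le _ _)
    _ ≤ A.card • ENNReal.ofReal (Real.exp (-(n * q))) :=
        Finset.sum_le_card_nsmul _ _ _ fun y hy =>
          measure_forall_notMem_le hmeas hindep measurableSet_closedBall (hq y hy) n
    _ = ENNReal.ofReal (A.card * Real.exp (-(n * q))) := by
        rw [nsmul_eq_mul, ENNReal.ofReal_mul (Nat.cast_nonneg _), ENNReal.ofReal_natCast]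

end IsObservationModel

/-! ### Nets -/

lemma exists_finset_isSeparated_isCover {X : Type*} [PseudoEMetricSpace X] {S : Set X}
    (hS : TotallyBounded S) {δ : NNReal} (hδ : δ ≠ 0) : ∃ A : Finset X,
      ↑A ⊆ S ∧ Metric.IsSeparated δ (A : Set X) ∧ Metric.IsCover δ S A := by
  obtain ⟨N, -, hN, hcover⟩ := Metric.exists_finite_isCover_of_totallyBounded
    (div_ne_zero hδ two_ne_zero) hS
  have hpacking : Metric.packingNumber δ S ≠ ⊤ := by
    have hle := Metric.packingNumber_two_mul_le_externalCoveringNumber (δ / 2) S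
    rw [mul_div_cancel₀ _ two_ne_zero] at hle
    exact ((hle.trans hcover.externalCoveringNumber_le_encard).trans_lt hN.encard_lt_top).ne
  have hfin : (Metric.maximalSeparatedSet δ S).Finite := by
    rwa [← encard_ne_top_iff, Metric.encard_maximalSeparatedSet hpacking]
  refine ⟨hfin.toFinset, ?_⟩
  rw [hfin.coe_toFinset]
  exact ⟨Metric.maximalSeparatedSet_subset, Metric.isSeparated_maximalSeparatedSet,
    Metric.isCover_maximalSeparatedSet hpacking⟩

section FiniteDimensional
variable {E : Type*} [NormedAddCommGroup E] [NormedSpace ℝ E] [FiniteDimensional ℝ E]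

lemma card_mul_pow_finrank_le_of_isSeparated {A : Finset E} {z : E} {R : ℝ} {δ : NNReal}
    (hδ : 0 < δ) (hR : 0 ≤ R) (hA : ↑A ⊆ Metric.closedBall z R)
    (hsep : Metric.IsSeparated δ (A : Set E)) :
    (A.card : ℝ) * (δ / 2) ^ Module.finrank ℝ E ≤ (R + δ / 2) ^ Module.finrank ℝ E := by
  borelize E
  let μ : Measure E := Measure.addHaar
  have hδ' : (0 : ℝ) < δ / 2 := half_pos hδ
  have hdisj : (A : Set E).PairwiseDisjoint fun y => Metric.ball y (δ / 2) :=
    hsep.mono' fun x y hxy => Metric.ball_disjoint_ball (by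
      rw [edist_nndist, ENNReal.coe_lt_coe] at hxy
      rw [add_halves]
      exact hxy.le)
  have hsub : ⋃ y ∈ A, Metric.ball y (δ / 2 : ℝ) ⊆ Metric.ball z (R + δ / 2) :=
    iUnion₂_subset fun y hy => Metric.ball_subset_ball' (by
      linarith [Metric.mem_closedBall.1 (hA hy)])
  have hvol : ENNReal.ofReal (A.card * (δ / 2) ^ Module.finrank ℝ E) * μ (Metric.ball 0 1) ≤
      ENNReal.ofReal ((R + δ / 2) ^ Module.finrank ℝ E) * μ (Metric.ball 0 1) := calc
    _ = ∑ y ∈ A, μ (Metric.ball y (δ / 2)) := by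
      simp only [μ.addHaar_ball_of_pos _ hδ', Finset.sum_const, nsmul_eq_mul]
      rw [ENNReal.ofReal_mul (Nat.cast_nonneg _), ENNReal.ofReal_natCast, mul_assoc]
    _ = μ (⋃ y ∈ A, Metric.ball y (δ / 2)) :=
      (measure_biUnion_finset hdisj fun _ _ => Metric.isOpen_ball.measurableSet).symm
    _ ≤ μ (Metric.ball z (R + δ / 2)) := measure_mono hsub
    _ = _ := μ.addHaar_ball_of_pos _ (by positivity)
  exact (ENNReal.ofReal_le_ofReal_iff (by positivity)).1 ((ENNReal.mul_le_mul_iff_left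
    (Metric.measure_ball_pos μ 0 one_pos).ne' measure_ball_lt_top.ne).1 hvol)

lemma exists_net {S : Set E} (hS : Bornology.IsBounded S) : ∃ K > 0, ∀ δ : ℝ, 0 < δ → δ ≤ 1 →
    ∃ A : Finset E, ↑A ⊆ S ∧ (A.card : ℝ) ≤ K / δ ^ Module.finrank ℝ E ∧
      ∀ x ∈ S, ∃ y ∈ A, dist x y ≤ δ := by
  have : ProperSpace E := FiniteDimensional.proper ℝ E
  obtain ⟨R, hR, hSR⟩ := hS.subset_closedBall_lt 0 0
  refine ⟨(2 * R + 1) ^ Module.finrank ℝ E, by positivity, fun δ hδ hδ₁ => ?_⟩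
  lift δ to NNReal using hδ.le
  obtain ⟨A, hAS, hsep, hcover⟩ :=
    exists_finset_isSeparated_isCover ((isCompact_closedBall 0 R).totallyBounded.subset hSR)
      (NNReal.coe_pos.1 hδ).ne'
  refine ⟨A, hAS, ?_, fun x hx => ?_⟩
  · calc (A.card : ℝ) ≤ ((R + δ / 2) / (δ / 2)) ^ Module.finrank ℝ E := by
          rw [div_pow, le_div_iff₀ (by positivity)]
          exact card_mul_pow_finrank_le_of_isSeparated (NNReal.coe_pos.1 hδ) hR.le (hAS.trans hSR)
            hsep
      _ = ((2 * R + δ) / δ) ^ Module.finrank ℝ E := by field_simp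
      _ ≤ ((2 * R + 1) / δ) ^ Module.finrank ℝ E := by gcongr
      _ = (2 * R + 1) ^ Module.finrank ℝ E / δ ^ Module.finrank ℝ E := div_pow _ _ _
  · obtain ⟨y, hy, hxy : edist x y ≤ δ⟩ := hcover hx
    exact ⟨y, hy, by rwa [edist_nndist, ENNReal.coe_le_coe] at hxy⟩

end FiniteDimensional

/-! ### The rate -/

lemma tendsto_rate {β : ℝ} (hβ : 0 ≤ β) : Tendsto (rate β) atTop (𝓝 0) := by
  have hlog : Tendsto (fun n : ℕ => Real.log n / n) atTop (𝓝 0) :=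
    Real.isLittleO_log_id_atTop.tendsto_div_nhds_zero.comp tendsto_natCast_atTop_atTop
  have hp : 0 < 1 / (2 + (β + 1 / 2)) := by positivity
  simpa only [Real.zero_rpow hp.ne'] using! hlog.rpow_const (Or.inr hp.le)

lemma eventually_mul_rate_le {β b : ℝ} (hβ : 0 ≤ β) (a : ℝ) (hb : 0 < b) :
    ∀ᶠ n in atTop, a * rate β n ≤ b :=
  ((tendsto_rate hβ).const_mul a).eventually_le_const (by rwa [mul_zero])

lemma one_le_log_natCast {n : ℕ} (hn : 3 ≤ n) : 1 ≤ Real.log n := by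
  have h3 : (3 : ℝ) ≤ n := by exact_mod_cast hn
  rw [Real.le_log_iff_exp_le (by linarith)]
  linarith [Real.exp_one_lt_d9]

lemma rate_pos (β : ℝ) {n : ℕ} (hn : 3 ≤ n) : 0 < rate β n :=
  Real.rpow_pos_of_pos (div_pos (one_pos.trans_le (one_le_log_natCast hn))
    (Nat.cast_pos.2 (by lia))) _

lemma rate_rpow {β : ℝ} (hβ : 0 ≤ β) (n : ℕ) :
    rate β n ^ (2 + (β + 1 / 2)) = Real.log n / n := by
  rw [rate, ← Real.rpow_mul (div_nonneg (Real.log_natCast_nonneg n) n.cast_nonneg),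
    one_div_mul_cancel (by positivity), Real.rpow_one]

lemma one_div_le_rate_sq {β : ℝ} (hβ : 0 ≤ β) {n : ℕ} (hn : 3 ≤ n) :
    1 / (n : ℝ) ≤ rate β n ^ 2 := by
  have hlog := one_le_log_natCast hn
  have hn₀ : (0 : ℝ) < n := Nat.cast_pos.2 (by lia)
  have hx : Real.log n / n ≤ 1 := by
    rw [div_le_one hn₀]
    linarith [Real.log_le_sub_one_of_pos hn₀]
  calc 1 / (n : ℝ) ≤ Real.log n / n := by gcongr
    _ = rate β n ^ (2 + (β + 1 / 2)) := (rate_rpow hβ n).symm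
    _ ≤ rate β n ^ (2 : ℝ) := by
      refine Real.rpow_le_rpow_of_exponent_ge (rate_pos β hn) ?_ (by linarith)
      exact Real.rpow_le_one (by positivity) hx (by positivity)
    _ = rate β n ^ 2 := Real.rpow_two _

lemma three_mul_log_le {β a c : ℝ} (hβ : 0 ≤ β) (ha : 1 ≤ a) (hc : 0 ≤ c) (hac : 3 ≤ a * c)
    {n : ℕ} (hn : n ≠ 0) :
    3 * Real.log n ≤ n * (c * (a * rate β n) ^ (2 + (β + 1 / 2))) := by
  have hpow : a ≤ a ^ (2 + (β + 1 / 2)) := Real.self_le_rpow_of_one_le ha (by linarith)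
  have := Real.log_natCast_nonneg n
  have hrate : 0 ≤ rate β n := Real.rpow_nonneg (by positivity) _
  calc 3 * Real.log n ≤ a ^ (2 + (β + 1 / 2)) * c * Real.log n := by
        gcongr
        exact hac.trans (by gcongr)
    _ = n * (c * (a ^ (2 + (β + 1 / 2)) * (Real.log n / n))) := by field_simp
    _ = n * (c * (a * rate β n) ^ (2 + (β + 1 / 2))) := by
        rw [Real.mul_rpow (by linarith) hrate, rate_rpow hβ]

lemma mul_exp_neg_le {k K δ q : ℝ} {n : ℕ} (hn : n ≠ 0) (hK : 0 ≤ K) (hk : k ≤ K / δ ^ 2)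
    (hδ : 1 / (n : ℝ) ≤ δ ^ 2) (hq : 3 * Real.log n ≤ q) :
    k * Real.exp (-q) ≤ K / n ^ 2 := by
  have hn₀ : (0 : ℝ) < n := Nat.cast_pos.2 (Nat.pos_of_ne_zero hn)
  have hexp : Real.exp (-q) ≤ 1 / (n : ℝ) ^ 3 := calc
    Real.exp (-q) ≤ Real.exp (-(3 * Real.log n)) := by gcongr
    _ = 1 / (n : ℝ) ^ 3 := by
      rw [Real.exp_neg, mul_comm, Real.exp_mul, Real.exp_log hn₀, one_div]
      norm_cast
  calc k * Real.exp (-q) ≤ K / (1 / n) * Real.exp (-q) := by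
        gcongr
        exact hk.trans (by gcongr)
    _ ≤ K / (1 / n) * (1 / (n : ℝ) ^ 3) := by gcongr
    _ = K / n ^ 2 := by field_simp

/-! ### The observations as a sample of the tube -/

lemma IsNormalFrame.isBounded_tube {γ N : ℝ → Plane} {τ : ℝ} (h : IsNormalFrame γ N τ) (σ : ℝ) :
    Bornology.IsBounded {x | Metric.infDist x (range γ) ≤ σ} := by
  refine (h.isCompact_range.isBounded.cthickening (δ := σ)).subset fun x hx => ?_
  obtain ⟨y, hy, hxy⟩ := h.isCompact_range.exists_infDist_eq_dist (range_nonempty γ) x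
  exact Metric.mem_cthickening_of_dist_le x y σ _ hy (hxy ▸ hx)

lemma IsNormalFrame.isTubeSample {Ω : Type*} {γ N : ℝ → Plane} {τ σ ρ : ℝ}
    (hF : IsNormalFrame γ N τ) {U : ℕ → Ω → ℝ} {e : ℕ → Ω → Plane} {n : ℕ} {ω : Ω}
    (he : ∀ i, ‖e i ω‖ ≤ σ) (hρ : 0 < ρ) (hρσ : ρ ≤ σ) (hsmall : 16 * ρ ≤ τ - σ)
    (hcover : ω ∉ uncovered γ σ U e n (ρ / 2)) :
    IsTubeSample γ N τ σ ρ ((Finset.range n).image fun i => observation γ U e i ω) where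
  frame := hF
  pos := hρ
  le := hρσ
  small := hsmall
  subset c hc := by
    obtain ⟨i, -, rfl⟩ := Finset.mem_image.1 hc
    refine (Metric.infDist_le_dist_of_mem (mem_range_self (U i ω))).trans ?_
    rw [observation, dist_self_add_left]
    exact he i
  dense x hx := by
    by_contra! hne
    exact hcover ⟨x, hx, fun i hi => hne _ (Finset.mem_image_of_mem _ (Finset.mem_range.2 hi))⟩

namespace IsObservationModel
variable {Ω : Type*} [MeasurableSpace Ω] {P : Measure Ω} [IsProbabilityMeasure P] {h : ℝ → ℝ}
  {φ : Plane → ℝ} {U : ℕ → Ω → ℝ} {e : ℕ → Ω → Plane} {f γ T : ℝ → Plane} {ℓ τ σ β : ℝ}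

lemma exists_measure_uncovered_le (hM : IsObservationModel P h φ U e)
    (hC : IsClosedFrame γ T ℓ τ) (hσ : 0 < σ) (hστ : σ ≤ τ) (hβ : 0 ≤ β)
    (hh : IsDesignDensity h) (hφ : IsNoiseDensity σ β φ) :
    ∃ C₀ > 0, ∃ K : ℝ, ∀ C, C₀ ≤ C → ∀ᶠ n : ℕ in atTop,
      P (uncovered γ σ U e n (C * rate β n / 2)) ≤ ENNReal.ofReal (K / n ^ 2) := by
  obtain ⟨c, hc, η, hη, hball⟩ := hM.exists_le_measure_observation_mem hC hσ hστ hh hφ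
  obtain ⟨K, hK, hnet⟩ := exists_net (hC.isNormalFrame.isBounded_tube σ)
  rw [finrank_euclideanSpace_fin] at hnet
  refine ⟨4 * max 1 (3 / c), by positivity, K, fun C hC₀ => ?_⟩
  obtain ⟨a, rfl⟩ : ∃ a, C = 4 * a := ⟨C / 4, by ring⟩
  obtain ⟨ha, hac⟩ := max_le_iff.1 (le_of_mul_le_mul_left hC₀ four_pos)
  rw [div_le_iff₀ hc] at hac
  filter_upwards [eventually_mul_rate_le hβ a (half_pos hη), eventually_mul_rate_le hβ a one_pos,
    eventually_ge_atTop 3] with n hnη hn₁ hn₃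
  have hrate := rate_pos β hn₃
  have hδ : 0 < a * rate β n := by positivity
  obtain ⟨A, hA, hcard, hcover⟩ := hnet _ hδ hn₁
  rw [show 4 * a * rate β n / 2 = 2 * (a * rate β n) by ring]
  refine (hM.measure_uncovered_le hC.isNormalFrame.continuous hcover (fun y hy =>
    hball _ hδ (by linarith) y (hA hy)) n).trans (ENNReal.ofReal_le_ofReal ?_)
  refine mul_exp_neg_le (by lia) hK.le hcard ((one_div_le_rate_sq hβ hn₃).trans ?_)
    (three_mul_log_le hβ ha hc.le hac (by lia))
  gcongr
  exact le_mul_of_one_le_left hrate.le ha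

lemma exists_measure_not_isTubeSample_le (hM : IsObservationModel P h φ U e)
    (hC : IsClosedFrame γ T ℓ τ) (hf : EqOn f γ (Icc 0 1)) (hσ : 0 < σ) (hστ : σ < τ)
    (hβ : 0 ≤ β) (hh : IsDesignDensity h) (hφ : IsNoiseDensity σ β φ) :
    ∃ C₀ > 0, ∃ K : ℝ, ∀ C, C₀ ≤ C → ∀ᶠ n : ℕ in atTop,
      P {ω | ¬ IsTubeSample γ (fun s => perp (T s)) τ σ (C * rate β n)
        ((Finset.range n).image fun i => observation f U e i ω)} ≤ ENNReal.ofReal (K / n ^ 2) := by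
  obtain ⟨C₀, hC₀, K, hK⟩ := hM.exists_measure_uncovered_le hC hσ hστ.le hβ hh hφ
  refine ⟨C₀, hC₀, K, fun C hCC => ?_⟩
  filter_upwards [hK C hCC, eventually_mul_rate_le hβ C hσ,
    eventually_mul_rate_le hβ (16 * C) (sub_pos.2 hστ), eventually_ge_atTop 3]
    with n hn hnσ hnτ hn₃
  refine (measure_mono_ae ?_).trans hn
  filter_upwards [hM.ae_mem_Icc, hM.ae_norm_le hφ] with ω hU he hsample
  by_contra hcover
  refine hsample ?_
  simp only [observation, hf (hU _)]
  exact hC.isNormalFrame.isTubeSample he (mul_pos (hC₀.trans_le hCC) (rate_pos β hn₃)) hnσ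
    (by linarith) hcover

end IsObservationModel

/-! ### From bad events to stochastic bounds -/

section BadEvents
variable {Ω : Type*} [MeasurableSpace Ω] {P : Measure Ω} {A : ℕ → Set Ω}

lemma ae_eventually_notMem_of_eventually_le {u : ℕ → ℝ} (hu : Summable u)
    (h : ∀ᶠ n in atTop, P (A n) ≤ ENNReal.ofReal (u n)) : ∀ᵐ ω ∂P, ∀ᶠ n in atTop, ω ∉ A n := by
  obtain ⟨m, hm⟩ := eventually_atTop.1 h
  have hsum : ∑' n, P (A (n + m)) ≠ ∞ :=
    ne_top_of_le_ne_top ((summable_nat_add_iff m).2 hu).tsum_ofReal_ne_top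
      (ENNReal.tsum_le_tsum fun n => hm (n + m) (Nat.le_add_left m n))
  filter_upwards [ae_eventually_notMem hsum] with ω hω
  rwa [← map_add_atTop_eq_nat m, eventually_map]

lemma tendsto_measure_zero_of_eventually_le {u : ℕ → ℝ} (hu : Summable u)
    (h : ∀ᶠ n in atTop, P (A n) ≤ ENNReal.ofReal (u n)) :
    Tendsto (fun n => P (A n)) atTop (𝓝 0) := by
  have hlim := ENNReal.tendsto_ofReal hu.tendsto_atTop_zero
  rw [ENNReal.ofReal_zero] at hlim
  exact tendsto_of_tendsto_of_tendsto_of_le_of_le' tendsto_const_nhds hlim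
    (Eventually.of_forall fun _ => zero_le) h

lemma isBigOP_of_tendsto_measure_zero {X : ℕ → Ω → ℝ≥0∞} {r : ℕ → ℝ} {K : ℝ} (hK : 0 < K)
    (hA : Tendsto (fun n => P (A n)) atTop (𝓝 0))
    (hX : ∀ᶠ n in atTop, ∀ ω ∉ A n, X n ω ≤ ENNReal.ofReal (K * r n)) : IsBigOP P X r := by
  refine fun η hη => ⟨K, hK, ?_⟩
  filter_upwards [hX, hA.eventually_le_const (ENNReal.ofReal_pos.2 hη)] with n hn hAη
  exact (measure_mono fun ω hω => by_contra fun hωA => (hn ω hωA).not_gt hω).trans hAη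

end BadEvents

lemma unionOfBalls_eq_biUnion_image (y : ℕ → Plane) (n : ℕ) (ρ : ℝ) :
    unionOfBalls y n ρ = ⋃ c ∈ (Finset.range n).image y, Metric.closedBall c ρ := by
  rw [unionOfBalls, Finset.set_biUnion_finset_image]

lemma summable_const_div_sq (K : ℝ) : Summable fun n : ℕ => K / (n : ℝ) ^ 2 := by
  simpa only [div_eq_mul_inv] using! (Real.summable_nat_pow_inv.2 one_lt_two).mul_left K

end Filament

theorem mainTheorem5 {Ω : Type*} [MeasurableSpace Ω] (P : Measure Ω) [IsProbabilityMeasure P]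
    (f : ℝ → Filament.Plane) (hf : Filament.IsSimpleClosedCurve f)
    (hf_arc : Filament.IsArclengthParametrized f)
    (σ β : ℝ) (hσ : 0 < σ) (hβ : 0 ≤ β)
    (hσ_thick : ENNReal.ofReal σ < Filament.thickness (Filament.trace f))
    (h : ℝ → ℝ) (hh : Filament.IsDesignDensity h)
    (φ : Filament.Plane → ℝ) (hφ : Filament.IsNoiseDensity σ β φ)
    (U : ℕ → Ω → ℝ) (ε : ℕ → Ω → Filament.Plane)
    (hU : ∀ i, Measurable (U i)) (hε : ∀ i, Measurable (ε i))
    (hU_law : ∀ i, P.map (U i) = Filament.designLaw h)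
    (hε_law : ∀ i, P.map (ε i) = Filament.noiseLaw φ)
    (hUε : ∀ i, IndepFun (U i) (ε i) P)
    (h_indep : iIndepFun (fun i ω => (U i ω, ε i ω)) P) :
    ∃ C₀ : ℝ, 0 < C₀ ∧ ∀ C : ℝ, C₀ ≤ C →
      ∀ S_hat : ℕ → Ω → Set Filament.Plane,
      (∀ n ω, S_hat n ω = Filament.unionOfBalls
        (fun i => Filament.observation f U ε i ω) n (C * Filament.rate β n)) →
      (∀ᵐ ω ∂P, ∀ᶠ n in atTop,
        (∃ f_hat, Filament.IsMedialFit (S_hat n ω) f_hat) ∧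
        ∀ f_hat, Filament.IsMedialFit (S_hat n ω) f_hat →
          Filament.IsPiecewiseContinuous f_hat ∧
          (∃ f_star, Filament.IsCompletion f_hat f_star) ∧
          ∀ f_star, Filament.IsCompletion f_hat f_star →
            Filament.IsSimpleClosedCurve f_star) ∧
      Filament.IsBigOP P
        (fun n ω => ⨆ f_star ∈ Filament.completedMedialEstimators (S_hat n ω),
          Metric.hausdorffEDist (Filament.trace f_star) (Filament.trace f))
        (Filament.rate β) := by
  open Filament in
  obtain ⟨γ, T, ℓ, τ, hC, hστ, hfγ, hrange⟩ := exists_isClosedFrame hf hf_arc hσ.le hσ_thick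
  obtain ⟨w, hw, hinner⟩ := hC.exists_half_le_inner_tangent
  have hM : IsObservationModel P h φ U ε := ⟨hU, hε, hU_law, hε_law, hUε, h_indep⟩
  obtain ⟨C₀, hC₀, K, hK⟩ := hM.exists_measure_not_isTubeSample_le hC hfγ hσ hστ hβ hh hφ
  refine ⟨C₀, hC₀, fun C hCC S_hat hS => ?_⟩
  simp only [hS, unionOfBalls_eq_biUnion_image]
  constructor
  · filter_upwards [ae_eventually_notMem_of_eventually_le (summable_const_div_sq K) (hK C hCC)]
      with ω hω
    filter_upwards [hω] with n hn
    have hY := not_not.1 hn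
    refine ⟨hY.isBoundaryPair.exists_isMedialFit, fun F hF => ?_⟩
    have hpc := hY.isPiecewiseContinuous_of_isMedialFit hF
    exact ⟨hpc, hpc.exists_isCompletion, fun G => hY.isSimpleClosedCurve_of_isCompletion hF⟩
  · refine isBigOP_of_tendsto_measure_zero (mul_pos (hausdorffConst_pos hσ hστ) (hC₀.trans_le hCC))
      (tendsto_measure_zero_of_eventually_le (summable_const_div_sq K) (hK C hCC)) ?_
    filter_upwards [eventually_mul_rate_le hβ (deviationConst τ σ * C) (pow_pos hC.radius_pos 2),
      eventually_mul_rate_le hβ (2 * (deviationConst τ σ + σ) * C)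
        (pow_pos (mul_pos (half_pos hC.speed_pos) hw) 2)] with n h₁ h₂ ω hω
    rw [mul_assoc] at h₁ h₂ ⊢
    rw [← hrange]
    exact (not_not.1 hω).iSup_hausdorffEDist_le hC hinner hw.le h₁ h₂
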